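/- **Strong BV-categories.** A compact closed category $(\mathbf D,\boxtimes,J,(\cdot)^\perp)$ (symmetric monoidal with chosen duals, units $J\to A^\perp\boxtimes A$ and counits $\epsilon_A:A\boxtimes A^\perp\to J$) is *strict* if its monoidal structure is strict and the canonical isomorphisms $A^\perp\boxtimes B^\perp\cong(A\boxtimes B)^\perp$ and $A\cong A^{\perp\perp}$ are identities. It is $*$-autonomous with dualizing object $J$. In a $*$-autonomous category put $A⅋B=(A^\perp\otimes B^\perp)^\perp$. A *strong BV-category* $\langle\mathbf C,\otimes,<,I,(\cdot)^\perp,U\rangle$ consists of: a $*$-autonomous category $(\mathbf C,\otimes,I,(\cdot)^\perp)$ with an isomorphism $I^\perp\cong I$; a monoidal structure $(<,I)$ on $\mathbf C$; a natural isomorphism $\kappa_{AB}:A^\perp<B^\perp\cong(A<B)^\perp$; a natural transformation $q_{ABCD}:(A⅋B)<(C⅋D)\to(A<C)⅋(B<D)$; and a faithful strict $*$-autonomous functor $U:\mathbf C\to\mathbf D$ into a strict compact closed category such that $U$ is strict monoidal from $(<,I)$ to $(\boxtimes,J)$, $U(\kappa_{AB})=\mathrm{id}$, and $U(q_{ABCD})=\mathrm{id}_{UA}\boxtimes\sigma_{UB,UC}\boxtimes\mathrm{id}_{UD}$,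 where $\sigma$ is the symmetry. **The category $\mathbf{CP}^*[\mathbf{FHilb_{sk}}]$.** $\mathbf{FHilb_{sk}}$ has objects $\mathbb C^n$ ($n\in\mathbb N$), morphisms the complex matrices, dagger the conjugate transpose and tensor product the Kronecker product. An object of $\mathbf D=\mathbf{CP}^*[\mathbf{FHilb_{sk}}]$ is a special symmetric dagger Frobenius structure $A=(\mathbb C^n,m_A,u_A)$: a monoid with $(m\otimes1)(1\otimes m^\dagger)=(1\otimes m)(m^\dagger\otimes1)$, $mm^\dagger=1$ and $u^\dagger m=u^\dagger m\sigma$. A morphism $A\to B$ is a matrix $f$ such that $(1\otimes m_B)(1\otimes f\otimes1)(m_A^\dagger\otimes1)=g^\dagger g$ for some $g$ with domain $A\otimes B$. On $\mathbf D$, $A\boxtimes B$ is the product Frobenius structure, morphisms are tensored by the Kronecker product, $J=\mathbb C$ with its multiplication, $\sigma(e_i\otimes e_j)=e_j\otimes e_i$, $A^\perp$ is the entrywise complex conjugate Frobenius structure on $\mathbb C^n$, and $\epsilon_A(e_i\otimes e_j)=\delta_{ij}$. **The category $\mathrm{Caus}[\mathbf D]$** (Simmons–Kissinger). For $c\subseteq\mathbf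 D(J,A)$ let $c^*=\{\pi\in\mathbf D(A,J):\pi\rho=1\ \forall\rho\in c\}$ and $c^{**}=\{\rho\in\mathbf D(J,A):\pi\rho=1\ \forall\pi\in c^*\}$. An object of $\mathrm{Caus}[\mathbf D]$ is a pair $(A,c_A)$, with $A$ an object of $\mathbf D$ and $c_A\subseteq\mathbf D(J,A)$, which is closed ($c_A=c_A^{**}$) and flat (there are $\lambda,\mu>0$ with $\lambda u_A\in c_A$ and $\mu u_A^\dagger\in c_A^*$). A morphism $(A,c_A)\to(B,c_B)$ is a morphism $f:A\to B$ of $\mathbf D$ with $f\rho\in c_B$ for all $\rho\in c_A$. Let $U:\mathrm{Caus}[\mathbf D]\to\mathbf D$, $(A,c_A)\mapsto A$, be the forgetful functor. Put - $I=(J,\{1\})$, - $(A,c_A)^*=(A^\perp,\{\pi^{T}:\pi\in c_A^*\})$, - $(A,c_A)\otimes(B,c_B)=(A\boxtimes B,\{\rho\otimes\tau:\rho\in c_A,\tau\in c_B\}^{**})$, - $(A,c_A)<(B,c_B)=(A\boxtimes B,\{h:\exists m\in c_A\ \forall\pi\in c_B^*,\ (1_A\otimes\pi)h=m\})$. **Theorem.**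 These assignments define objects of $\mathrm{Caus}[\mathbf{CP}^*[\mathbf{FHilb_{sk}}]]$ and are the object parts of structures for which $\langle\mathrm{Caus}[\mathbf{CP}^*[\mathbf{FHilb_{sk}}]],\otimes,<,I,(\cdot)^*,U\rangle$ is a strong BV-category, with target the category $\mathbf{CP}^*[\mathbf{FHilb_{sk}}]$, which, with the structure described above, is a strict compact closed category. The dualizing object is $I$. -/

import Mathlib

open CategoryTheory MonoidalCategory
open scoped Kronecker

/-! ## *-autonomous, compact closed and strong BV-categories -/

section Abstract

universe v u v' u'

/-- A *-autonomous category, presented by a dualizing object: a symmetric monoidal category with an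
object `bot`, for every `A` an object `dual A` representing the internal hom from `A` to `bot` (with
evaluation `ev` and transposition `lift`), such that the canonical maps `A ⟶ dual (dual A)` are
invertible. The functor `(-)^⊥` is `dual` with `dualMap` below; `bot` is canonically `dual 𝟙`. -/
class StarAutonomous (C : Type u) [Category.{v} C] [MonoidalCategory C] [SymmetricCategory C] where
  bot : C
  dual : C → C
  ev : ∀ A : C, A ⊗ dual A ⟶ bot
  lift : ∀ {A X : C}, (A ⊗ X ⟶ bot) → (X ⟶ dual A)
  lift_ev : ∀ {A X : C} (p : A ⊗ X ⟶ bot), A ◁ lift p ≫ ev A = p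
  lift_unique : ∀ {A X : C} (f : X ⟶ dual A), lift (A ◁ f ≫ ev A) = f
  reflexive : ∀ A : C, IsIso (lift ((β_ (dual A) A).hom ≫ ev A))

namespace StarAutonomous

variable {C : Type u} [Category.{v} C] [MonoidalCategory C] [SymmetricCategory C] [StarAutonomous C]

/-- The action `f^⊥` of the duality on morphisms. -/
def dualMap {A B : C} (f : A ⟶ B) : dual B ⟶ dual A :=
  lift (f ▷ dual B ≫ ev B)

/-- The double dual map `A ⟶ A^⊥⊥`. -/
def doubleDual (A : C) : A ⟶ dual (dual A) :=
  lift ((β_ (dual A) A).hom ≫ ev A)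

/-- `A ⅋ B = (A^⊥ ⊗ B^⊥)^⊥`. -/
def par (A B : C) : C := dual (dual A ⊗ dual B)

def parMap {A A' B B' : C} (f : A ⟶ A') (g : B ⟶ B') : par A B ⟶ par A' B' :=
  dualMap (dualMap f ⊗ₘ dualMap g)

end StarAutonomous

/-- A compact closed category: a symmetric monoidal category with a chosen dual `dual A` of every
object, with unit `𝟙 ⟶ dual A ⊗ A` and counit `A ⊗ dual A ⟶ 𝟙` satisfying the snake equations. -/
class CompactClosed (D : Type u) [Category.{v} D] [MonoidalCategory D] [SymmetricCategory D] where
  dual : D → D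
  pairing : ∀ A : D, ExactPairing (dual A) A

namespace CompactClosed

section

variable {D : Type u} [Category.{v} D] [MonoidalCategory D]

/-- For `Y'` with dual `Y`, bending `Y'` around: `X = 𝟙 ⊗ X ⟶ Y ⊗ Y' ⊗ X ⟶ Y ⊗ 𝟙 = Y`. -/
def bendAlong (Y Y' : D) [ExactPairing Y Y'] {X : D} (p : Y' ⊗ X ⟶ 𝟙_ D) : X ⟶ Y :=
  tensorLeftHomEquiv X Y Y' (𝟙_ D) p ≫ (ρ_ Y).hom

theorem bendAlong_ev (Y Y' : D) [ExactPairing Y Y'] {X : D} (p : Y' ⊗ X ⟶ 𝟙_ D) :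
    Y' ◁ bendAlong Y Y' p ≫ ExactPairing.evaluation Y Y' = p := by
  have h := (tensorLeftHomEquiv X Y Y' (𝟙_ D)).left_inv p
  simp only [tensorLeftHomEquiv] at h
  simp only [bendAlong, tensorLeftHomEquiv, Equiv.coe_fn_mk]
  refine Eq.trans ?_ h
  simp only [MonoidalCategory.whiskerLeft_comp, Category.assoc]
  congr 4
  monoidal

theorem bendAlong_unique (Y Y' : D) [ExactPairing Y Y'] {X : D} (f : X ⟶ Y) :
    bendAlong Y Y' (Y' ◁ f ≫ ExactPairing.evaluation Y Y') = f := by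
  have h := (tensorLeftHomEquiv X Y Y' (𝟙_ D)).right_inv (f ≫ (ρ_ Y).inv)
  have h2 : (tensorLeftHomEquiv X Y Y' (𝟙_ D)).invFun (f ≫ (ρ_ Y).inv)
      = Y' ◁ f ≫ ExactPairing.evaluation Y Y' := by
    simp only [tensorLeftHomEquiv, MonoidalCategory.whiskerLeft_comp, Category.assoc]
    congr 1
    monoidal
  rw [h2] at h
  change (tensorLeftHomEquiv X Y Y' (𝟙_ D)).toFun _ ≫ _ = _
  rw [h]
  simp

end

variable {D : Type u} [Category.{v} D] [MonoidalCategory D] [SymmetricCategory D] [CompactClosed D]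

attribute [reducible, instance] CompactClosed.pairing

/-- The counit `A ⊗ A^⊥ ⟶ 𝟙`. -/
def counit (A : D) : A ⊗ dual A ⟶ 𝟙_ D := ExactPairing.evaluation (dual A) A

/-- The morphism `X ⟶ A^⊥` with `A ◁ bend p ≫ counit A = p`. -/
def bend {A X : D} (p : A ⊗ X ⟶ 𝟙_ D) : X ⟶ dual A := bendAlong (dual A) A p

/-- The double dual map `A ⟶ A^⊥⊥`. -/
def doubleDual (A : D) : A ⟶ dual (dual A) :=
  bend ((β_ (dual A) A).hom ≫ counit A)

theorem isIso_doubleDual (A : D) : IsIso (doubleDual A) := by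
  let _ : ExactPairing A (dual A) := BraidedCategory.exactPairing_swap (dual A) A
  have e : ExactPairing.evaluation A (dual A) = (β_ (dual A) A).hom ≫ counit A := rfl
  have h1 : dual A ◁ doubleDual A ≫ counit (dual A) = ExactPairing.evaluation A (dual A) :=
    bendAlong_ev (dual (dual A)) (dual A) _
  let g : dual (dual A) ⟶ A := bendAlong A (dual A) (counit (dual A))
  have h2 : dual A ◁ g ≫ ExactPairing.evaluation A (dual A) = counit (dual A) :=
    bendAlong_ev A (dual A) _
  refine ⟨g, ?_, ?_⟩
  · rw [← bendAlong_unique A (dual A) (doubleDual A ≫ g), MonoidalCategory.whiskerLeft_comp,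
      Category.assoc, h2, h1, ← bendAlong_unique A (dual A) (𝟙 A)]
    simp
  · rw [← bendAlong_unique (dual (dual A)) (dual A) (g ≫ doubleDual A),
      MonoidalCategory.whiskerLeft_comp, Category.assoc]
    change bendAlong _ _ (dual A ◁ g ≫ dual A ◁ doubleDual A ≫ counit (dual A)) = _
    rw [h1, h2]
    have := bendAlong_unique (dual (dual A)) (dual A) (𝟙 (dual (dual A)))
    simp only [MonoidalCategory.whiskerLeft_id, Category.id_comp] at this
    exact this

/-- Every compact closed category is *-autonomous, with dualizing object the tensor unit. -/
instance toStarAutonomous : StarAutonomous D where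
  bot := 𝟙_ D
  dual := dual
  ev := counit
  lift := bend
  lift_ev := bendAlong_ev _ _
  lift_unique := bendAlong_unique _ _
  reflexive := isIso_doubleDual

/-- The canonical De Morgan map `A^⊥ ⊗ B^⊥ ⟶ (A ⊗ B)^⊥`. -/
def deMorgan (A B : D) : dual A ⊗ dual B ⟶ dual (A ⊗ B) :=
  bend (tensorμ A B (dual A) (dual B) ≫ (counit A ⊗ₘ counit B) ≫ (λ_ (𝟙_ D)).hom)

end CompactClosed

/-- Strictness of a compact closed category: the monoidal structure is strict, and the canonical
De Morgan and double dual isomorphisms are identities. -/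
structure IsStrictCompactClosed (D : Type u) [Category.{v} D] [MonoidalCategory D]
    [SymmetricCategory D] [CompactClosed D] : Prop where
  tensor_assoc : ∀ A B C : D, (A ⊗ B) ⊗ C = A ⊗ (B ⊗ C)
  unit_tensor : ∀ A : D, 𝟙_ D ⊗ A = A
  tensor_unit : ∀ A : D, A ⊗ 𝟙_ D = A
  associator_eq : ∀ A B C : D, (α_ A B C).hom = eqToHom (tensor_assoc A B C)
  leftUnitor_eq : ∀ A : D, (λ_ A).hom = eqToHom (unit_tensor A)
  rightUnitor_eq : ∀ A : D, (ρ_ A).hom = eqToHom (tensor_unit A)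
  dual_tensor : ∀ A B : D,
    CompactClosed.dual A ⊗ CompactClosed.dual B = CompactClosed.dual (A ⊗ B)
  deMorgan_eq : ∀ A B : D, CompactClosed.deMorgan A B = eqToHom (dual_tensor A B)
  dual_dual : ∀ A : D, A = CompactClosed.dual (CompactClosed.dual A)
  doubleDual_eq : ∀ A : D, CompactClosed.doubleDual A = eqToHom (dual_dual A)

/-- `U` is a strict monoidal functor from the monoidal structure `M` to `N`. Equalities of morphisms
are heterogeneous: their sources and targets agree by the equalities of objects. -/
structure IsStrictMonoidal {C : Type u} [Category.{v} C] {D : Type u'} [Category.{v'} D]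
    (M : MonoidalCategory C) (N : MonoidalCategory D) (U : C ⥤ D) : Prop where
  obj_unit : U.obj M.tensorUnit = N.tensorUnit
  obj_tensor : ∀ A B : C, U.obj (M.tensorObj A B) = N.tensorObj (U.obj A) (U.obj B)
  map_tensor : ∀ {A A' B B' : C} (f : A ⟶ A') (g : B ⟶ B'),
    U.map (M.tensorHom f g) ≍ N.tensorHom (U.map f) (U.map g)
  map_associator : ∀ A B E : C,
    U.map (M.associator A B E).hom ≍ (N.associator (U.obj A) (U.obj B) (U.obj E)).hom
  map_leftUnitor : ∀ A : C, U.map (M.leftUnitor A).hom ≍ (N.leftUnitor (U.obj A)).hom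
  map_rightUnitor : ∀ A : C, U.map (M.rightUnitor A).hom ≍ (N.rightUnitor (U.obj A)).hom

/-- `U` preserves all of the *-autonomous structure strictly. -/
structure IsStrictStarAutonomous {C : Type u} [Category.{v} C] [MC : MonoidalCategory C]
    [SymmetricCategory C] [StarAutonomous C] {D : Type u'} [Category.{v'} D]
    [MD : MonoidalCategory D] [SymmetricCategory D] [StarAutonomous D] (U : C ⥤ D) : Prop
    extends IsStrictMonoidal MC MD U where
  map_braiding : ∀ A B : C, U.map (β_ A B).hom ≍ (β_ (U.obj A) (U.obj B)).hom
  obj_bot : U.obj (StarAutonomous.bot : C) = StarAutonomous.bot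
  obj_dual : ∀ A : C, U.obj (StarAutonomous.dual A) = StarAutonomous.dual (U.obj A)
  map_ev : ∀ A : C, U.map (StarAutonomous.ev A) ≍ StarAutonomous.ev (U.obj A)
  map_dual : ∀ {A B : C} (f : A ⟶ B),
    U.map (StarAutonomous.dualMap f) ≍ StarAutonomous.dualMap (U.map f)

/-- A monoidal structure on `C` as a plain datum, used for a second tensor product on `C`. -/
structure MonoidalStructure (C : Type u) [Category.{v} C] where
  str : MonoidalCategory C

namespace MonoidalStructure

variable {C : Type u} [Category.{v} C] (M : MonoidalStructure C)

def unit : C := M.str.tensorUnit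

def obj (A B : C) : C := M.str.tensorObj A B

def hom {A A' B B' : C} (f : A ⟶ A') (g : B ⟶ B') : M.obj A B ⟶ M.obj A' B' :=
  M.str.tensorHom f g

end MonoidalStructure

/-- The structure of a strong BV-category on the category `C`, with target category `D` and functor
`U : C ⥤ D`. The `⊗`-structure of `C` is given by instances; the structure `seq` is the
non-commutative one. -/
structure StrongBVCategory (C : Type u) [Category.{v} C] (D : Type u') [Category.{v'} D]
    (U : C ⥤ D) where
  /-- `⟨C, ⊗, 𝟙, (-)^⊥⟩` is *-autonomous, and isomix. -/
  [tens : MonoidalCategory C]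
  [symm : SymmetricCategory C]
  [star : StarAutonomous C]
  isomix : StarAutonomous.dual (𝟙_ C) ≅ 𝟙_ C
  /-- `⟨C, <, 𝟙⟩` is monoidal, with the same unit object. -/
  seq : MonoidalStructure C
  seq_unit : seq.unit = 𝟙_ C
  /-- The natural isomorphism `A^⊥ < B^⊥ ≅ (A < B)^⊥`. -/
  κ : ∀ A B : C, seq.obj (StarAutonomous.dual A) (StarAutonomous.dual B) ≅
    StarAutonomous.dual (seq.obj A B)
  κ_natural : ∀ {A A' B B' : C} (f : A ⟶ A') (g : B ⟶ B'),
    seq.hom (StarAutonomous.dualMap f) (StarAutonomous.dualMap g) ≫ (κ A B).hom =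
      (κ A' B').hom ≫ StarAutonomous.dualMap (seq.hom f g)
  /-- The natural transformation `(A ⅋ B) < (E ⅋ F) ⟶ (A < E) ⅋ (B < F)`. -/
  q : ∀ A B E F : C, seq.obj (StarAutonomous.par A B) (StarAutonomous.par E F) ⟶
    StarAutonomous.par (seq.obj A E) (seq.obj B F)
  q_natural : ∀ {A A' B B' E E' F F' : C} (a : A ⟶ A') (b : B ⟶ B') (e : E ⟶ E') (f : F ⟶ F'),
    seq.hom (StarAutonomous.parMap a b) (StarAutonomous.parMap e f) ≫ q A' B' E' F' =
      q A B E F ≫ StarAutonomous.parMap (seq.hom a e) (seq.hom b f)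
  /-- `D` is a strict compact closed category. -/
  [tensD : MonoidalCategory D]
  [symmD : SymmetricCategory D]
  [compactD : CompactClosed D]
  strictD : IsStrictCompactClosed D
  /-- `U` is a faithful strict *-autonomous functor, strict monoidal with respect to `<`. -/
  faithful : U.Faithful
  strict_star : IsStrictStarAutonomous U
  strict_seq : IsStrictMonoidal seq.str tensD U
  /-- `U κ` is an identity. -/
  map_κ : ∀ A B : C,
    U.map (κ A B).hom ≍ 𝟙 (CompactClosed.dual (U.obj A) ⊗ CompactClosed.dual (U.obj B))
  /-- `U q` is the interchange `id ⊠ σ ⊠ id`. -/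
  map_q : ∀ A B E F : C,
    U.map (q A B E F) ≍ tensorμ (U.obj A) (U.obj B) (U.obj E) (U.obj F)

end Abstract

/-! ## The category `CP*[FHilb_sk]`

The objects of `FHilb_sk` are the Hilbert spaces `ℂ^n`, its morphisms `ℂ^n ⟶ ℂ^m` the `m × n` complex
matrices, its dagger the conjugate transpose, and its tensor product `ℂ^m ⊗ ℂ^n = ℂ^(m * n)` the
Kronecker product, along the lexicographic bijection `finProdFinEquiv`. -/

/-- An object of `CP*[FHilb_sk]`: a special symmetric dagger Frobenius structure on `ℂ^dim`. The
multiplication `m` is given by its structure constants, `e_i · e_j = ∑ k, mul i j k • e_k`, and the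
unit by its coordinates; the comultiplication `m†` is `e_k ↦ ∑ i j, star (mul i j k) • e_i ⊗ e_j`. -/
@[ext]
structure CPStar where
  dim : ℕ
  mul : Fin dim → Fin dim → Fin dim → ℂ
  unit : Fin dim → ℂ
  assoc : ∀ i j k l, ∑ p, mul i j p * mul p k l = ∑ p, mul j k p * mul i p l
  unit_mul : ∀ j l, ∑ i, unit i * mul i j l = if j = l then 1 else 0
  mul_unit : ∀ i l, ∑ j, unit j * mul i j l = if i = l then 1 else 0
  /-- `(m ⊗ 1) ∘ (1 ⊗ m†) = (1 ⊗ m) ∘ (m† ⊗ 1)` -/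
  frobenius : ∀ i j k l, ∑ p, star (mul p l j) * mul i p k = ∑ p, star (mul k p i) * mul p j l
  /-- `m ∘ m† = 1` -/
  special : ∀ k l, ∑ i, ∑ j, star (mul i j k) * mul i j l = if k = l then 1 else 0
  /-- `unit† ∘ m = unit† ∘ m ∘ swap` -/
  symmetric : ∀ i j, ∑ k, star (unit k) * mul i j k = ∑ k, star (unit k) * mul j i k

namespace CPStar

/-- The endomorphism `(1 ⊗ m_B) ∘ (1 ⊗ f ⊗ 1) ∘ (m_A† ⊗ 1)` of `A ⊗ B` (rows index the output). -/
def choi (A B : CPStar) (f : Matrix (Fin B.dim) (Fin A.dim) ℂ) :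
    Matrix (Fin A.dim × Fin B.dim) (Fin A.dim × Fin B.dim) ℂ :=
  Matrix.of fun o i => ∑ p, ∑ q, star (A.mul o.1 p i.1) * f q p * B.mul q i.2 o.2

/-- The CP condition: `(1 ⊗ m_B) ∘ (1 ⊗ f ⊗ 1) ∘ (m_A† ⊗ 1) = g† ∘ g` for some `g : A ⊗ B ⟶ ℂ^r`. -/
def IsCP (A B : CPStar) (f : Matrix (Fin B.dim) (Fin A.dim) ℂ) : Prop :=
  ∃ (r : ℕ) (g : Matrix (Fin r) (Fin A.dim × Fin B.dim) ℂ), choi A B f = g.conjTranspose * g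

theorem isCP_of_gram (A B : CPStar) (f : Matrix (Fin B.dim) (Fin A.dim) ℂ) {ι : Type} [Fintype ι]
    (g : Matrix ι (Fin A.dim × Fin B.dim) ℂ) (h : choi A B f = g.conjTranspose * g) :
    IsCP A B f := by
  let e := Fintype.equivFin ι
  refine ⟨Fintype.card ι, g.submatrix e.symm id, ?_⟩
  rw [h]
  ext a b
  simp only [Matrix.mul_apply, Matrix.conjTranspose_apply, Matrix.submatrix_apply, id]
  exact (e.symm.sum_comp (fun s => star (g s a) * g s b)).symm

/-- The coordinates of `m† ∘ unit`. -/
def cup (A : CPStar) (b b' : Fin A.dim) : ℂ := ∑ k, A.unit k * star (A.mul b b' k)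

theorem cup_left (A : CPStar) (q b b' : Fin A.dim) :
    ∑ p, A.mul q p b * A.cup p b' = star (A.mul b b' q) := by
  have h : ∑ j, A.unit j * ∑ p, star (A.mul p b' j) * A.mul q p b
      = ∑ j, A.unit j * ∑ p, star (A.mul b p q) * A.mul p j b' := by
    simp_rw [A.frobenius]
  have r : ∑ j, A.unit j * ∑ p, star (A.mul b p q) * A.mul p j b' = star (A.mul b b' q) := by
    simp_rw [Finset.mul_sum]
    rw [Finset.sum_comm]
    have : ∀ p, ∑ j, A.unit j * (star (A.mul b p q) * A.mul p j b')
        = star (A.mul b p q) * (if p = b' then 1 else 0) := by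
      intro p
      rw [← A.mul_unit, Finset.mul_sum]
      exact Finset.sum_congr rfl fun _ _ => by ring
    simp_rw [this]
    simp
  rw [← r, ← h]
  simp only [cup, Finset.mul_sum]
  rw [Finset.sum_comm]
  exact Finset.sum_congr rfl fun _ _ => Finset.sum_congr rfl fun _ _ => by ring

theorem cup_right (A : CPStar) (q b b' : Fin A.dim) :
    ∑ p, A.mul p q b' * A.cup b p = star (A.mul b b' q) := by
  have h : ∑ i, A.unit i * ∑ p, star (A.mul p b' q) * A.mul i p b
      = ∑ i, A.unit i * ∑ p, star (A.mul b p i) * A.mul p q b' := by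
    simp_rw [A.frobenius]
  have r : ∑ i, A.unit i * ∑ p, star (A.mul p b' q) * A.mul i p b = star (A.mul b b' q) := by
    simp_rw [Finset.mul_sum]
    rw [Finset.sum_comm]
    have : ∀ p, ∑ i, A.unit i * (star (A.mul p b' q) * A.mul i p b)
        = star (A.mul p b' q) * (if p = b then 1 else 0) := by
      intro p
      rw [← A.unit_mul, Finset.mul_sum]
      exact Finset.sum_congr rfl fun _ _ => by ring
    simp_rw [this]
    simp
  rw [← r, h]
  simp only [cup, Finset.mul_sum]
  rw [Finset.sum_comm]
  exact Finset.sum_congr rfl fun _ _ => Finset.sum_congr rfl fun _ _ => by ring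

theorem isCP_one (A : CPStar) : IsCP A A 1 := by
  refine isCP_of_gram A A 1 (ι := Fin A.dim) (Matrix.of fun p x => A.mul x.1 x.2 p) ?_
  ext ⟨k, l⟩ ⟨i, j⟩
  simp only [choi, Matrix.mul_apply, Matrix.conjTranspose_apply, Matrix.one_apply, Matrix.of_apply]
  have : ∑ p, star (A.mul k l p) * A.mul i j p = ∑ p, star (A.mul k p i) * A.mul p j l := by
    rw [← A.frobenius]
    calc ∑ p, star (A.mul k l p) * A.mul i j p
        = ∑ p, ∑ b, A.cup b l * (A.mul i j p * A.mul p b k) := by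
          refine Finset.sum_congr rfl fun p _ => ?_
          rw [← A.cup_left, Finset.sum_mul]
          exact Finset.sum_congr rfl fun _ _ => by ring
      _ = ∑ b, A.cup b l * ∑ p, A.mul i j p * A.mul p b k := by
          rw [Finset.sum_comm]; simp_rw [Finset.mul_sum]
      _ = ∑ b, A.cup b l * ∑ p, A.mul j b p * A.mul i p k := by simp_rw [A.assoc]
      _ = ∑ p, ∑ b, A.cup b l * (A.mul j b p * A.mul i p k) := by
          simp_rw [Finset.mul_sum]; rw [Finset.sum_comm]
      _ = ∑ p, star (A.mul p l j) * A.mul i p k := by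
          refine Finset.sum_congr rfl fun p _ => ?_
          rw [← A.cup_left, Finset.sum_mul]
          exact Finset.sum_congr rfl fun _ _ => by ring
  rw [this]
  simp

/-- The sandwich of `X ⊗ Y` by the vector `m† ∘ unit`. -/
def sandwich (A : CPStar) (X Y : Fin A.dim → Fin A.dim → ℂ) : ℂ :=
  ∑ z : Fin A.dim × Fin A.dim, ∑ w : Fin A.dim × Fin A.dim,
    star (A.cup z.1 z.2) * A.cup w.1 w.2 * X z.1 w.1 * Y z.2 w.2

theorem sandwich_left (A : CPStar) {ι : Type} [Fintype ι] (c : ι → ℂ)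
    (X : ι → Fin A.dim → Fin A.dim → ℂ) (Y : Fin A.dim → Fin A.dim → ℂ) :
    A.sandwich (fun b d => ∑ s, c s * X s b d) Y = ∑ s, c s * A.sandwich (X s) Y := by
  simp only [sandwich, Finset.mul_sum, Finset.sum_mul]
  rw [Finset.sum_comm]
  rw [Finset.sum_comm]
  simp_rw [Finset.sum_comm (s := (Finset.univ : Finset ι))]
  refine Finset.sum_congr rfl fun _ _ => Finset.sum_congr rfl fun _ _ =>
    Finset.sum_congr rfl fun _ _ => by ring

theorem sandwich_right (A : CPStar) {ι : Type} [Fintype ι] (c : ι → ℂ)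
    (X : Fin A.dim → Fin A.dim → ℂ) (Y : ι → Fin A.dim → Fin A.dim → ℂ) :
    A.sandwich X (fun b d => ∑ s, c s * Y s b d) = ∑ s, c s * A.sandwich X (Y s) := by
  simp only [sandwich, Finset.mul_sum]
  simp_rw [Finset.sum_comm (s := (Finset.univ : Finset ι))]
  refine Finset.sum_congr rfl fun _ _ => Finset.sum_congr rfl fun _ _ =>
    Finset.sum_congr rfl fun _ _ => by ring

theorem sandwich_mul (A : CPStar) (q p : Fin A.dim) :
    A.sandwich (fun b d => A.mul q d b) (fun b d => star (A.mul b p d))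
      = if q = p then 1 else 0 := by
  have h1 : ∀ b d', ∑ d, A.mul q d b * A.cup d d' = star (A.mul b d' q) := fun b d' =>
    A.cup_left q b d'
  have h2 : ∀ b d', ∑ b', star (A.mul b' p d') * star (A.cup b b') = A.mul b d' p := by
    intro b d'
    have := congrArg star (A.cup_right p b d')
    simpa only [star_sum, star_mul', star_star] using this
  rw [← A.special]
  simp only [sandwich, Fintype.sum_prod_type]
  refine Finset.sum_congr rfl fun b _ => ?_
  calc _ = ∑ d', ∑ b', ∑ d, (A.mul q d b * A.cup d d') *
        (star (A.mul b' p d') * star (A.cup b b')) := by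
        refine ((Finset.sum_congr rfl fun _ _ => Finset.sum_comm).trans Finset.sum_comm).trans ?_
        exact Finset.sum_congr rfl fun _ _ => Finset.sum_congr rfl fun _ _ =>
          Finset.sum_congr rfl fun _ _ => by ring
    _ = _ := by
        refine Finset.sum_congr rfl fun d' _ => ?_
        simp_rw [← Finset.sum_mul, ← Finset.mul_sum, h1, h2]

theorem isCP_mul (A B C : CPStar) (f : Matrix (Fin B.dim) (Fin A.dim) ℂ)
    (g : Matrix (Fin C.dim) (Fin B.dim) ℂ) (hf : IsCP A B f) (hg : IsCP B C g) :
    IsCP A C (g * f) := by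
  obtain ⟨r, G, hG⟩ := hf
  obtain ⟨s, H, hH⟩ := hg
  refine isCP_of_gram A C (g * f) (ι := Fin r × Fin s) (Matrix.of fun u i =>
    ∑ z : Fin B.dim × Fin B.dim, B.cup z.1 z.2 * (G u.1 (i.1, z.1) * H u.2 (z.2, i.2))) ?_
  ext ⟨k, l⟩ ⟨i, j⟩
  have e1 : ∀ b d, choi A B f (k, b) (i, d) = ∑ x, star (G x (k, b)) * G x (i, d) := by
    intro b d; rw [hG]; simp [Matrix.mul_apply]
  have e2 : ∀ b d, choi B C g (b, l) (d, j) = ∑ x, star (H x (b, l)) * H x (d, j) := by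
    intro b d; rw [hH]; simp [Matrix.mul_apply]
  have e3 : B.sandwich (fun b d => choi A B f (k, b) (i, d)) (fun b d => choi B C g (b, l) (d, j))
      = choi A C (g * f) (k, l) (i, j) := by
    have a1 : (fun b d => choi A B f (k, b) (i, d)) = fun b d =>
        ∑ x : Fin A.dim × Fin B.dim, (star (A.mul k x.1 i) * f x.2 x.1) * B.mul x.2 d b := by
      ext b d; simp [choi, Fintype.sum_prod_type]
    have a2 : (fun b d => choi B C g (b, l) (d, j)) = fun b d =>
        ∑ x : Fin B.dim × Fin C.dim, (g x.2 x.1 * C.mul x.2 j l) * star (B.mul b x.1 d) := by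
      ext b d; simp only [choi, Fintype.sum_prod_type, Matrix.of_apply]
      exact Finset.sum_congr rfl fun _ _ => Finset.sum_congr rfl fun _ _ => by ring
    rw [a1, a2, sandwich_left]
    simp_rw [sandwich_right, sandwich_mul]
    simp only [choi, Fintype.sum_prod_type, Matrix.of_apply, Matrix.mul_apply, Finset.mul_sum,
      Finset.sum_mul]
    refine Finset.sum_congr rfl fun x _ => ?_
    rw [Finset.sum_comm (s := (Finset.univ : Finset (Fin C.dim)))]
    refine Finset.sum_congr rfl fun y _ => ?_
    rw [Finset.sum_comm]
    refine Finset.sum_congr rfl fun z _ => ?_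
    simp only [mul_ite, mul_one, mul_zero, Finset.sum_ite_eq, Finset.mem_univ, if_true]
    ring
  rw [← e3]
  simp_rw [e1, e2]
  simp only [sandwich, Matrix.mul_apply, Matrix.conjTranspose_apply, Matrix.of_apply, star_sum,
    star_mul', Finset.mul_sum, Finset.sum_mul]
  refine Eq.trans ?_ ((Finset.sum_comm.trans
    (Finset.sum_congr rfl fun _ _ => Finset.sum_comm)).trans Finset.sum_comm).symm
  refine Finset.sum_congr rfl fun _ _ => Finset.sum_congr rfl fun _ _ => ?_
  rw [Fintype.sum_prod_type_right]
  exact Finset.sum_congr rfl fun _ _ => Finset.sum_congr rfl fun _ _ => by ring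

/-- The morphisms of `CP*[FHilb_sk]`. -/
@[ext]
structure Hom (A B : CPStar) where
  mat : Matrix (Fin B.dim) (Fin A.dim) ℂ
  isCP : IsCP A B mat

instance : Category CPStar where
  Hom := Hom
  id A := ⟨1, isCP_one A⟩
  comp {A B C} f g := ⟨g.mat * f.mat, isCP_mul A B C f.mat g.mat f.isCP g.isCP⟩
  id_comp f := Hom.ext (Matrix.mul_one f.mat)
  comp_id f := Hom.ext (Matrix.one_mul f.mat)
  assoc f g h := Hom.ext (Matrix.mul_assoc h.mat g.mat f.mat).symm

/-- The tensor unit: the Frobenius structure on `ℂ^1` given by multiplication of scalars. -/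
def one : CPStar where
  dim := 1
  mul := fun _ _ _ => 1
  unit := fun _ => 1
  assoc := by simp
  unit_mul := by simp [Subsingleton.elim (_ : Fin 1) 0]
  mul_unit := by simp [Subsingleton.elim (_ : Fin 1) 0]
  frobenius := by simp
  special := by simp [Subsingleton.elim (_ : Fin 1) 0]
  symmetric := by simp

/-- The dual object: the complex conjugate Frobenius structure. -/
def conj (A : CPStar) : CPStar where
  dim := A.dim
  mul := fun i j k => star (A.mul i j k)
  unit := fun i => star (A.unit i)
  assoc i j k l := by simpa only [star_sum, star_mul'] using congrArg star (A.assoc i j k l)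
  unit_mul j l := by
    simpa only [star_sum, star_mul', apply_ite star, star_one, star_zero]
      using congrArg star (A.unit_mul j l)
  mul_unit i l := by
    simpa only [star_sum, star_mul', apply_ite star, star_one, star_zero]
      using congrArg star (A.mul_unit i l)
  frobenius i j k l := by
    simpa only [star_sum, star_mul'] using congrArg star (A.frobenius i j k l)
  special k l := by
    simpa only [star_sum, star_mul', apply_ite star, star_one, star_zero]
      using congrArg star (A.special k l)
  symmetric i j := by simpa only [star_sum, star_mul'] using congrArg star (A.symmetric i j)

theorem sum_pair {m n : ℕ} (F : Fin m → ℂ) (G : Fin n → ℂ) :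
    ∑ p : Fin (m * n), F (finProdFinEquiv.symm p).1 * G (finProdFinEquiv.symm p).2
      = (∑ a, F a) * ∑ b, G b := by
  rw [finProdFinEquiv.symm.sum_comp (fun x : Fin m × Fin n => F x.1 * G x.2),
    Fintype.sum_prod_type, Finset.sum_mul_sum]

theorem ite_pair {m n : ℕ} (k l : Fin (m * n)) :
    (if (finProdFinEquiv.symm k).1 = (finProdFinEquiv.symm l).1 then (1 : ℂ) else 0) *
      (if (finProdFinEquiv.symm k).2 = (finProdFinEquiv.symm l).2 then 1 else 0)
      = if k = l then 1 else 0 := by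
  have : k = l ↔ (finProdFinEquiv.symm k).1 = (finProdFinEquiv.symm l).1 ∧
      (finProdFinEquiv.symm k).2 = (finProdFinEquiv.symm l).2 := by
    rw [← Prod.ext_iff, Equiv.apply_eq_iff_eq]
  by_cases h1 : (finProdFinEquiv.symm k).1 = (finProdFinEquiv.symm l).1 <;>
  by_cases h2 : (finProdFinEquiv.symm k).2 = (finProdFinEquiv.symm l).2 <;>
  simp only [this, h1, h2, and_self, and_true, and_false, if_true, if_false, mul_one, mul_zero]

/-- The tensor product of objects: the product Frobenius structure on `ℂ^m ⊗ ℂ^n = ℂ^(m * n)`. -/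
def tensor (A B : CPStar) : CPStar where
  dim := A.dim * B.dim
  mul := fun i j k =>
    A.mul (finProdFinEquiv.symm i).1 (finProdFinEquiv.symm j).1 (finProdFinEquiv.symm k).1 *
    B.mul (finProdFinEquiv.symm i).2 (finProdFinEquiv.symm j).2 (finProdFinEquiv.symm k).2
  unit := fun i => A.unit (finProdFinEquiv.symm i).1 * B.unit (finProdFinEquiv.symm i).2
  assoc i j k l := by
    have h := congrArg₂ (· * ·)
      (A.assoc (finProdFinEquiv.symm i).1 (finProdFinEquiv.symm j).1 (finProdFinEquiv.symm k).1
        (finProdFinEquiv.symm l).1)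
      (B.assoc (finProdFinEquiv.symm i).2 (finProdFinEquiv.symm j).2 (finProdFinEquiv.symm k).2
        (finProdFinEquiv.symm l).2)
    simp only [← sum_pair] at h
    refine Eq.trans (Finset.sum_congr rfl fun _ _ => ?_)
      (h.trans (Finset.sum_congr rfl fun _ _ => ?_)) <;> ring
  unit_mul j l := by
    have h := congrArg₂ (· * ·)
      (A.unit_mul (finProdFinEquiv.symm j).1 (finProdFinEquiv.symm l).1)
      (B.unit_mul (finProdFinEquiv.symm j).2 (finProdFinEquiv.symm l).2)
    simp only [← sum_pair, ite_pair] at h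
    exact Eq.trans (Finset.sum_congr rfl fun _ _ => by ring) h
  mul_unit i l := by
    have h := congrArg₂ (· * ·)
      (A.mul_unit (finProdFinEquiv.symm i).1 (finProdFinEquiv.symm l).1)
      (B.mul_unit (finProdFinEquiv.symm i).2 (finProdFinEquiv.symm l).2)
    simp only [← sum_pair, ite_pair] at h
    exact Eq.trans (Finset.sum_congr rfl fun _ _ => by ring) h
  frobenius i j k l := by
    have h := congrArg₂ (· * ·)
      (A.frobenius (finProdFinEquiv.symm i).1 (finProdFinEquiv.symm j).1 (finProdFinEquiv.symm k).1
        (finProdFinEquiv.symm l).1)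
      (B.frobenius (finProdFinEquiv.symm i).2 (finProdFinEquiv.symm j).2 (finProdFinEquiv.symm k).2
        (finProdFinEquiv.symm l).2)
    simp only [← sum_pair] at h
    refine Eq.trans (Finset.sum_congr rfl fun _ _ => ?_)
      (h.trans (Finset.sum_congr rfl fun _ _ => ?_)) <;> rw [star_mul'] <;> ring
  special k l := by
    have h := congrArg₂ (· * ·)
      (A.special (finProdFinEquiv.symm k).1 (finProdFinEquiv.symm l).1)
      (B.special (finProdFinEquiv.symm k).2 (finProdFinEquiv.symm l).2)
    simp only [ite_pair] at h
    rw [← sum_pair] at h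
    simp only [← sum_pair] at h
    refine Eq.trans (Finset.sum_congr rfl fun _ _ => Finset.sum_congr rfl fun _ _ => ?_) h
    rw [star_mul']
    ring
  symmetric i j := by
    have h := congrArg₂ (· * ·)
      (A.symmetric (finProdFinEquiv.symm i).1 (finProdFinEquiv.symm j).1)
      (B.symmetric (finProdFinEquiv.symm i).2 (finProdFinEquiv.symm j).2)
    simp only [← sum_pair] at h
    refine Eq.trans (Finset.sum_congr rfl fun _ _ => ?_)
      (h.trans (Finset.sum_congr rfl fun _ _ => ?_)) <;> rw [star_mul'] <;> ring

/-- The Kronecker product of matrices, as a matrix `ℂ^(m * n) ⟶ ℂ^(m' * n')`. -/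
def kron {m m' n n' : ℕ} (M : Matrix (Fin m') (Fin m) ℂ) (N : Matrix (Fin n') (Fin n) ℂ) :
    Matrix (Fin (m' * n')) (Fin (m * n)) ℂ :=
  Matrix.of fun o i => M (finProdFinEquiv.symm o).1 (finProdFinEquiv.symm i).1 *
    N (finProdFinEquiv.symm o).2 (finProdFinEquiv.symm i).2

/-- The symmetry `e_i ⊗ e_j ↦ e_j ⊗ e_i`. -/
def swap (m n : ℕ) : Matrix (Fin (n * m)) (Fin (m * n)) ℂ :=
  Matrix.of fun o i => if finProdFinEquiv.symm o = (finProdFinEquiv.symm i).swap then 1 else 0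

/-- The counit `e_i ⊗ e_j ↦ δ_ij`. -/
def cap (n : ℕ) : Matrix (Fin 1) (Fin (n * n)) ℂ :=
  Matrix.of fun _ i => if (finProdFinEquiv.symm i).1 = (finProdFinEquiv.symm i).2 then 1 else 0

end CPStar

/-! ## The category `Caus[CP*[FHilb_sk]]` -/

/-- A pair of an object of `CP*[FHilb_sk]` and a set of states of it. -/
structure PreCaus where
  carrier : CPStar
  states : Set (CPStar.one ⟶ carrier)

namespace PreCaus

/-- The dual set of effects: those that send all states in `c` to the scalar `1`. -/
def dualEffects {A : CPStar} (c : Set (CPStar.one ⟶ A)) : Set (A ⟶ CPStar.one) :=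
  {π | ∀ ρ ∈ c, ρ ≫ π = 𝟙 CPStar.one}

/-- The closure `c**` of a set of states. -/
def closure {A : CPStar} (c : Set (CPStar.one ⟶ A)) : Set (CPStar.one ⟶ A) :=
  {ρ | ∀ π ∈ dualEffects c, ρ ≫ π = 𝟙 CPStar.one}

/-- The coordinates of a state. -/
def vec {A : CPStar} (ρ : CPStar.one ⟶ A) (i : Fin A.dim) : ℂ := ρ.mat i (0 : Fin 1)

/-- The coordinates of an effect. -/
def covec {A : CPStar} (π : A ⟶ CPStar.one) (i : Fin A.dim) : ℂ := π.mat (0 : Fin 1) i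

/-- `c = c**` -/
def IsClosed (X : PreCaus) : Prop := closure X.states = X.states

/-- Up to invertible scalars, the uniform state (the unit of the Frobenius structure) is in `c` and
the discarding effect (the counit) is in `c*`. The invertible scalars are the positive reals. -/
def IsFlat (X : PreCaus) : Prop :=
  (∃ r : ℝ, 0 < r ∧ ∃ ρ ∈ X.states, ∀ i, vec ρ i = r * X.carrier.unit i) ∧
  (∃ r : ℝ, 0 < r ∧ ∃ π ∈ dualEffects X.states, ∀ i, covec π i = r * star (X.carrier.unit i))

/-- `(I, {1})` -/
def unit : PreCaus := ⟨CPStar.one, {𝟙 CPStar.one}⟩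

/-- `(A^*, c*)`, where the effect `π : A ⟶ I` is regarded as the state `π^T : I ⟶ A^*`. -/
def dual (X : PreCaus) : PreCaus :=
  ⟨X.carrier.conj, {σ | ∃ π ∈ dualEffects X.states, ∀ i, vec σ i = covec π i}⟩

/-- `(A ⊗ B, {ρ ⊗ σ | ρ ∈ c_A, σ ∈ c_B}**)` -/
def tensor (X Y : PreCaus) : PreCaus :=
  ⟨X.carrier.tensor Y.carrier,
    closure {τ | ∃ ρ ∈ X.states, ∃ σ ∈ Y.states,
      ∀ i j, vec τ (finProdFinEquiv (i, j)) = vec ρ i * vec σ j}⟩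

/-- The one-way signalling states, from `A` to `B`: those states `h` of `A ⊗ B` for which the
marginal `(1 ⊗ π) ∘ h` on `A` is the same element of `c_A` for all effects `π ∈ c_B*`. -/
def seq (X Y : PreCaus) : PreCaus :=
  ⟨X.carrier.tensor Y.carrier,
    {h | ∃ m ∈ X.states, ∀ π ∈ dualEffects Y.states,
      ∀ i, ∑ j, covec π j * vec h (finProdFinEquiv (i, j)) = vec m i}⟩

end PreCaus

/-- The objects of `Caus[CP*[FHilb_sk]]`: pairs `(A, c)` with `c` closed and flat. -/
def Caus : Type := {X : PreCaus // X.IsClosed ∧ X.IsFlat}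

namespace Caus

/-- The morphisms of `Caus[CP*[FHilb_sk]]`: those of `CP*[FHilb_sk]` that preserve the chosen states. -/
@[ext]
structure Hom (X Y : Caus) where
  map : X.1.carrier ⟶ Y.1.carrier
  preserves : ∀ ρ ∈ X.1.states, ρ ≫ map ∈ Y.1.states

instance : Category Caus where
  Hom := Hom
  id X := ⟨𝟙 X.1.carrier, fun ρ h => by rwa [Category.comp_id]⟩
  comp f g := ⟨f.map ≫ g.map, fun ρ h => by
    rw [← Category.assoc]; exact g.preserves _ (f.preserves ρ h)⟩
  id_comp f := Hom.ext (Category.id_comp f.map)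
  comp_id f := Hom.ext (Category.comp_id f.map)
  assoc f g h := Hom.ext (Category.assoc f.map g.map h.map)

/-- The forgetful functor `Caus[CP*[FHilb_sk]] ⥤ CP*[FHilb_sk]`. -/
def forget : Caus ⥤ CPStar where
  obj X := X.1.carrier
  map f := f.map

end Caus

/-! ## The symmetric monoidal structure of `CP*[FHilb_sk]` -/

namespace CPStar

/-! Left multiplication is a faithful *-representation of a special symmetric dagger Frobenius
structure, so such a structure behaves like a finite-dimensional C*-algebra. A vector is a state
exactly when its left multiplication operator is positive semidefinite (`isPos_iff`), and effects
are the states of the conjugate structure (`isEff_iff`). The unit acts as the identity matrix, so it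
is interior to the positive cone: a small Hermitian perturbation of it stays positive
(`eq_zero_of_perturb`). Flatness puts a multiple of the unit in `c` and one of the counit in `c*`.
Hence a linear functional constant on `c` annihilates every vector that `c*` annihilates
(`DualPair.dot_eq_zero`).

This gives `(A < B)* = A* < B*` (`dualPair_seqSet`). Let `h` be a one-way signalling state with
marginal `m`, and `φ` an effect with marginal `m'`. Each row of `φ` is constant on `c_B`, and each
row of `h - m ⊗ (s • u)` is annihilated by `c_B*`, so `φ h = φ (m ⊗ (s • u)) = m' m = 1`.
Conversely, an effect that is 1 on all one-way signalling states cannot distinguish states `σ`, `τ`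
of `B`, because small Hermitian perturbations built from `v ⊗ (σ - τ)` can be added to the uniform
state without leaving the set (`eq_of_const_on_seqSet`). The same row-by-row argument yields
associativity of `<` (`reassoc_mem_seqSet`) and the interchange `q` (`tens_dot_interchange`).
Associativity of `⊗` holds because both bracketings have the effects normalised on triple products
as dual set.

Everything else is inherited. Lexicographic indexing makes `CPStar` strict, and its coherence laws
reduce to `eqToHom` or to tracking basis vectors. The structural maps of `Caus` lie over those of
`CPStar` and the forgetful functor is faithful, so only preservation of states has to be proved
upstairs. -/

theorem Hom.ext_mat {A B : CPStar} {f g : A ⟶ B} (h : f.mat = g.mat) : f = g := Hom.ext h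

theorem comp_mat {A B C : CPStar} (f : A ⟶ B) (g : B ⟶ C) : (f ≫ g).mat = g.mat * f.mat := rfl

theorem id_mat (A : CPStar) : (𝟙 A : A ⟶ A).mat = 1 := rfl

/-- The Choi matrix of a Kronecker product is, after regrouping indices, the Kronecker product of
the Choi matrices; Gram factors multiply accordingly. -/
theorem isCP_kron {A A' B B' : CPStar} {f : Matrix (Fin A'.dim) (Fin A.dim) ℂ}
    {g : Matrix (Fin B'.dim) (Fin B.dim) ℂ} (hf : IsCP A A' f) (hg : IsCP B B' g) :
    IsCP (A.tensor B) (A'.tensor B') (kron f g) := by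
  obtain ⟨r, G, hG⟩ := hf
  obtain ⟨s, H, hH⟩ := hg
  refine isCP_of_gram _ _ _ (ι := Fin r × Fin s) (Matrix.of fun u x =>
    G u.1 ((finProdFinEquiv.symm x.1).1, (finProdFinEquiv.symm x.2).1) *
    H u.2 ((finProdFinEquiv.symm x.1).2, (finProdFinEquiv.symm x.2).2)) ?_
  ext ⟨k, l⟩ ⟨i, j⟩
  have e := congrArg₂ (· * ·)
    (congrFun (congrFun hG ((finProdFinEquiv.symm k).1, (finProdFinEquiv.symm l).1))
      ((finProdFinEquiv.symm i).1, (finProdFinEquiv.symm j).1))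
    (congrFun (congrFun hH ((finProdFinEquiv.symm k).2, (finProdFinEquiv.symm l).2))
      ((finProdFinEquiv.symm i).2, (finProdFinEquiv.symm j).2))
  simp only [choi, Matrix.of_apply, Matrix.mul_apply, Matrix.conjTranspose_apply] at e
  rw [← sum_pair] at e
  simp only [← sum_pair] at e
  simp only [choi, Matrix.of_apply, Matrix.mul_apply, Matrix.conjTranspose_apply,
    Fintype.sum_prod_type]
  refine Eq.trans (Finset.sum_congr rfl fun _ _ => Finset.sum_congr rfl fun _ _ => ?_)
    (e.trans ?_)
  · change star ((_ : ℂ) * _) * ((_ : ℂ) * _) * ((_ : ℂ) * _) = _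
    rw [star_mul']
    ring
  · refine (sum_pair (fun p => star (G p (_, _)) * G p (_, _))
      (fun p => star (H p (_, _)) * H p (_, _))).trans ?_
    rw [Finset.sum_mul_sum]
    refine Finset.sum_congr rfl fun _ _ => Finset.sum_congr rfl fun _ _ => ?_
    rw [star_mul']
    ring

/-- The tensor product of morphisms. -/
def tensorMap {A A' B B' : CPStar} (f : A ⟶ A') (g : B ⟶ B') : A.tensor B ⟶ A'.tensor B' :=
  ⟨kron f.mat g.mat, isCP_kron f.isCP g.isCP⟩

theorem kron_one_one (m n : ℕ) :
    kron (1 : Matrix (Fin m) (Fin m) ℂ) (1 : Matrix (Fin n) (Fin n) ℂ) = 1 := by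
  ext o i
  simp only [kron, Matrix.of_apply, Matrix.one_apply, ite_pair]

theorem kron_mul_kron {m m' m'' n n' n'' : ℕ} (M : Matrix (Fin m') (Fin m) ℂ)
    (M' : Matrix (Fin m'') (Fin m') ℂ) (N : Matrix (Fin n') (Fin n) ℂ)
    (N' : Matrix (Fin n'') (Fin n') ℂ) :
    kron M' N' * kron M N = kron (M' * M) (N' * N) := by
  ext o i
  simp only [kron, Matrix.of_apply, Matrix.mul_apply]
  rw [← sum_pair]
  exact Finset.sum_congr rfl fun _ _ => by ring

theorem ext_cast {A B : CPStar} (h : A.dim = B.dim)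
    (hm : ∀ i j k, A.mul i j k = B.mul (Fin.cast h i) (Fin.cast h j) (Fin.cast h k))
    (hu : ∀ i, A.unit i = B.unit (Fin.cast h i)) : A = B := by
  cases A
  cases B
  cases h
  congr
  · ext i j k; exact hm i j k
  · ext i; exact hu i

/-- Lexicographic numbering is associative on the nose, which is the source of strictness of the
tensor product. -/
theorem cast_pair_assoc {a b c : ℕ} (h : a * b * c = a * (b * c)) (i : Fin a) (j : Fin b)
    (k : Fin c) : Fin.cast h (finProdFinEquiv (finProdFinEquiv (i, j), k)) =
      finProdFinEquiv (i, finProdFinEquiv (j, k)) := by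
  ext
  simp only [finProdFinEquiv_apply_val, Fin.val_cast]
  ring

theorem cast_pair_one_left {a : ℕ} (h : 1 * a = a) (i : Fin 1) (j : Fin a) :
    Fin.cast h (finProdFinEquiv (i, j)) = j := by
  ext
  simp [finProdFinEquiv_apply_val]

theorem cast_pair_one_right {a : ℕ} (h : a * 1 = a) (i : Fin a) (j : Fin 1) :
    Fin.cast h (finProdFinEquiv (i, j)) = i := by
  ext
  simp [finProdFinEquiv_apply_val]

theorem tensor_assoc (A B C : CPStar) : (A.tensor B).tensor C = A.tensor (B.tensor C) := by
  have hs : ∀ x : Fin (A.dim * B.dim * C.dim), ∃ i j k,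
      x = finProdFinEquiv (finProdFinEquiv (i, j), k) := fun x =>
    ⟨_, _, _, by rw [Prod.mk.eta, Equiv.apply_symm_apply, Prod.mk.eta, Equiv.apply_symm_apply]⟩
  refine ext_cast (Nat.mul_assoc _ _ _) (fun x y z => ?_) fun x => ?_
  · obtain ⟨i, j, k, rfl⟩ := hs x
    obtain ⟨i', j', k', rfl⟩ := hs y
    obtain ⟨i'', j'', k'', rfl⟩ := hs z
    erw [cast_pair_assoc, cast_pair_assoc, cast_pair_assoc]
    simp only [tensor, Equiv.symm_apply_apply]
    ring
  · obtain ⟨i, j, k, rfl⟩ := hs x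
    erw [cast_pair_assoc]
    simp only [tensor, Equiv.symm_apply_apply]
    ring

theorem one_tensor (A : CPStar) : one.tensor A = A := by
  have hs : ∀ x : Fin (1 * A.dim), ∃ i j, x = finProdFinEquiv (i, j) := fun x =>
    ⟨_, _, by rw [Prod.mk.eta, Equiv.apply_symm_apply]⟩
  refine ext_cast (Nat.one_mul _) (fun x y z => ?_) fun x => ?_
  · obtain ⟨i, j, rfl⟩ := hs x
    obtain ⟨i', j', rfl⟩ := hs y
    obtain ⟨i'', j'', rfl⟩ := hs z
    erw [cast_pair_one_left, cast_pair_one_left, cast_pair_one_left]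
    simp only [tensor, Equiv.symm_apply_apply, one, one_mul]
  · obtain ⟨i, j, rfl⟩ := hs x
    erw [cast_pair_one_left]
    simp only [tensor, Equiv.symm_apply_apply, one, one_mul]

theorem tensor_one (A : CPStar) : A.tensor one = A := by
  have hs : ∀ x : Fin (A.dim * 1), ∃ i j, x = finProdFinEquiv (i, j) := fun x =>
    ⟨_, _, by rw [Prod.mk.eta, Equiv.apply_symm_apply]⟩
  refine ext_cast (Nat.mul_one _) (fun x y z => ?_) fun x => ?_
  · obtain ⟨i, j, rfl⟩ := hs x
    obtain ⟨i', j', rfl⟩ := hs y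
    obtain ⟨i'', j'', rfl⟩ := hs z
    erw [cast_pair_one_right, cast_pair_one_right, cast_pair_one_right]
    simp only [tensor, Equiv.symm_apply_apply, one, mul_one]
  · obtain ⟨i, j, rfl⟩ := hs x
    erw [cast_pair_one_right]
    simp only [tensor, Equiv.symm_apply_apply, one, mul_one]

instance : MonoidalCategoryStruct CPStar where
  tensorObj := tensor
  tensorUnit := one
  tensorHom := tensorMap
  whiskerLeft A _ _ f := tensorMap (𝟙 A) f
  whiskerRight f B := tensorMap f (𝟙 B)
  associator A B C := eqToIso (tensor_assoc A B C)
  leftUnitor A := eqToIso (one_tensor A)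
  rightUnitor A := eqToIso (tensor_one A)

/-! ### Matrix entries of tensor products and the action of coherence maps on basis vectors -/

/-- The basis vector `e_i ⊗ e_j`. -/
def pr {A B : CPStar} (i : Fin A.dim) (j : Fin B.dim) : Fin (A ⊗ B).dim := finProdFinEquiv (i, j)

theorem exists_pr {A B : CPStar} (x : Fin (A ⊗ B).dim) :
    ∃ (i : Fin A.dim) (j : Fin B.dim), x = pr i j :=
  ⟨(finProdFinEquiv.symm x).1, (finProdFinEquiv.symm x).2,
    (finProdFinEquiv.apply_symm_apply x).symm⟩

theorem pr_inj {A B : CPStar} {i i' : Fin A.dim} {j j' : Fin B.dim} :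
    pr i j = pr i' j' ↔ i = i' ∧ j = j' :=
  (finProdFinEquiv.apply_eq_iff_eq).trans Prod.mk_inj

theorem sum_pr {A B : CPStar} {M : Type*} [AddCommMonoid M] (F : Fin (A ⊗ B).dim → M) :
    ∑ x, F x = ∑ i, ∑ j, F (pr i j) := by
  refine (finProdFinEquiv.sum_comp F).symm.trans ?_
  rw [Fintype.sum_prod_type]
  rfl

theorem forall_pr {A B : CPStar} {P : Fin (A ⊗ B).dim → Prop} : (∀ x, P x) ↔ ∀ i j, P (pr i j) :=
  ⟨fun h _ _ => h _, fun h x => by obtain ⟨i, j, rfl⟩ := exists_pr x; exact h i j⟩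

theorem tensorHom_mat {A A' B B' : CPStar} (f : A ⟶ A') (g : B ⟶ B') (k : Fin A'.dim)
    (l : Fin B'.dim) (i : Fin A.dim) (j : Fin B.dim) :
    (f ⊗ₘ g).mat (pr k l) (pr i j) = f.mat k i * g.mat l j := by
  change kron f.mat g.mat (finProdFinEquiv (k, l)) (finProdFinEquiv (i, j)) = _
  simp only [kron, Matrix.of_apply, Equiv.symm_apply_apply]

theorem whiskerLeft_mat (A : CPStar) {B B' : CPStar} (g : B ⟶ B') (k : Fin A.dim)
    (l : Fin B'.dim) (i : Fin A.dim) (j : Fin B.dim) :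
    (A ◁ g).mat (pr k l) (pr i j) = if k = i then g.mat l j else 0 := by
  refine (tensorHom_mat (𝟙 A) g k l i j).trans ?_
  rw [id_mat, Matrix.one_apply, ite_mul, one_mul, zero_mul]

theorem whiskerRight_mat {A A' : CPStar} (f : A ⟶ A') (B : CPStar) (k : Fin A'.dim)
    (l : Fin B.dim) (i : Fin A.dim) (j : Fin B.dim) :
    (f ▷ B).mat (pr k l) (pr i j) = if l = j then f.mat k i else 0 := by
  refine (tensorHom_mat f (𝟙 B) k l i j).trans ?_
  rw [id_mat, Matrix.one_apply, mul_ite, mul_one, mul_zero]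

/-- `f` sends the basis vector `e_i` to the basis vector `e_j`. -/
def Maps {A B : CPStar} (f : A ⟶ B) (i : Fin A.dim) (j : Fin B.dim) : Prop :=
  ∀ o, f.mat o i = if o = j then 1 else 0

theorem Maps.comp_mat {A B C : CPStar} {f : A ⟶ B} {i : Fin A.dim} {j : Fin B.dim}
    (h : Maps f i j) (g : B ⟶ C) (o : Fin C.dim) : (f ≫ g).mat o i = g.mat o j := by
  rw [CPStar.comp_mat, Matrix.mul_apply]
  simp [h _]

theorem Maps.comp {A B C : CPStar} {f : A ⟶ B} {g : B ⟶ C} {i : Fin A.dim} {j : Fin B.dim}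
    {k : Fin C.dim} (h : Maps f i j) (h' : Maps g j k) : Maps (f ≫ g) i k :=
  fun o => (h.comp_mat g o).trans (h' o)

theorem Maps.id {A : CPStar} (i : Fin A.dim) : Maps (𝟙 A) i i :=
  fun o => by rw [id_mat, Matrix.one_apply]

theorem Maps.tensorHom {A A' B B' : CPStar} {f : A ⟶ A'} {g : B ⟶ B'} {i : Fin A.dim}
    {j : Fin B.dim} {k : Fin A'.dim} {l : Fin B'.dim} (hf : Maps f i k) (hg : Maps g j l) :
    Maps (f ⊗ₘ g) (pr i j) (pr k l) := by
  refine forall_pr.2 fun a b => ?_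
  rw [tensorHom_mat, hf, hg]
  simp only [pr_inj, ite_and, ite_mul, one_mul, zero_mul]

theorem Maps.whiskerLeft {B B' : CPStar} {g : B ⟶ B'} {j : Fin B.dim} {l : Fin B'.dim}
    (A : CPStar) (i : Fin A.dim) (hg : Maps g j l) : Maps (A ◁ g) (pr i j) (pr i l) :=
  (Maps.id i).tensorHom hg

theorem Maps.whiskerRight {A A' : CPStar} {f : A ⟶ A'} {i : Fin A.dim} {k : Fin A'.dim}
    (B : CPStar) (j : Fin B.dim) (hf : Maps f i k) : Maps (f ▷ B) (pr i j) (pr k j) :=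
  hf.tensorHom (Maps.id j)

theorem maps_eqToHom {A B : CPStar} (h : A = B) (i : Fin A.dim) :
    Maps (eqToHom h) i (Fin.cast (congrArg dim h) i) := by
  subst h
  exact Maps.id i

theorem maps_associator (A B C : CPStar) (i : Fin A.dim) (j : Fin B.dim) (k : Fin C.dim) :
    Maps (α_ A B C).hom (pr (pr i j) k) (pr i (pr j k)) := by
  have h := maps_eqToHom (tensor_assoc A B C) (pr (pr i j) k)
  have e := cast_pair_assoc (Nat.mul_assoc _ _ _) i j k
  erw [e] at h
  exact h

theorem maps_leftUnitor (A : CPStar) (x : Fin (𝟙_ CPStar).dim) (i : Fin A.dim) :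
    Maps (λ_ A).hom (pr x i) i := by
  have h := maps_eqToHom (one_tensor A) (pr x i)
  have e := cast_pair_one_left (Nat.one_mul _) x i
  erw [e] at h
  exact h

theorem maps_rightUnitor (A : CPStar) (i : Fin A.dim) (x : Fin (𝟙_ CPStar).dim) :
    Maps (ρ_ A).hom (pr i x) i := by
  have h := maps_eqToHom (tensor_one A) (pr i x)
  have e := cast_pair_one_right (Nat.mul_one _) i x
  erw [e] at h
  exact h

theorem maps_inv {A B : CPStar} {f : A ≅ B} {i : Fin A.dim} {j : Fin B.dim}
    (h : Maps f.hom i j) : Maps f.inv j i := by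
  intro o
  rw [← h.comp_mat f.inv o, f.hom_inv_id]
  exact Maps.id i o

/-- Coherence maps send basis vectors to basis vectors, so their equations can be checked by
following indices. -/
theorem hom_ext_of_maps {A B : CPStar} {f g : A ⟶ B} (h : ∀ i, ∃ j, Maps f i j ∧ Maps g i j) :
    f = g := by
  refine Hom.ext_mat (Matrix.ext fun o i => ?_)
  obtain ⟨j, hf, hg⟩ := h i
  rw [hf, hg]

end CPStar

namespace CPStar

theorem maps_associator_inv (A B C : CPStar) (i : Fin A.dim) (j : Fin B.dim) (k : Fin C.dim) :
    Maps (α_ A B C).inv (pr i (pr j k)) (pr (pr i j) k) :=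
  maps_inv (maps_associator A B C i j k)

theorem maps_leftUnitor_inv (A : CPStar) (x : Fin (𝟙_ CPStar).dim) (i : Fin A.dim) :
    Maps (λ_ A).inv i (pr x i) :=
  maps_inv (maps_leftUnitor A x i)

theorem maps_rightUnitor_inv (A : CPStar) (i : Fin A.dim) (x : Fin (𝟙_ CPStar).dim) :
    Maps (ρ_ A).inv i (pr i x) :=
  maps_inv (maps_rightUnitor A i x)

instance : Unique (Fin (𝟙_ CPStar).dim) := inferInstanceAs (Unique (Fin 1))

/-- Counterpart of `Maps.comp_mat` for postcomposition; naturality squares compare the two. -/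
theorem comp_associator_mat {A B C X : CPStar} (g : X ⟶ (A ⊗ B) ⊗ C) (i : Fin A.dim)
    (j : Fin B.dim) (k : Fin C.dim) (x : Fin X.dim) :
    (g ≫ (α_ A B C).hom).mat (pr i (pr j k)) x = g.mat (pr (pr i j) k) x := by
  rw [CPStar.comp_mat, Matrix.mul_apply]
  simp only [sum_pr, maps_associator A B C _ _ _ _, pr_inj, ite_and, ite_mul, one_mul, zero_mul]
  simp

theorem comp_leftUnitor_mat {A X : CPStar} (g : X ⟶ 𝟙_ CPStar ⊗ A) (y : Fin (𝟙_ CPStar).dim)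
    (i : Fin A.dim) (x : Fin X.dim) : (g ≫ (λ_ A).hom).mat i x = g.mat (pr y i) x := by
  rw [CPStar.comp_mat, Matrix.mul_apply]
  simp only [sum_pr, maps_leftUnitor A _ _ _, ite_mul, one_mul, zero_mul, Fintype.sum_unique]
  simp [Unique.eq_default y]

theorem comp_rightUnitor_mat {A X : CPStar} (g : X ⟶ A ⊗ 𝟙_ CPStar) (i : Fin A.dim)
    (y : Fin (𝟙_ CPStar).dim) (x : Fin X.dim) :
    (g ≫ (ρ_ A).hom).mat i x = g.mat (pr i y) x := by
  rw [CPStar.comp_mat, Matrix.mul_apply]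
  simp only [sum_pr, maps_rightUnitor A _ _ _, ite_mul, one_mul, zero_mul, Fintype.sum_unique]
  simp [Unique.eq_default y]

theorem mat_ext_pr {A B X : CPStar} {f g : A ⊗ B ⟶ X}
    (h : ∀ o i j, f.mat o (pr i j) = g.mat o (pr i j)) : f = g :=
  Hom.ext_mat (Matrix.ext fun o => forall_pr.2 fun i j => h o i j)

theorem eqToHom_tensor {A A' : CPStar} (h : A = A') (B : CPStar) :
    eqToHom h ▷ B = eqToHom (congrArg (· ⊗ B) h) := by
  subst h
  exact Hom.ext_mat (kron_one_one _ _)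

theorem tensor_eqToHom {A A' : CPStar} (B : CPStar) (h : A = A') :
    B ◁ eqToHom h = eqToHom (congrArg (B ⊗ ·) h) := by
  subst h
  exact Hom.ext_mat (kron_one_one _ _)

instance : MonoidalCategory CPStar where
  tensorHom_def f g := Hom.ext_mat ((kron_mul_kron _ _ _ _).trans (by
    rw [id_mat, id_mat, Matrix.mul_one, Matrix.one_mul]; rfl)).symm
  id_tensorHom_id A B := Hom.ext_mat (kron_one_one _ _)
  tensorHom_comp_tensorHom f g f' g' := Hom.ext_mat (kron_mul_kron _ _ _ _)
  whiskerLeft_id A B := Hom.ext_mat (kron_one_one _ _)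
  id_whiskerRight A B := Hom.ext_mat (kron_one_one _ _)
  associator_naturality f g h := by
    refine mat_ext_pr fun o => forall_pr.2 fun i j k => ?_
    obtain ⟨o₁, o', rfl⟩ := exists_pr o
    obtain ⟨o₂, o₃, rfl⟩ := exists_pr o'
    rw [comp_associator_mat, (maps_associator _ _ _ i j k).comp_mat]
    simp only [tensorHom_mat, mul_assoc]
  leftUnitor_naturality f := by
    refine mat_ext_pr fun o i j => ?_
    rw [comp_leftUnitor_mat _ i, (maps_leftUnitor _ i j).comp_mat, whiskerLeft_mat, if_pos rfl]
  rightUnitor_naturality f := by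
    refine mat_ext_pr fun o i j => ?_
    rw [comp_rightUnitor_mat _ _ j, (maps_rightUnitor _ i j).comp_mat, whiskerRight_mat, if_pos rfl]
  pentagon A B C D := by
    change eqToHom (tensor_assoc A B C) ▷ D ≫ eqToHom (tensor_assoc A (B ⊗ C) D) ≫
      A ◁ eqToHom (tensor_assoc B C D) =
      eqToHom (tensor_assoc (A ⊗ B) C D) ≫ eqToHom (tensor_assoc A B (C ⊗ D))
    -- A whiskered `eqToHom` is again an `eqToHom`, so both sides collapse to the same one.
    rw [eqToHom_tensor, tensor_eqToHom]
    exact (congrArg _ (eqToHom_trans _ _)).trans ((eqToHom_trans _ _).trans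
      (eqToHom_trans _ _).symm)
  triangle A B := by
    change eqToHom (tensor_assoc A one B) ≫ A ◁ eqToHom (one_tensor B) =
      eqToHom (tensor_one A) ▷ B
    rw [eqToHom_tensor, tensor_eqToHom]
    exact eqToHom_trans _ _

/-- The Choi matrix of a relabelling that respects the structure constants is that of the identity
with its second indices relabelled, so the Gram factor of the identity can be reused. -/
theorem isCP_of_equiv {A B : CPStar} (e : Fin A.dim ≃ Fin B.dim)
    (h : ∀ i j k, B.mul (e i) (e j) (e k) = A.mul i j k) :
    IsCP A B (Matrix.of fun o i => if o = e i then 1 else 0) := by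
  obtain ⟨r, g, hg⟩ := isCP_one A
  refine ⟨r, Matrix.of fun s x => g s (x.1, e.symm x.2), ?_⟩
  ext ⟨k, l⟩ ⟨i, j⟩
  obtain ⟨l, rfl⟩ := e.surjective l
  obtain ⟨j, rfl⟩ := e.surjective j
  have e' := congrFun (congrFun hg (k, l)) (i, j)
  simp only [choi, Matrix.mul_apply, Matrix.conjTranspose_apply, Matrix.of_apply,
    e.symm_apply_apply] at e' ⊢
  rw [← e']
  refine Finset.sum_congr rfl fun p _ => ?_
  rw [← e.sum_comp]
  refine Finset.sum_congr rfl fun q _ => ?_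
  simp only [h, e.apply_eq_iff_eq]
  exact congrArg (· * _) (congrArg (_ * ·) (Matrix.one_apply (i := q) (j := p)).symm)

theorem isCP_swap (A B : CPStar) : IsCP (A.tensor B) (B.tensor A) (swap A.dim B.dim) := by
  let e : Fin (A.dim * B.dim) ≃ Fin (B.dim * A.dim) :=
    finProdFinEquiv.symm.trans ((Equiv.prodComm _ _).trans finProdFinEquiv)
  have he : ∀ i, finProdFinEquiv.symm (e i) = (finProdFinEquiv.symm i).swap := fun i =>
    finProdFinEquiv.symm_apply_apply _
  have h : swap A.dim B.dim = Matrix.of fun o i => if o = e i then 1 else 0 := by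
    ext o i
    simp only [swap, Matrix.of_apply, ← he, Equiv.apply_eq_iff_eq]
  rw [h]
  refine isCP_of_equiv (A := A.tensor B) (B := B.tensor A) e fun i j k => ?_
  change B.mul (finProdFinEquiv.symm (e i)).1 (finProdFinEquiv.symm (e j)).1
      (finProdFinEquiv.symm (e k)).1 * A.mul (finProdFinEquiv.symm (e i)).2
      (finProdFinEquiv.symm (e j)).2 (finProdFinEquiv.symm (e k)).2 = _
  have he' : ∀ i : Fin (A.tensor B).dim,
      finProdFinEquiv.symm (e i) = (finProdFinEquiv.symm i).swap := he
  simp only [he']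
  exact mul_comm (_ : ℂ) _

/-- The symmetry as a morphism. -/
def swapMap (A B : CPStar) : A ⊗ B ⟶ B ⊗ A := ⟨swap A.dim B.dim, isCP_swap A B⟩

theorem maps_swapMap (A B : CPStar) (i : Fin A.dim) (j : Fin B.dim) :
    Maps (swapMap A B) (pr i j) (pr j i) := by
  refine forall_pr.2 fun k l => ?_
  change (swap A.dim B.dim) (finProdFinEquiv (k, l)) (finProdFinEquiv (i, j)) = _
  simp only [swap, Matrix.of_apply, Equiv.symm_apply_apply, Prod.swap_prod_mk, Prod.mk_inj, pr_inj]

theorem swapMap_swapMap (A B : CPStar) : swapMap A B ≫ swapMap B A = 𝟙 (A ⊗ B) :=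
  hom_ext_of_maps (forall_pr.2 fun i j =>
    ⟨_, (maps_swapMap A B i j).comp (maps_swapMap B A j i), Maps.id _⟩)

theorem comp_swapMap_mat {A B X : CPStar} (g : X ⟶ A ⊗ B) (i : Fin A.dim) (j : Fin B.dim)
    (x : Fin X.dim) : (g ≫ swapMap A B).mat (pr j i) x = g.mat (pr i j) x := by
  rw [CPStar.comp_mat, Matrix.mul_apply]
  simp only [sum_pr, maps_swapMap A B _ _ _, pr_inj, ite_and, ite_mul, one_mul, zero_mul]
  simp

instance : SymmetricCategory CPStar where
  braiding A B := ⟨swapMap A B, swapMap B A, swapMap_swapMap A B, swapMap_swapMap B A⟩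
  braiding_naturality_right A B B' f := by
    refine mat_ext_pr fun o i j => ?_
    obtain ⟨k, l, rfl⟩ := exists_pr o
    rw [comp_swapMap_mat, (maps_swapMap _ _ i j).comp_mat, whiskerLeft_mat, whiskerRight_mat]
  braiding_naturality_left f B := by
    refine mat_ext_pr fun o i j => ?_
    obtain ⟨k, l, rfl⟩ := exists_pr o
    rw [comp_swapMap_mat, (maps_swapMap _ _ i j).comp_mat, whiskerLeft_mat, whiskerRight_mat]
  hexagon_forward A B C := hom_ext_of_maps (forall_pr.2 fun x k => by
    obtain ⟨i, j, rfl⟩ := exists_pr x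
    exact ⟨_, (maps_associator A B C i j k).comp ((maps_swapMap A (B ⊗ C) _ _).comp
      (maps_associator B C A j k i)), ((maps_swapMap A B i j).whiskerRight C k).comp
      ((maps_associator B A C j i k).comp ((maps_swapMap A C i k).whiskerLeft B j))⟩)
  hexagon_reverse A B C := hom_ext_of_maps (forall_pr.2 fun i x => by
    obtain ⟨j, k, rfl⟩ := exists_pr x
    exact ⟨_, (maps_associator_inv A B C i j k).comp ((maps_swapMap (A ⊗ B) C _ _).comp
      (maps_associator_inv C A B k i j)), ((maps_swapMap B C j k).whiskerLeft A i).comp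
      ((maps_associator_inv A C B i k j).comp ((maps_swapMap A C i k).whiskerRight B j))⟩)
  symmetry := swapMap_swapMap

theorem maps_tensorμ (A B C D : CPStar) (i : Fin A.dim) (j : Fin B.dim) (k : Fin C.dim)
    (l : Fin D.dim) :
    Maps (tensorμ A B C D) (pr (pr i j) (pr k l)) (pr (pr i k) (pr j l)) :=
  (maps_associator A B (C ⊗ D) i j (pr k l)).comp
    (((maps_associator_inv B C D j k l).whiskerLeft A i).comp
      ((((maps_swapMap B C j k).whiskerRight D l).whiskerLeft A i).comp
        (((maps_associator C B D k j l).whiskerLeft A i).comp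
          (maps_associator_inv A C (B ⊗ D) i k (pr j l)))))

end CPStar

/-! ## The compact closed structure of `CP*[FHilb_sk]` -/

namespace CPStar

/-- This is the axiom `symmetric`, conjugated. -/
theorem cup_comm (A : CPStar) (i j : Fin A.dim) : A.cup i j = A.cup j i := by
  simpa only [cup, star_sum, star_mul', star_star] using congrArg star (A.symmetric i j)

/-- The left side is the Choi matrix of the counit, the right side displays it as a Gram matrix.
Conjugated multiplications are traded for plain ones along the cup, and associativity does the rest.
-/
theorem sum_star_mul_right (A : CPStar) (o₁ o₂ i₁ i₂ : Fin A.dim) :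
    ∑ p, star (A.mul o₁ p i₁) * A.mul o₂ p i₂ = ∑ s, A.mul s o₂ o₁ * star (A.mul s i₂ i₁) := by
  trans ∑ x, A.mul i₁ x o₁ * star (A.mul i₂ x o₂)
  · simp only [← A.cup_left, Finset.mul_sum, Finset.sum_mul]
    rw [Finset.sum_comm]
    refine Finset.sum_congr rfl fun x _ => Finset.sum_congr rfl fun p _ => ?_
    rw [A.cup_comm x p]
    ring
  · have h : ∀ x, ∑ s, A.mul i₁ x s * A.mul s o₂ o₁ = ∑ s, A.mul x o₂ s * A.mul i₁ s o₁ :=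
      fun x => A.assoc i₁ x o₂ o₁
    trans ∑ x, A.cup x i₂ * ∑ s, A.mul x o₂ s * A.mul i₁ s o₁
    · simp only [Finset.mul_sum]
      rw [Finset.sum_comm]
      refine Finset.sum_congr rfl fun x _ => ?_
      rw [← A.cup_right, Finset.mul_sum]
      refine Finset.sum_congr rfl fun p _ => ?_
      rw [A.cup_comm i₂ p]
      ring
    · simp only [← h, ← A.cup_left, Finset.mul_sum]
      rw [Finset.sum_comm]
      exact Finset.sum_congr rfl fun x _ => Finset.sum_congr rfl fun p _ => by ring

/-- The analogue for the Choi matrix of the unit `𝟙 ⟶ A^⊥ ⊗ A`. -/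
theorem sum_star_mul_left (A : CPStar) (o₁ o₂ i₁ i₂ : Fin A.dim) :
    ∑ q, star (A.mul q i₁ o₁) * A.mul q i₂ o₂ = ∑ s, star (A.mul o₂ s o₁) * A.mul i₂ s i₁ := by
  trans ∑ x, A.mul x o₁ i₁ * star (A.mul x o₂ i₂)
  · simp only [← A.cup_right, Finset.mul_sum, Finset.sum_mul]
    rw [Finset.sum_comm]
    refine Finset.sum_congr rfl fun x _ => Finset.sum_congr rfl fun p _ => ?_
    rw [A.cup_comm x p]
    ring
  · have h : ∀ x, ∑ s, A.mul i₂ x s * A.mul s o₁ i₁ = ∑ s, A.mul x o₁ s * A.mul i₂ s i₁ :=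
      fun x => A.assoc i₂ x o₁ i₁
    trans ∑ x, A.cup o₂ x * ∑ s, A.mul i₂ x s * A.mul s o₁ i₁
    · simp only [Finset.mul_sum]
      rw [Finset.sum_comm]
      refine Finset.sum_congr rfl fun x _ => ?_
      rw [← A.cup_left, Finset.mul_sum]
      refine Finset.sum_congr rfl fun p _ => ?_
      rw [A.cup_comm o₂ p]
      ring
    · simp only [h, ← A.cup_right, Finset.mul_sum, Finset.sum_mul]
      rw [Finset.sum_comm]
      exact Finset.sum_congr rfl fun x _ => Finset.sum_congr rfl fun p _ => by ring

theorem cap_pair {n : ℕ} (y : Fin 1) (i j : Fin n) :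
    cap n y (finProdFinEquiv (i, j)) = if i = j then 1 else 0 := by
  simp only [cap, Matrix.of_apply, Equiv.symm_apply_apply]

theorem sum_fin_mul {m n : ℕ} (F : Fin (m * n) → ℂ) :
    ∑ x, F x = ∑ i, ∑ j, F (finProdFinEquiv (i, j)) := by
  rw [← finProdFinEquiv.sum_comp F, Fintype.sum_prod_type]

theorem tensor_mul (A B : CPStar) (i i' i'' : Fin A.dim) (j j' j'' : Fin B.dim) :
    (A.tensor B).mul (finProdFinEquiv (i, j)) (finProdFinEquiv (i', j'))
      (finProdFinEquiv (i'', j'')) = A.mul i i' i'' * B.mul j j' j'' := by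
  simp only [tensor, Equiv.symm_apply_apply]

theorem isCP_cap (A : CPStar) : IsCP (A.tensor A.conj) one (cap A.dim) := by
  refine isCP_of_gram _ _ _ (ι := Fin A.dim) (Matrix.of fun s x =>
    star (A.mul s (finProdFinEquiv.symm x.1).2 (finProdFinEquiv.symm x.1).1)) ?_
  ext ⟨o, y⟩ ⟨i, y'⟩
  obtain ⟨o₁, o₂, rfl⟩ : ∃ (a b : Fin A.dim), o = finProdFinEquiv (a, b) :=
    exists_pr (B := A.conj) o
  obtain ⟨i₁, i₂, rfl⟩ : ∃ (a b : Fin A.dim), i = finProdFinEquiv (a, b) :=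
    exists_pr (B := A.conj) i
  refine Eq.trans ?_ ((sum_star_mul_right A o₁ o₂ i₁ i₂).trans
    (Finset.sum_congr rfl fun s _ => ?_))
  swap
  · change _ = star (star (A.mul s (finProdFinEquiv.symm (finProdFinEquiv (o₁, o₂))).2
      (finProdFinEquiv.symm (finProdFinEquiv (o₁, o₂))).1)) *
      star (A.mul s (finProdFinEquiv.symm (finProdFinEquiv (i₁, i₂))).2
      (finProdFinEquiv.symm (finProdFinEquiv (i₁, i₂))).1)
    rw [Equiv.symm_apply_apply, Equiv.symm_apply_apply, star_star]
  change ∑ p : Fin (A.dim * A.dim), ∑ q : Fin 1,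
    star ((A.tensor A.conj).mul _ p _) * cap _ q p * 1 = _
  rw [sum_fin_mul]
  refine Finset.sum_congr rfl fun a _ => ?_
  rw [Finset.sum_eq_single a]
  · rw [Fin.sum_univ_one, cap_pair, if_pos rfl]
    erw [tensor_mul]
    change star (A.mul o₁ a i₁ * star (A.mul o₂ a i₂)) * 1 * 1 = _
    rw [star_mul', star_star, mul_one, mul_one]
  · intro b _ hb
    rw [Fin.sum_univ_one, cap_pair, if_neg hb.symm, mul_zero, zero_mul]
  · exact fun h => absurd (Finset.mem_univ _) h

theorem isCP_cap_transpose (A : CPStar) : IsCP one (A.conj.tensor A) (cap A.dim).transpose := by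
  refine isCP_of_gram _ _ _ (ι := Fin A.dim) (Matrix.of fun s x =>
    A.mul (finProdFinEquiv.symm x.2).2 s (finProdFinEquiv.symm x.2).1) ?_
  ext ⟨y, o⟩ ⟨y', i⟩
  obtain ⟨o₁, o₂, rfl⟩ : ∃ (a b : Fin A.dim), o = finProdFinEquiv (a, b) :=
    exists_pr (A := A.conj) o
  obtain ⟨i₁, i₂, rfl⟩ : ∃ (a b : Fin A.dim), i = finProdFinEquiv (a, b) :=
    exists_pr (A := A.conj) i
  refine Eq.trans ?_ ((sum_star_mul_left A o₁ o₂ i₁ i₂).trans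
    (Finset.sum_congr rfl fun s _ => ?_))
  swap
  · change _ = star (A.mul (finProdFinEquiv.symm (finProdFinEquiv (o₁, o₂))).2 s
      (finProdFinEquiv.symm (finProdFinEquiv (o₁, o₂))).1) *
      A.mul (finProdFinEquiv.symm (finProdFinEquiv (i₁, i₂))).2 s
      (finProdFinEquiv.symm (finProdFinEquiv (i₁, i₂))).1
    rw [Equiv.symm_apply_apply, Equiv.symm_apply_apply]
  change ∑ q : Fin 1, ∑ p : Fin (A.dim * A.dim),
    star 1 * cap _ q p * (A.conj.tensor A).mul p _ _ = _
  rw [Fin.sum_univ_one, sum_fin_mul]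
  refine Finset.sum_congr rfl fun a _ => ?_
  rw [Finset.sum_eq_single a]
  · rw [cap_pair, if_pos rfl]
    erw [tensor_mul]
    rw [star_one, one_mul, one_mul]
    rfl
  · intro b _ hb
    rw [cap_pair, if_neg hb.symm, mul_zero, zero_mul]
  · exact fun h => absurd (Finset.mem_univ _) h

/-- The counit `A ⊗ A^⊥ ⟶ 𝟙`. -/
def ev (A : CPStar) : A ⊗ A.conj ⟶ 𝟙_ CPStar := ⟨cap A.dim, isCP_cap A⟩

/-- The unit `𝟙 ⟶ A^⊥ ⊗ A`. -/
def coev (A : CPStar) : 𝟙_ CPStar ⟶ A.conj ⊗ A := ⟨(cap A.dim).transpose, isCP_cap_transpose A⟩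

theorem ev_mat (A : CPStar) (y : Fin (𝟙_ CPStar).dim) (i j : Fin A.dim) :
    (ev A).mat y (pr (B := A.conj) i j) = if i = j then 1 else 0 := cap_pair y i j

theorem coev_mat (A : CPStar) (y : Fin (𝟙_ CPStar).dim) (i j : Fin A.dim) :
    (coev A).mat (pr (A := A.conj) i j) y = if i = j then 1 else 0 := cap_pair y i j

theorem sum_pr_conj_right {A B : CPStar} {M : Type*} [AddCommMonoid M]
    (F : Fin (A ⊗ B.conj).dim → M) :
    ∑ x, F x = ∑ i : Fin A.dim, ∑ j : Fin B.dim, F (pr (B := B.conj) i j) := sum_pr F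

theorem sum_pr_conj_left {A B : CPStar} {M : Type*} [AddCommMonoid M]
    (F : Fin (A.conj ⊗ B).dim → M) :
    ∑ x, F x = ∑ i : Fin A.dim, ∑ j : Fin B.dim, F (pr (A := A.conj) i j) := sum_pr F

theorem coev_ev (A : CPStar) :
    A ◁ coev A ≫ (α_ A A.conj A).inv ≫ ev A ▷ A = (ρ_ A).hom ≫ (λ_ A).inv := by
  refine mat_ext_pr fun o i x => ?_
  obtain ⟨y, o, rfl⟩ := exists_pr o
  rw [((maps_rightUnitor A i x).comp (maps_leftUnitor_inv A y i)) (pr y o), CPStar.comp_mat,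
    Matrix.mul_apply, sum_pr]
  have h : ∀ (a b c : Fin A.dim), ((α_ A A.conj A).inv ≫ ev A ▷ A).mat (pr y o)
      (pr a (pr (A := A.conj) b c)) = if o = c then if a = b then 1 else 0 else 0 := by
    intro a b c
    rw [(maps_associator_inv A A.conj A a b c).comp_mat, whiskerRight_mat, ev_mat]
  simp only [sum_pr_conj_left, h, whiskerLeft_mat, coev_mat, pr_inj]
  simp [eq_comm]

theorem ev_coev (A : CPStar) :
    coev A ▷ A.conj ≫ (α_ A.conj A A.conj).hom ≫ A.conj ◁ ev A =
      (λ_ A.conj).hom ≫ (ρ_ A.conj).inv := by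
  refine mat_ext_pr fun o x (i : Fin A.dim) => ?_
  obtain ⟨o, y, rfl⟩ : ∃ (a : Fin A.dim) (b : Fin (𝟙_ CPStar).dim), o = pr (A := A.conj) a b :=
    exists_pr o
  rw [((maps_leftUnitor A.conj x i).comp (maps_rightUnitor_inv A.conj i y)) (pr o y),
    CPStar.comp_mat, Matrix.mul_apply, sum_pr_conj_right]
  have h : ∀ (a b c : Fin A.dim), ((α_ A.conj A A.conj).hom ≫ A.conj ◁ ev A).mat (pr o y)
      (pr (B := A.conj) (pr (A := A.conj) a b) c) =
        if o = a then if b = c then 1 else 0 else 0 := by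
    intro a b c
    refine ((maps_associator A.conj A A.conj a b c).comp_mat _ _).trans
      ((whiskerLeft_mat A.conj (ev A) o y a (pr (B := A.conj) b c)).trans ?_)
    rw [ev_mat]
    rfl
  have h' : ∀ (a b c : Fin A.dim), (coev A ▷ A.conj).mat
      (pr (B := A.conj) (pr (A := A.conj) a b) c) (pr x i) =
        if c = i then if a = b then 1 else 0 else 0 := by
    intro a b c
    refine (whiskerRight_mat (coev A) A.conj (pr (A := A.conj) a b) c x i).trans ?_
    rw [coev_mat]
    rfl
  simp only [sum_pr_conj_left, h, h']
  have : ∀ o i : Fin A.dim, (∑ a : Fin A.dim, ∑ b : Fin A.dim, ∑ c : Fin A.dim,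
      (if o = a then if b = c then (1 : ℂ) else 0 else 0) *
        (if c = i then if a = b then 1 else 0 else 0)) = if o = i then 1 else 0 := by
    intro o i
    simp
  exact (this o i).trans (if_congr (pr_inj.trans (and_iff_left rfl)).symm rfl rfl)

instance : CompactClosed CPStar where
  dual := conj
  pairing A :=
    { coevaluation' := coev A
      evaluation' := ev A
      coevaluation_evaluation' := coev_ev A
      evaluation_coevaluation' := ev_coev A }

/-- The counit is a Kronecker delta, so bending a wire moves an index and changes no entry. -/
theorem whiskerLeft_ev_mat {A X : CPStar} (f : X ⟶ A.conj) (y : Fin (𝟙_ CPStar).dim)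
    (i : Fin A.dim) (x : Fin X.dim) :
    (A ◁ f ≫ ev A).mat y (pr i x) = f.mat i x := by
  rw [comp_mat, Matrix.mul_apply, sum_pr_conj_right]
  simp only [ev_mat]
  have h : ∀ a b : Fin A.dim, (A ◁ f).mat (pr (B := A.conj) a b) (pr i x) =
    if a = i then f.mat b x else 0 := fun a b => whiskerLeft_mat _ _ _ _ _ _
  simp only [h]
  simp

theorem bend_mat {A X : CPStar} (p : A ⊗ X ⟶ 𝟙_ CPStar) (y : Fin (𝟙_ CPStar).dim)
    (i : Fin A.dim) (x : Fin X.dim) : (CompactClosed.bend p).mat i x = p.mat y (pr i x) := by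
  rw [← whiskerLeft_ev_mat (CompactClosed.bend p) y]
  exact congrArg (fun q : A ⊗ X ⟶ 𝟙_ CPStar => q.mat y (pr i x))
    (CompactClosed.bendAlong_ev (CompactClosed.dual A) A p)

/-- Here and in the next two lemmas the dimensions agree definitionally; a vector over one object is
later read as a vector over the other without a visible cast. -/
theorem conj_conj (A : CPStar) : A.conj.conj = A :=
  ext_cast rfl (fun _ _ _ => star_star _) fun _ => star_star _

theorem conj_tensor (A B : CPStar) : (A ⊗ B).conj = A.conj ⊗ B.conj :=
  ext_cast rfl (fun _ _ _ => star_mul' _ _) fun _ => star_mul' _ _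

theorem conj_one : one.conj = one := ext_cast rfl (fun _ _ _ => star_one _) fun _ => star_one _

theorem ite_congr_iff {p q : Prop} {_ : Decidable p} {_ : Decidable q} (h : p ↔ q) :
    (if p then (1 : ℂ) else 0) = if q then 1 else 0 := if_congr h rfl rfl

theorem deMorgan_eq (A B : CPStar) :
    CompactClosed.deMorgan A B = eqToHom (conj_tensor A B).symm := by
  refine hom_ext_of_maps fun x => ?_
  obtain ⟨k, l, rfl⟩ : ∃ (k : Fin A.dim) (l : Fin B.dim), x = pr (A := A.conj) (B := B.conj) k l :=
    exists_pr x
  refine ⟨pr (A := A) (B := B) k l, ?_, maps_eqToHom (conj_tensor A B).symm _⟩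
  intro o
  obtain ⟨i, j, rfl⟩ : ∃ (i : Fin A.dim) (j : Fin B.dim), o = pr (A := A) (B := B) i j :=
    exists_pr o
  refine (bend_mat (A := A ⊗ B) _ default _ _).trans ?_
  refine ((maps_tensorμ A B A.conj B.conj i j k l).comp_mat _ _).trans ?_
  refine (comp_leftUnitor_mat _ default _ _).trans ?_
  refine (tensorHom_mat (ev A) (ev B) default default (pr i k) (pr j l)).trans ?_
  erw [ev_mat, ev_mat]
  rw [ite_mul, zero_mul, one_mul, ← ite_and]
  exact ite_congr_iff pr_inj.symm

theorem doubleDual_eq (A : CPStar) :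
    CompactClosed.doubleDual A = eqToHom (conj_conj A).symm := by
  refine hom_ext_of_maps fun (i : Fin A.dim) => ⟨i, ?_, maps_eqToHom (conj_conj A).symm i⟩
  intro (o : Fin A.dim)
  refine (bend_mat (A := A.conj) _ default _ _).trans ?_
  refine ((maps_swapMap A.conj A o i).comp_mat _ _).trans ((ev_mat A default i o).trans ?_)
  exact ite_congr_iff eq_comm

theorem isStrictCompactClosed : IsStrictCompactClosed CPStar where
  tensor_assoc := tensor_assoc
  unit_tensor := one_tensor
  tensor_unit := tensor_one
  associator_eq _ _ _ := rfl
  leftUnitor_eq _ := rfl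
  rightUnitor_eq _ := rfl
  dual_tensor A B := (conj_tensor A B).symm
  deMorgan_eq := deMorgan_eq
  dual_dual A := (conj_conj A).symm
  doubleDual_eq := doubleDual_eq

theorem dualMap_mat {A B : CPStar} (f : A ⟶ B) (i : Fin A.dim) (j : Fin B.dim) :
    (StarAutonomous.dualMap f).mat i j = f.mat j i := by
  refine (bend_mat (X := B.conj) (f ▷ B.conj ≫ ev B) default i j).trans ?_
  rw [comp_mat, Matrix.mul_apply, sum_pr_conj_right]
  have h : ∀ a b : Fin B.dim, (f ▷ B.conj).mat (pr (B := B.conj) a b) (pr (B := B.conj) i j) =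
    if b = j then f.mat a i else 0 := fun a b => whiskerRight_mat _ _ _ _ _ _
  simp only [ev_mat, h]
  simp

theorem parMap_mat {A A' B B' : CPStar} (f : A ⟶ A') (g : B ⟶ B') :
    (StarAutonomous.parMap f g).mat = (f ⊗ₘ g).mat := by
  ext o i
  obtain ⟨k, l, rfl⟩ : ∃ (k : Fin A'.dim) (l : Fin B'.dim), o = pr (A := A') (B := B') k l :=
    exists_pr o
  obtain ⟨i, j, rfl⟩ : ∃ (k : Fin A.dim) (l : Fin B.dim), i = pr (A := A) (B := B) k l :=
    exists_pr i
  refine (dualMap_mat (StarAutonomous.dualMap f ⊗ₘ StarAutonomous.dualMap g) _ _).trans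
    ((tensorHom_mat (StarAutonomous.dualMap f) (StarAutonomous.dualMap g) i j k l).trans ?_)
  rw [tensorHom_mat]
  exact congrArg₂ (· * ·) (dualMap_mat f i k) (dualMap_mat g j l)

end CPStar

/-! ## Positive vectors -/

namespace CPStar

open scoped ComplexOrder

theorem comp_mat_apply {A B C : CPStar} (f : A ⟶ B) (g : B ⟶ C) (o : Fin C.dim)
    (i : Fin A.dim) : (f ≫ g).mat o i = ∑ k, g.mat o k * f.mat k i := rfl

/-- The coordinate vectors of the states of `A`. -/
def IsPos (A : CPStar) (v : Fin A.dim → ℂ) : Prop := IsCP one A (Matrix.of fun i _ => v i)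

/-- The coordinate vectors of the effects of `A`. -/
def IsEff (A : CPStar) (w : Fin A.dim → ℂ) : Prop := IsPos A.conj w

theorem isPos_vec {A : CPStar} (ρ : one ⟶ A) : IsPos A (PreCaus.vec ρ) := by
  have h : (Matrix.of fun i _ => PreCaus.vec ρ i : Matrix (Fin A.dim) (Fin 1) ℂ) = ρ.mat := by
    ext i (x : Fin 1)
    exact congrArg (ρ.mat i) (Subsingleton.elim (0 : Fin 1) x)
  have := ρ.isCP
  rw [← h] at this
  exact this

/-- The state with given coordinates. -/
def toState {A : CPStar} (v : Fin A.dim → ℂ) (h : IsPos A v) : one ⟶ A := ⟨_, h⟩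

theorem vec_injective {A : CPStar} {ρ σ : one ⟶ A} (h : PreCaus.vec ρ = PreCaus.vec σ) : ρ = σ := by
  refine Hom.ext_mat (Matrix.ext fun i (x : Fin 1) => ?_)
  obtain rfl : x = 0 := Subsingleton.elim _ _
  exact congrFun h i

/-- Transposing along the compact structure turns effects of `A` into states of `A.conj` with the
same coordinates. -/
theorem isEff_iff {A : CPStar} {w : Fin A.dim → ℂ} :
    IsEff A w ↔ ∃ π : A ⟶ one, PreCaus.covec π = w := by
  constructor
  · intro h
    refine ⟨(ρ_ A).inv ≫ A ◁ toState (A := A.conj) w h ≫ ev A, funext fun i => ?_⟩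
    refine ((maps_rightUnitor_inv A i default).comp_mat _ _).trans ?_
    exact whiskerLeft_ev_mat _ _ _ _
  · rintro ⟨π, rfl⟩
    have h := isPos_vec (A := A.conj) (CompactClosed.bend ((ρ_ A).hom ≫ π))
    refine Eq.mp (congrArg (IsPos A.conj) (funext fun i => ?_)) h
    exact (bend_mat (A := A) (X := 𝟙_ CPStar) _ default i _).trans
      ((maps_rightUnitor A i _).comp_mat _ _)

theorem comp_effect_eq {A : CPStar} (ρ : one ⟶ A) (π : A ⟶ one) :
    ρ ≫ π = 𝟙 one ↔ PreCaus.covec π ⬝ᵥ PreCaus.vec ρ = 1 := by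
  constructor
  · intro h
    exact congrArg (fun s : one ⟶ one => s.mat (0 : Fin 1) (0 : Fin 1)) h
  · intro h
    refine Hom.ext_mat (Matrix.ext fun (x y : Fin 1) => ?_)
    obtain rfl : x = 0 := Subsingleton.elim _ _
    obtain rfl : y = 0 := Subsingleton.elim _ _
    exact h

/-- Left multiplication by the vector `v`. -/
def leftMul (A : CPStar) (v : Fin A.dim → ℂ) : Matrix (Fin A.dim) (Fin A.dim) ℂ :=
  Matrix.of fun o i => ∑ q, v q * A.mul q i o

theorem choi_one (A : CPStar) (v : Fin A.dim → ℂ) :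
    choi one A (Matrix.of fun i _ => v i) = (leftMul A v).submatrix Prod.snd Prod.snd := by
  ext ⟨x, o⟩ ⟨y, i⟩
  change ∑ p : Fin 1, ∑ q, star (1 : ℂ) * v q * A.mul q i o = ∑ q, v q * A.mul q i o
  simp

open scoped MatrixOrder Matrix.Norms.L2Operator in
theorem exists_conjTranspose_mul_self {n : ℕ} {M : Matrix (Fin n) (Fin n) ℂ}
    (h : M.PosSemidef) : ∃ B : Matrix (Fin n) (Fin n) ℂ, M = B.conjTranspose * B :=
  CStarAlgebra.nonneg_iff_eq_star_mul_self.1 (Matrix.nonneg_iff_posSemidef.2 h)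

/-- By `choi_one` the Choi matrix of a state is its left multiplication operator. Gram matrices are
positive semidefinite, and a positive semidefinite matrix factors as `Bᴴ * B`. -/
theorem isPos_iff {A : CPStar} {v : Fin A.dim → ℂ} : IsPos A v ↔ (leftMul A v).PosSemidef := by
  constructor
  · rintro ⟨r, g, hg⟩
    rw [choi_one] at hg
    have h := (Matrix.posSemidef_conjTranspose_mul_self g).submatrix
      (fun i : Fin A.dim => ((0 : Fin 1), i))
    rw [← hg] at h
    exact h
  · intro h
    obtain ⟨B, hB⟩ := exists_conjTranspose_mul_self h
    refine isCP_of_gram one A _ (ι := Fin A.dim) (B.submatrix id Prod.snd) ?_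
    rw [choi_one, hB]
    rfl

theorem leftMul_add (A : CPStar) (v w : Fin A.dim → ℂ) :
    leftMul A (v + w) = leftMul A v + leftMul A w := by
  ext o i
  simp only [leftMul, Matrix.of_apply, Matrix.add_apply, Pi.add_apply, add_mul,
    Finset.sum_add_distrib]

theorem leftMul_smul (A : CPStar) (a : ℂ) (v : Fin A.dim → ℂ) :
    leftMul A (a • v) = a • leftMul A v := by
  ext o i
  simp only [leftMul, Matrix.of_apply, Matrix.smul_apply, Pi.smul_apply, smul_eq_mul,
    Finset.mul_sum, mul_assoc]

theorem leftMul_unit (A : CPStar) : leftMul A A.unit = 1 := by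
  ext o i
  simp only [leftMul, Matrix.of_apply, A.unit_mul, Matrix.one_apply, eq_comm]

/-- Evaluation at the unit recovers the vector, so the left regular representation is faithful. -/
theorem leftMul_mulVec_unit (A : CPStar) (v : Fin A.dim → ℂ) :
    (leftMul A v).mulVec A.unit = v := by
  ext o
  simp only [leftMul, Matrix.mulVec, dotProduct, Matrix.of_apply, Finset.sum_mul]
  rw [Finset.sum_comm]
  have h : ∀ q, ∑ i, v q * A.mul q i o * A.unit i = v q * if q = o then 1 else 0 := fun q => by
    rw [← A.mul_unit, Finset.mul_sum]
    exact Finset.sum_congr rfl fun _ _ => by ring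
  simp [h]

theorem leftMul_injective {A : CPStar} {v w : Fin A.dim → ℂ} (h : leftMul A v = leftMul A w) :
    v = w := by
  rw [← leftMul_mulVec_unit A v, h, leftMul_mulVec_unit]

/-- The involution of the algebra `A`. -/
def involution (A : CPStar) (x : Fin A.dim → ℂ) : Fin A.dim → ℂ :=
  fun p => ∑ b, star (x b) * A.cup b p

/-- `cup_right` identifies the adjoint of left multiplication: the regular representation respects
the involution. -/
theorem leftMul_involution (A : CPStar) (x : Fin A.dim → ℂ) :
    leftMul A (involution A x) = (leftMul A x).conjTranspose := by
  ext o i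
  simp only [leftMul, involution, Matrix.conjTranspose_apply, Matrix.of_apply, star_sum, star_mul',
    Finset.sum_mul]
  rw [Finset.sum_comm]
  refine Finset.sum_congr rfl fun b _ => ?_
  rw [← A.cup_right, Finset.mul_sum]
  exact Finset.sum_congr rfl fun _ _ => by ring

theorem IsPos.involution_eq {A : CPStar} {v : Fin A.dim → ℂ} (h : IsPos A v) :
    involution A v = v :=
  leftMul_injective ((leftMul_involution A v).trans (isPos_iff.1 h).isHermitian)

/-- Positive functionals are Hermitian: apply `IsPos.involution_eq` to the conjugate structure,
whose cup is the conjugate cup. -/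
theorem IsEff.dotProduct_involution {A : CPStar} {w : Fin A.dim → ℂ} (h : IsEff A w)
    (x : Fin A.dim → ℂ) : w ⬝ᵥ involution A x = star (w ⬝ᵥ x) := by
  have hc : ∀ b p, A.conj.cup b p = star (A.cup b p) := fun b p => by
    simp only [cup, conj, star_sum, star_mul']
    rfl
  have hw : ∀ p, ∑ b, w b * A.cup b p = star (w p) := fun p => by
    have := congrArg star (congrFun (IsPos.involution_eq h) p)
    rw [← this]
    refine Eq.trans ?_ (star_sum _ _).symm
    refine Finset.sum_congr rfl fun b _ => ?_
    exact (((congrArg (fun z => star (star (w b) * z)) (hc b p)).trans (star_mul' _ _)).trans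
      (congrArg₂ (· * ·) (star_star _) (star_star _))).symm
  simp only [dotProduct, involution, Finset.mul_sum, star_sum, star_mul']
  rw [Finset.sum_comm]
  refine Finset.sum_congr rfl fun b _ => ?_
  rw [← hw, Finset.sum_mul]
  refine Finset.sum_congr rfl fun p _ => ?_
  rw [A.cup_comm]
  ring

open scoped MatrixOrder Matrix.Norms.L2Operator in
theorem exists_posSemidef_perturb {n : ℕ} {r : ℝ} (hr : 0 < r) (M : Matrix (Fin n) (Fin n) ℂ)
    (hM : M.IsHermitian) :
    ∃ ε : ℝ, 0 < ε ∧ ((r : ℂ) • (1 : Matrix (Fin n) (Fin n) ℂ) + (ε : ℂ) • M).PosSemidef := by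
  have hM' : IsSelfAdjoint M := hM
  have h := hM'.neg_algebraMap_norm_le_self
  have hp : 0 ≤ M + algebraMap ℝ _ ‖M‖ := by
    have := neg_le_iff_add_nonneg.1 h
    exact this
  rw [Matrix.nonneg_iff_posSemidef] at hp
  have hn : 0 < ‖M‖ + 1 := by positivity
  -- With this `ε` one has `r • 1 + ε • M = ε • (M + ‖M‖ • 1) + ε • 1`, a sum of positive
  -- semidefinite matrices.
  refine ⟨r / (‖M‖ + 1), by positivity, ?_⟩
  have h1 := hp.smul (show (0 : ℝ) ≤ r / (‖M‖ + 1) by positivity)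
  have h2 := (Matrix.PosSemidef.one (n := Fin n) (R := ℂ)).smul
    (show (0 : ℝ) ≤ r / (‖M‖ + 1) by positivity)
  refine Eq.mpr (congrArg Matrix.PosSemidef ?_) (h1.add h2)
  ext i j
  have e : (r : ℂ) = (r / (‖M‖ + 1) : ℝ) * ‖M‖ + (r / (‖M‖ + 1) : ℝ) := by
    rw [← Complex.ofReal_mul, ← Complex.ofReal_add]
    congr 1
    field_simp
  simp only [Matrix.add_apply, Matrix.smul_apply, Matrix.algebraMap_matrix_apply, Matrix.one_apply,
    smul_eq_mul, Complex.real_smul]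
  split_ifs
  · simp only [Complex.coe_algebraMap]
    linear_combination e
  · simp

/-- The unit is interior to the positive cone, so the hypothesis applies to small multiples of every
Hermitian combination of `x` and its involute; these combinations span `x`. -/
theorem eq_zero_of_perturb {A : CPStar} {r : ℝ} (hr : 0 < r) (x : Fin A.dim → ℂ)
    (l : (Fin A.dim → ℂ) →ₗ[ℂ] ℂ)
    (h : ∀ a b : ℂ, IsPos A ((r : ℂ) • A.unit + (a • x + b • involution A x)) →
      l (a • x + b • involution A x) = 0) : l x = 0 := by
  have key : ∀ a : ℂ, l (a • x + star a • involution A x) = 0 := by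
    intro a
    obtain ⟨ε, hε, hp⟩ := exists_posSemidef_perturb hr
      (leftMul A (a • x + star a • involution A x)) (by
        rw [Matrix.IsHermitian, leftMul_add, leftMul_smul, leftMul_smul, leftMul_involution,
          Matrix.conjTranspose_add, Matrix.conjTranspose_smul, Matrix.conjTranspose_smul,
          Matrix.conjTranspose_conjTranspose, star_star, add_comm])
    have h' := h (ε * a) (ε * star a) (by
      rw [isPos_iff, mul_smul, mul_smul, ← smul_add, leftMul_add, leftMul_smul, leftMul_smul,
        leftMul_unit]
      exact hp)
    rw [mul_smul, mul_smul, ← smul_add, map_smul, smul_eq_mul] at h'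
    exact (mul_eq_zero.1 h').resolve_left (Complex.ofReal_ne_zero.2 hε.ne')
  -- Writing `x*` for the involute, `a = 1` gives `l x + l x* = 0` and `a = i` gives `i (l x - l x*)
  -- = 0`.
  have h1 := key 1
  have h2 := key Complex.I
  simp only [map_add, map_smul, smul_eq_mul, star_one, one_mul, Complex.star_def,
    Complex.conj_I] at h1 h2
  have h3 : (2 * Complex.I) * l x = 0 := by linear_combination Complex.I * h1 + h2
  exact (mul_eq_zero.1 h3).resolve_left (by simp)

/-- The vector `v ⊗ w`. -/
def tens {A B : CPStar} (v : Fin A.dim → ℂ) (w : Fin B.dim → ℂ) : Fin (A ⊗ B).dim → ℂ :=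
  fun x => v (finProdFinEquiv.symm x).1 * w (finProdFinEquiv.symm x).2

theorem tens_pr {A B : CPStar} (v : Fin A.dim → ℂ) (w : Fin B.dim → ℂ) (i : Fin A.dim)
    (j : Fin B.dim) : tens v w (pr i j) = v i * w j := by
  simp only [tens, pr, Equiv.symm_apply_apply]

theorem unit_tensor (A B : CPStar) : (A ⊗ B).unit = tens A.unit B.unit := rfl

theorem involution_tens {A B : CPStar} (v : Fin A.dim → ℂ) (w : Fin B.dim → ℂ) :
    involution (A ⊗ B) (tens v w) = tens (involution A v) (involution B w) := by
  have hc : ∀ i j i' j', (A ⊗ B).cup (pr i j) (pr i' j') = A.cup i i' * B.cup j j' := by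
    intro i j i' j'
    unfold cup
    rw [sum_pr, Finset.sum_mul_sum]
    refine Finset.sum_congr rfl fun k _ => Finset.sum_congr rfl fun l _ => ?_
    refine Eq.trans (congrArg₂ (fun a b => a * star b) (tens_pr A.unit B.unit k l)
      (tensor_mul A B i i' k j j' l)) ?_
    rw [star_mul']
    ring
  ext x
  obtain ⟨i, j, rfl⟩ := exists_pr x
  rw [tens_pr]
  unfold involution
  rw [sum_pr, Finset.sum_mul_sum]
  refine Finset.sum_congr rfl fun k _ => Finset.sum_congr rfl fun l _ => ?_
  rw [hc, tens_pr, star_mul']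
  ring

theorem IsPos.tens {A B : CPStar} {v : Fin A.dim → ℂ} {w : Fin B.dim → ℂ} (hv : IsPos A v)
    (hw : IsPos B w) : IsPos (A ⊗ B) (CPStar.tens v w) := by
  refine Eq.mp (congrArg (IsPos (A ⊗ B)) (funext fun x => ?_))
    (isPos_vec ((λ_ (𝟙_ CPStar)).inv ≫ (toState v hv ⊗ₘ toState w hw)))
  obtain ⟨i, j, rfl⟩ := exists_pr x
  rw [tens_pr]
  exact ((maps_leftUnitor_inv (𝟙_ CPStar) default _).comp_mat _ _).trans
    (tensorHom_mat (toState v hv) (toState w hw) i j _ _)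

/-- `(1 ⊗ w) h` -/
def margLeft {A B : CPStar} (h : Fin (A ⊗ B).dim → ℂ) (w : Fin B.dim → ℂ) : Fin A.dim → ℂ :=
  fun i => ∑ j, w j * h (pr i j)

/-- `(w ⊗ 1) h` -/
def margRight {A B : CPStar} (h : Fin (A ⊗ B).dim → ℂ) (w : Fin A.dim → ℂ) : Fin B.dim → ℂ :=
  fun j => ∑ i, w i * h (pr i j)

/-- Taking a marginal is composition with `A ◁ π`, so positivity follows from closure of CP maps
under composition. -/
theorem isPos_margLeft {A B : CPStar} {h : Fin (A ⊗ B).dim → ℂ} {w : Fin B.dim → ℂ}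
    (hh : IsPos (A ⊗ B) h) (hw : IsEff B w) : IsPos A (margLeft h w) := by
  obtain ⟨π, rfl⟩ := isEff_iff.1 hw
  refine Eq.mp (congrArg (IsPos A) (funext fun i => ?_))
    (isPos_vec (toState h hh ≫ A ◁ π ≫ (ρ_ A).hom))
  refine (comp_mat_apply (A := one) _ _ i (0 : Fin 1)).trans ?_
  rw [sum_pr]
  simp only [comp_rightUnitor_mat _ _ default, whiskerLeft_mat]
  rw [Finset.sum_eq_single i]
  · simp only [if_true]
    rfl
  · intro b _ hb
    simp [hb.symm]
  · exact fun h => absurd (Finset.mem_univ _) h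

theorem isPos_margRight {A B : CPStar} {h : Fin (A ⊗ B).dim → ℂ} {w : Fin A.dim → ℂ}
    (hh : IsPos (A ⊗ B) h) (hw : IsEff A w) : IsPos B (margRight h w) := by
  obtain ⟨π, rfl⟩ := isEff_iff.1 hw
  refine Eq.mp (congrArg (IsPos B) (funext fun i => ?_))
    (isPos_vec (toState h hh ≫ π ▷ B ≫ (λ_ B).hom))
  refine (comp_mat_apply (A := one) _ _ i (0 : Fin 1)).trans ?_
  rw [sum_pr]
  simp only [comp_leftUnitor_mat _ default, whiskerRight_mat]
  refine Finset.sum_congr rfl fun a _ => ?_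
  rw [Finset.sum_eq_single i]
  · simp only [if_true]
    rfl
  · intro b _ hb
    simp [hb.symm]
  · exact fun h => absurd (Finset.mem_univ _) h

theorem isEff_tensor_iff {A B : CPStar} {φ : Fin (A ⊗ B).dim → ℂ} :
    IsEff (A ⊗ B) φ ↔ IsPos (A.conj ⊗ B.conj) φ := by
  have : ∀ {X Y : CPStar} (h : X = Y) (v : Fin Y.dim → ℂ),
      IsPos X (fun i => v (Fin.cast (congrArg dim h) i)) ↔ IsPos Y v := by
    intro X Y h v
    subst h
    rfl
  exact this (conj_tensor A B) φ

theorem isEff_conj_iff {A : CPStar} {v : Fin A.dim → ℂ} : IsEff A.conj v ↔ IsPos A v := by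
  have : ∀ {X Y : CPStar} (h : X = Y) (v : Fin Y.dim → ℂ),
      IsPos X (fun i => v (Fin.cast (congrArg dim h) i)) ↔ IsPos Y v := by
    intro X Y h v
    subst h
    rfl
  exact this (conj_conj A) v

theorem IsEff.tens {A B : CPStar} {v : Fin A.dim → ℂ} {w : Fin B.dim → ℂ} (hv : IsEff A v)
    (hw : IsEff B w) : IsEff (A ⊗ B) (CPStar.tens v w) :=
  isEff_tensor_iff.2 (IsPos.tens (A := A.conj) (B := B.conj) hv hw)

theorem isEff_margLeft {A B : CPStar} {φ : Fin (A ⊗ B).dim → ℂ} {v : Fin B.dim → ℂ}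
    (hφ : IsEff (A ⊗ B) φ) (hv : IsPos B v) : IsEff A (margLeft φ v) :=
  isPos_margLeft (A := A.conj) (B := B.conj) (isEff_tensor_iff.1 hφ) (isEff_conj_iff.2 hv)

theorem isEff_margRight {A B : CPStar} {φ : Fin (A ⊗ B).dim → ℂ} {v : Fin A.dim → ℂ}
    (hφ : IsEff (A ⊗ B) φ) (hv : IsPos A v) : IsEff B (margRight φ v) :=
  isPos_margRight (A := A.conj) (B := B.conj) (isEff_tensor_iff.1 hφ) (isEff_conj_iff.2 hv)

end CPStar

/-! ## Closed and flat sets of states -/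

namespace CPStar

theorem isPos_congr {X Y : CPStar} (h : X = Y) (v : Fin Y.dim → ℂ) :
    IsPos X (fun i => v (Fin.cast (congrArg dim h) i)) ↔ IsPos Y v := by
  subst h
  rfl

theorem isEff_congr {X Y : CPStar} (h : X = Y) (v : Fin Y.dim → ℂ) :
    IsEff X (fun i => v (Fin.cast (congrArg dim h) i)) ↔ IsEff Y v := by
  subst h
  rfl

theorem isEff_conj_tensor_iff {A B : CPStar} {v : Fin (A ⊗ B).dim → ℂ} :
    IsEff (A.conj ⊗ B.conj) v ↔ IsPos (A ⊗ B) v :=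
  (isEff_congr (conj_tensor A B).symm v).trans isEff_conj_iff

theorem involution_add (A : CPStar) (v w : Fin A.dim → ℂ) :
    involution A (v + w) = involution A v + involution A w := by
  ext p
  simp only [involution, Pi.add_apply, star_add, add_mul, Finset.sum_add_distrib]

theorem involution_neg (A : CPStar) (v : Fin A.dim → ℂ) :
    involution A (-v) = -involution A v := by
  ext p
  simp only [involution, Pi.neg_apply, star_neg, neg_mul, Finset.sum_neg_distrib]

/-- The functional `w ⬝ᵥ ·`. -/
def dotLeft {n : ℕ} (w : Fin n → ℂ) : (Fin n → ℂ) →ₗ[ℂ] ℂ where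
  toFun v := w ⬝ᵥ v
  map_add' := dotProduct_add w
  map_smul' a v := dotProduct_smul a w v

theorem dotLeft_apply {n : ℕ} (w v : Fin n → ℂ) : dotLeft w v = w ⬝ᵥ v := rfl

theorem dotProduct_eq_one_comm {n : ℕ} (w v : Fin n → ℂ) : w ⬝ᵥ v = 1 ↔ v ⬝ᵥ w = 1 := by
  rw [dotProduct_comm]

/-- The involution on functionals. -/
def coinvolution (A : CPStar) (x : Fin A.dim → ℂ) : Fin A.dim → ℂ := involution A.conj x

theorem IsPos.coinvolution_dotProduct {A : CPStar} {v : Fin A.dim → ℂ} (h : IsPos A v)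
    (x : Fin A.dim → ℂ) : coinvolution A x ⬝ᵥ v = star (x ⬝ᵥ v) := by
  rw [dotProduct_comm, dotProduct_comm x]
  exact IsEff.dotProduct_involution (isEff_conj_iff.2 h) x

theorem eq_zero_of_perturb_effect {A : CPStar} {r : ℝ} (hr : 0 < r) (x : Fin A.dim → ℂ)
    (l : (Fin A.dim → ℂ) →ₗ[ℂ] ℂ)
    (h : ∀ a b : ℂ, IsEff A ((r : ℂ) • star A.unit + (a • x + b • coinvolution A x)) →
      l (a • x + b • coinvolution A x) = 0) : l x = 0 :=
  eq_zero_of_perturb (A := A.conj) hr x l h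

/-- `c` is a closed flat set of states of `A`, with dual set of effects `d`. -/
structure DualPair (A : CPStar) (c d : Set (Fin A.dim → ℂ)) : Prop where
  mem_left_iff : ∀ v, v ∈ c ↔ IsPos A v ∧ ∀ w ∈ d, w ⬝ᵥ v = 1
  mem_right_iff : ∀ w, w ∈ d ↔ IsEff A w ∧ ∀ v ∈ c, w ⬝ᵥ v = 1
  unit_left : ∃ r : ℝ, 0 < r ∧ (r : ℂ) • A.unit ∈ c
  unit_right : ∃ r : ℝ, 0 < r ∧ (r : ℂ) • star A.unit ∈ d

namespace DualPair

variable {A B : CPStar} {c d : Set (Fin A.dim → ℂ)} {c' d' : Set (Fin B.dim → ℂ)}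

theorem isPos (h : DualPair A c d) {v : Fin A.dim → ℂ} (hv : v ∈ c) : IsPos A v :=
  ((h.mem_left_iff v).1 hv).1

theorem isEff (h : DualPair A c d) {w : Fin A.dim → ℂ} (hw : w ∈ d) : IsEff A w :=
  ((h.mem_right_iff w).1 hw).1

theorem dot (h : DualPair A c d) {v w : Fin A.dim → ℂ} (hv : v ∈ c) (hw : w ∈ d) :
    w ⬝ᵥ v = 1 :=
  ((h.mem_left_iff v).1 hv).2 w hw

theorem symm (h : DualPair A c d) : DualPair A.conj d c where
  mem_left_iff w := (h.mem_right_iff w).trans (and_congr Iff.rfl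
    (forall₂_congr fun v _ => dotProduct_eq_one_comm _ _))
  mem_right_iff v := (h.mem_left_iff v).trans (and_congr isEff_conj_iff.symm
    (forall₂_congr fun v _ => dotProduct_eq_one_comm _ _))
  unit_left := h.unit_right
  unit_right := by
    obtain ⟨r, hr, h⟩ := h.unit_left
    refine ⟨r, hr, ?_⟩
    have e : star A.conj.unit = A.unit := funext fun _ => star_star _
    rw [e]
    exact h

/-- A functional that is constant on `c` annihilates everything that `d` annihilates. -/
theorem dot_eq_zero (h : DualPair A c d) {ψ w : Fin A.dim → ℂ} {k : ℂ}
    (hψ : ∀ v ∈ c, ψ ⬝ᵥ v = k) (hw : ∀ π ∈ d, π ⬝ᵥ w = 0) : ψ ⬝ᵥ w = 0 := by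
  obtain ⟨r, hr, hu⟩ := h.unit_right
  -- The normalised counit is 1 on `c`; subtracting `k` times it makes the constant 0.
  set ψ₀ : Fin A.dim → ℂ := ψ + (-k) • (r : ℂ) • star A.unit with hψ₀
  have h0 : ∀ v ∈ c, ψ₀ ⬝ᵥ v = 0 := fun v hv => by
    rw [hψ₀, add_dotProduct, smul_dotProduct, h.dot hv hu, hψ v hv, smul_eq_mul, mul_one,
      add_neg_cancel]
  have key : dotLeft w ψ₀ = 0 := by
    -- Perturbing the normalised counit by `ψ₀` and its involute keeps the value 1 on `c`, so the
    -- result lies in `d` as soon as it is positive, and is then annihilated by `w`.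
    refine eq_zero_of_perturb_effect hr ψ₀ (dotLeft w) fun a b hab => ?_
    have h2 := hw _ ((h.mem_right_iff _).2 ⟨hab, fun v hv => by
      rw [add_dotProduct, add_dotProduct, smul_dotProduct a, smul_dotProduct b,
        (h.isPos hv).coinvolution_dotProduct, h.dot hv hu, h0 v hv]
      simp⟩)
    rwa [add_dotProduct, hw _ hu, zero_add, dotProduct_comm] at h2
  rwa [dotLeft_apply, dotProduct_comm, hψ₀, add_dotProduct, smul_dotProduct, hw _ hu, smul_zero,
    add_zero] at key

end DualPair

section Marginals

variable {A B : CPStar}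

theorem margLeft_tens (v : Fin A.dim → ℂ) (w p : Fin B.dim → ℂ) :
    margLeft (tens v w) p = (p ⬝ᵥ w) • v := by
  ext i
  simp only [margLeft, tens_pr, dotProduct, Pi.smul_apply, smul_eq_mul, Finset.sum_mul]
  exact Finset.sum_congr rfl fun _ _ => by ring

theorem margLeft_add (g h : Fin (A ⊗ B).dim → ℂ) (p : Fin B.dim → ℂ) :
    margLeft (g + h) p = margLeft g p + margLeft h p := by
  ext i
  simp only [margLeft, Pi.add_apply, mul_add, Finset.sum_add_distrib]

theorem margLeft_sub (g h : Fin (A ⊗ B).dim → ℂ) (p : Fin B.dim → ℂ) :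
    margLeft (g - h) p = margLeft g p - margLeft h p := by
  ext i
  simp only [margLeft, Pi.sub_apply, mul_sub, Finset.sum_sub_distrib]

theorem dot_pr (φ h : Fin (A ⊗ B).dim → ℂ) :
    φ ⬝ᵥ h = ∑ i, (fun j => φ (pr i j)) ⬝ᵥ fun j => h (pr i j) := sum_pr _

theorem dot_tens (φ : Fin (A ⊗ B).dim → ℂ) (v : Fin A.dim → ℂ) (w : Fin B.dim → ℂ) :
    φ ⬝ᵥ tens v w = margLeft φ w ⬝ᵥ v := by
  rw [dot_pr]
  simp only [dotProduct, tens_pr, margLeft, Finset.sum_mul]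
  exact Finset.sum_congr rfl fun _ _ => Finset.sum_congr rfl fun _ _ => by ring

theorem dot_tens' (φ : Fin (A ⊗ B).dim → ℂ) (v : Fin A.dim → ℂ) (w : Fin B.dim → ℂ) :
    φ ⬝ᵥ tens v w = margRight φ v ⬝ᵥ w := by
  rw [dot_pr]
  simp only [dotProduct, tens_pr, margRight, Finset.sum_mul]
  rw [Finset.sum_comm]
  exact Finset.sum_congr rfl fun _ _ => Finset.sum_congr rfl fun _ _ => by ring

theorem tens_dot_tens (p v : Fin A.dim → ℂ) (q w : Fin B.dim → ℂ) :
    tens p q ⬝ᵥ tens v w = (p ⬝ᵥ v) * (q ⬝ᵥ w) := by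
  rw [dot_tens, margLeft_tens, smul_dotProduct, smul_eq_mul, dotProduct_comm w q, mul_comm]

theorem smul_tens (a : ℂ) (v : Fin A.dim → ℂ) (w : Fin B.dim → ℂ) :
    a • tens v w = tens (a • v) w := by
  ext x
  simp only [tens, Pi.smul_apply, smul_eq_mul, mul_assoc]

theorem tens_smul (a : ℂ) (v : Fin A.dim → ℂ) (w : Fin B.dim → ℂ) :
    tens v (a • w) = tens (a • v) w := by
  ext x
  simp only [tens, Pi.smul_apply, smul_eq_mul]
  ring

theorem add_tens (v v' : Fin A.dim → ℂ) (w : Fin B.dim → ℂ) :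
    tens (v + v') w = tens v w + tens v' w := by
  ext x
  simp only [tens, Pi.add_apply, add_mul]

theorem tens_sub (v : Fin A.dim → ℂ) (w w' : Fin B.dim → ℂ) :
    tens v (w - w') = tens v w - tens v w' := by
  ext x
  simp only [tens, Pi.sub_apply, mul_sub]

theorem smul_unit_tensor (r s : ℝ) :
    ((r * s : ℝ) : ℂ) • (A ⊗ B).unit = tens ((r : ℂ) • A.unit) ((s : ℂ) • B.unit) := by
  rw [unit_tensor, tens_smul, smul_tens, smul_smul, Complex.ofReal_mul, mul_comm]

theorem smul_star_unit_tensor (r s : ℝ) :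
    ((r * s : ℝ) : ℂ) • star (A ⊗ B).unit =
      tens ((r : ℂ) • star A.unit) ((s : ℂ) • star B.unit) := by
  have h : star (A ⊗ B).unit = tens (star A.unit) (star B.unit) := funext fun _ => star_mul' _ _
  rw [h, tens_smul, smul_tens, smul_smul, Complex.ofReal_mul, mul_comm]

/-- Expand along the index of `A`: each row of `φ` is constant on `c'` and each row of `g` is
annihilated by `d'`, so `DualPair.dot_eq_zero` applies row by row. -/
theorem dot_eq_zero_of_marginals {c' d' : Set (Fin B.dim → ℂ)} (hB : DualPair B c' d')
    {φ g : Fin (A ⊗ B).dim → ℂ} {m : Fin A.dim → ℂ} (hφ : ∀ σ ∈ c', margLeft φ σ = m)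
    (hg : ∀ π ∈ d', margLeft g π = 0) : φ ⬝ᵥ g = 0 := by
  rw [dot_pr]
  refine Finset.sum_eq_zero fun i _ => hB.dot_eq_zero (k := m i) (fun σ hσ => ?_) fun π hπ => ?_
  · rw [dotProduct_comm]
    exact congrFun (hφ σ hσ) i
  · exact congrFun (hg π hπ) i

/-- `DualPair.dot_eq_zero` is used once in each factor: product effects in `d` and `d'` suffice to
test against any product of functionals constant on states. -/
theorem tens_dot_eq_zero {c d : Set (Fin A.dim → ℂ)} {c' d' : Set (Fin B.dim → ℂ)}
    (hA : DualPair A c d) (hB : DualPair B c' d') {g : Fin (A ⊗ B).dim → ℂ}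
    {ψ : Fin A.dim → ℂ} {χ : Fin B.dim → ℂ} {k l : ℂ} (hψ : ∀ v ∈ c, ψ ⬝ᵥ v = k)
    (hχ : ∀ v ∈ c', χ ⬝ᵥ v = l) (hg : ∀ π ∈ d, ∀ π' ∈ d', tens π π' ⬝ᵥ g = 0) :
    tens ψ χ ⬝ᵥ g = 0 := by
  rw [dotProduct_comm, dot_tens', dotProduct_comm]
  refine hB.dot_eq_zero hχ fun π' hπ' => ?_
  rw [dotProduct_comm, ← dot_tens', dot_tens, dotProduct_comm]
  refine hA.dot_eq_zero hψ fun π hπ => ?_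
  rw [dotProduct_comm, ← dot_tens, dotProduct_comm]
  exact hg π hπ π' hπ'

end Marginals

/-! ### One-way signalling -/

/-- The one-way signalling states, in coordinates. -/
def seqSet (A B : CPStar) (c : Set (Fin A.dim → ℂ)) (d' : Set (Fin B.dim → ℂ)) :
    Set (Fin (A ⊗ B).dim → ℂ) :=
  {h | IsPos (A ⊗ B) h ∧ ∃ m ∈ c, ∀ π ∈ d', margLeft h π = m}

/-- The effects that are dual to the one-way signalling states, in coordinates. -/
def coseqSet (A B : CPStar) (d : Set (Fin A.dim → ℂ)) (c' : Set (Fin B.dim → ℂ)) :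
    Set (Fin (A ⊗ B).dim → ℂ) :=
  {φ | IsEff (A ⊗ B) φ ∧ ∃ m ∈ d, ∀ σ ∈ c', margLeft φ σ = m}

/-- Passing to conjugate structures exchanges the roles of states and effects, so one half of each
duality argument yields the other. -/
theorem mem_coseqSet_iff {A B : CPStar} {d : Set (Fin A.dim → ℂ)} {c' : Set (Fin B.dim → ℂ)}
    {φ : Fin (A ⊗ B).dim → ℂ} : φ ∈ coseqSet A B d c' ↔ φ ∈ seqSet A.conj B.conj d c' :=
  and_congr isEff_tensor_iff Iff.rfl

theorem mem_seqSet_iff {A B : CPStar} {c : Set (Fin A.dim → ℂ)} {d' : Set (Fin B.dim → ℂ)}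
    {φ : Fin (A ⊗ B).dim → ℂ} : φ ∈ seqSet A B c d' ↔ φ ∈ coseqSet A.conj B.conj c d' :=
  and_congr isEff_conj_tensor_iff.symm Iff.rfl

section Seq

variable {A B : CPStar} {c d : Set (Fin A.dim → ℂ)} {c' d' : Set (Fin B.dim → ℂ)}

theorem tens_mem_seqSet (hA : DualPair A c d) (hB : DualPair B c' d') {v : Fin A.dim → ℂ}
    {w : Fin B.dim → ℂ} (hv : v ∈ c) (hw : w ∈ c') : tens v w ∈ seqSet A B c d' :=
  ⟨(hA.isPos hv).tens (hB.isPos hw), v, hv, fun π hπ => by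
    rw [margLeft_tens, hB.dot hw hπ, one_smul]⟩

theorem tens_mem_coseqSet (hA : DualPair A c d) (hB : DualPair B c' d') {v : Fin A.dim → ℂ}
    {w : Fin B.dim → ℂ} (hv : v ∈ d) (hw : w ∈ d') : tens v w ∈ coseqSet A B d c' :=
  mem_coseqSet_iff.2 (tens_mem_seqSet hA.symm hB.symm hv hw)

/-- A functional that is constant on the one-way signalling states does not distinguish states of
the second factor. -/
theorem eq_of_const_on_seqSet (hA : DualPair A c d) (hB : DualPair B c' d')
    (l : (Fin (A ⊗ B).dim → ℂ) →ₗ[ℂ] ℂ) {k : ℂ} (hl : ∀ h ∈ seqSet A B c d', l h = k)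
    (v : Fin A.dim → ℂ) {σ τ : Fin B.dim → ℂ} (hσ : σ ∈ c') (hτ : τ ∈ c') :
    l (tens v σ) = l (tens v τ) := by
  obtain ⟨r, hr, hu⟩ := hA.unit_left
  obtain ⟨s, hs, hu'⟩ := hB.unit_left
  -- States are self-adjoint, so the involute of `v ⊗ (σ - τ)` is again a product with `σ - τ`.
  have hi : involution B (σ - τ) = σ - τ := by
    rw [sub_eq_add_neg, involution_add, involution_neg, (hB.isPos hσ).involution_eq,
      (hB.isPos hτ).involution_eq]
  rw [← sub_eq_zero, ← map_sub, ← tens_sub]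
  refine eq_zero_of_perturb (mul_pos hr hs) _ l fun a b hab => ?_
  have h1 := hl _ (tens_mem_seqSet hA hB hu hu')
  -- Effects in `d'` annihilate `σ - τ`, so the perturbed uniform state keeps the marginal `r •
  -- A.unit`.
  have h2 := hl _ (show _ ∈ seqSet A B c d' from ⟨hab, _, hu, fun π hπ => by
    rw [smul_unit_tensor, involution_tens, hi, smul_tens, smul_tens, ← add_tens, margLeft_add,
      margLeft_tens, margLeft_tens, dotProduct_sub, hB.dot hσ hπ, hB.dot hτ hπ, hB.dot hu' hπ,
      sub_self, zero_smul, add_zero, one_smul]⟩)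
  rw [map_add, smul_unit_tensor, h1] at h2
  exact add_eq_left.1 h2

/-- `h` and `m ⊗ (s • u)` have the same marginals, which is all that `φ` sees; on the latter `φ`
evaluates to `m' ⬝ᵥ m = 1`. -/
theorem dot_seqSet (hB : DualPair B c' d') (hA : DualPair A c d) {h φ : Fin (A ⊗ B).dim → ℂ}
    (hh : h ∈ seqSet A B c d') (hφ : φ ∈ coseqSet A B d c') : φ ⬝ᵥ h = 1 := by
  obtain ⟨-, m, hm, hh⟩ := hh
  obtain ⟨-, m', hm', hφ⟩ := hφ
  obtain ⟨s, hs, hu⟩ := hB.unit_left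
  have h1 : φ ⬝ᵥ (h - tens m ((s : ℂ) • B.unit)) = 0 := by
    refine dot_eq_zero_of_marginals hB hφ fun π hπ => ?_
    rw [margLeft_sub, hh π hπ, margLeft_tens, hB.dot hu hπ, one_smul, sub_self]
  rw [dotProduct_sub, dot_tens, hφ _ hu, hA.dot hm hm'] at h1
  exact sub_eq_zero.1 h1

/-- The candidate for the common marginal is the one at the uniform state of `B`. Product states
show that it lies in `d`; `eq_of_const_on_seqSet` shows that other states of `B` give the same. -/
theorem mem_coseqSet_of_dot (hA : DualPair A c d) (hB : DualPair B c' d')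
    {φ : Fin (A ⊗ B).dim → ℂ} (hφ : IsEff (A ⊗ B) φ) (h : ∀ v ∈ seqSet A B c d', φ ⬝ᵥ v = 1) :
    φ ∈ coseqSet A B d c' := by
  obtain ⟨s, hs, hu⟩ := hB.unit_left
  refine ⟨hφ, margLeft φ ((s : ℂ) • B.unit), (hA.mem_right_iff _).2
    ⟨isEff_margLeft hφ (hB.isPos hu), fun v hv => ?_⟩, fun σ hσ => funext fun i => ?_⟩
  · rw [← dot_tens]
    exact h _ (tens_mem_seqSet hA hB hv hu)
  · have e := eq_of_const_on_seqSet hA hB (dotLeft φ) h (Pi.single i 1) hσ hu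
    rw [dotLeft_apply, dotLeft_apply, dot_tens, dot_tens, dotProduct_single_one,
      dotProduct_single_one] at e
    exact e

/-- One-way signalling is self-dual. -/
theorem dualPair_seqSet (hA : DualPair A c d) (hB : DualPair B c' d') :
    DualPair (A ⊗ B) (seqSet A B c d') (coseqSet A B d c') where
  mem_left_iff v := by
    refine ⟨fun hv => ⟨hv.1, fun w hw => dot_seqSet hB hA hv hw⟩, fun ⟨hv, h⟩ => ?_⟩
    -- The converse for states is the converse for effects over the conjugate structures.
    refine mem_seqSet_iff.2 (mem_coseqSet_of_dot hA.symm hB.symm (isEff_conj_tensor_iff.2 hv)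
      fun w hw => ?_)
    exact (dotProduct_comm _ _).trans (h w (mem_coseqSet_iff.2 hw))
  mem_right_iff w := ⟨fun hw => ⟨hw.1, fun v hv => dot_seqSet hB hA hv hw⟩,
    fun ⟨hw, h⟩ => mem_coseqSet_of_dot hA hB hw h⟩
  unit_left := by
    obtain ⟨r, hr, hu⟩ := hA.unit_left
    obtain ⟨s, hs, hu'⟩ := hB.unit_left
    exact ⟨r * s, mul_pos hr hs, smul_unit_tensor (A := A) (B := B) r s ▸
      tens_mem_seqSet hA hB hu hu'⟩
  unit_right := by
    obtain ⟨r, hr, hu⟩ := hA.unit_right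
    obtain ⟨s, hs, hu'⟩ := hB.unit_right
    exact ⟨r * s, mul_pos hr hs, smul_star_unit_tensor (A := A) (B := B) r s ▸
      tens_mem_coseqSet hA hB hu hu'⟩

end Seq

/-! ### Tensor products -/

/-- The effects that send all products of states in `c` and `c'` to `1`. -/
def cotensSet (A B : CPStar) (c : Set (Fin A.dim → ℂ)) (c' : Set (Fin B.dim → ℂ)) :
    Set (Fin (A ⊗ B).dim → ℂ) :=
  {φ | IsEff (A ⊗ B) φ ∧ ∀ v ∈ c, ∀ w ∈ c', φ ⬝ᵥ tens v w = 1}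

/-- The closure of the set of products of states in `c` and `c'`. -/
def tensSet (A B : CPStar) (c : Set (Fin A.dim → ℂ)) (c' : Set (Fin B.dim → ℂ)) :
    Set (Fin (A ⊗ B).dim → ℂ) :=
  {h | IsPos (A ⊗ B) h ∧ ∀ φ ∈ cotensSet A B c c', φ ⬝ᵥ h = 1}

section Tens

variable {A B : CPStar} {c d : Set (Fin A.dim → ℂ)} {c' d' : Set (Fin B.dim → ℂ)}

theorem tens_mem_tensSet (hA : DualPair A c d) (hB : DualPair B c' d') {v : Fin A.dim → ℂ}
    {w : Fin B.dim → ℂ} (hv : v ∈ c) (hw : w ∈ c') : tens v w ∈ tensSet A B c c' :=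
  ⟨(hA.isPos hv).tens (hB.isPos hw), fun _ hφ => hφ.2 v hv w hw⟩

theorem tens_mem_cotensSet (hA : DualPair A c d) (hB : DualPair B c' d') {v : Fin A.dim → ℂ}
    {w : Fin B.dim → ℂ} (hv : v ∈ d) (hw : w ∈ d') : tens v w ∈ cotensSet A B c c' :=
  ⟨(hA.isEff hv).tens (hB.isEff hw), fun x hx y hy => by
    rw [tens_dot_tens, hA.dot hx hv, hB.dot hy hw, one_mul]⟩

theorem dualPair_tensSet (hA : DualPair A c d) (hB : DualPair B c' d') :
    DualPair (A ⊗ B) (tensSet A B c c') (cotensSet A B c c') where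
  mem_left_iff _ := Iff.rfl
  mem_right_iff φ := ⟨fun hφ => ⟨hφ.1, fun _ hv => hv.2 φ hφ⟩, fun hφ =>
    ⟨hφ.1, fun _ hv _ hw => hφ.2 _ (tens_mem_tensSet hA hB hv hw)⟩⟩
  unit_left := by
    obtain ⟨r, hr, hu⟩ := hA.unit_left
    obtain ⟨s, hs, hu'⟩ := hB.unit_left
    exact ⟨r * s, mul_pos hr hs, smul_unit_tensor (A := A) (B := B) r s ▸
      tens_mem_tensSet hA hB hu hu'⟩
  unit_right := by
    obtain ⟨r, hr, hu⟩ := hA.unit_right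
    obtain ⟨s, hs, hu'⟩ := hB.unit_right
    exact ⟨r * s, mul_pos hr hs, smul_star_unit_tensor (A := A) (B := B) r s ▸
      tens_mem_cotensSet hA hB hu hu'⟩

end Tens

end CPStar

namespace CPStar

/-! ### Associativity, units, and interchange -/

section Assoc

variable {A B C : CPStar}

/-- Reassociation of vectors. -/
def reassoc (v : Fin (A ⊗ (B ⊗ C)).dim → ℂ) : Fin ((A ⊗ B) ⊗ C).dim → ℂ :=
  fun i => v (Fin.cast (congrArg dim (tensor_assoc A B C)) i)

theorem reassoc_pr (v : Fin (A ⊗ (B ⊗ C)).dim → ℂ) (i : Fin A.dim) (j : Fin B.dim)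
    (k : Fin C.dim) : reassoc v (pr (pr i j) k) = v (pr i (pr j k)) :=
  congrArg v (cast_pair_assoc (Nat.mul_assoc _ _ _) i j k)

theorem reassoc_tens (u : Fin A.dim → ℂ) (v : Fin B.dim → ℂ) (w : Fin C.dim → ℂ) :
    reassoc (tens u (tens v w)) = tens (tens u v) w := by
  ext x
  obtain ⟨y, k, rfl⟩ := exists_pr x
  obtain ⟨i, j, rfl⟩ := exists_pr y
  rw [reassoc_pr]
  simp only [tens_pr, mul_assoc]

theorem reassoc_dot (φ v : Fin (A ⊗ (B ⊗ C)).dim → ℂ) : reassoc φ ⬝ᵥ reassoc v = φ ⬝ᵥ v := by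
  unfold dotProduct
  simp only [sum_pr, reassoc_pr]

theorem isPos_reassoc {v : Fin (A ⊗ (B ⊗ C)).dim → ℂ} :
    IsPos ((A ⊗ B) ⊗ C) (reassoc v) ↔ IsPos (A ⊗ (B ⊗ C)) v := isPos_congr (tensor_assoc A B C) v

theorem isEff_reassoc {v : Fin (A ⊗ (B ⊗ C)).dim → ℂ} :
    IsEff ((A ⊗ B) ⊗ C) (reassoc v) ↔ IsEff (A ⊗ (B ⊗ C)) v := isEff_congr (tensor_assoc A B C) v

theorem exists_reassoc (w : Fin ((A ⊗ B) ⊗ C).dim → ℂ) : ∃ v, reassoc (A := A) v = w :=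
  ⟨fun i => w (Fin.cast (congrArg dim (tensor_assoc A B C)).symm i), rfl⟩

variable {c₁ d₁ : Set (Fin A.dim → ℂ)} {c₂ d₂ : Set (Fin B.dim → ℂ)} {c₃ d₃ : Set (Fin C.dim → ℂ)}

/-- Fixing a state of the outer factor leaves an effect on the inner tensor product. If it is 1 on
products it is 1 on their closure, so the closure can be dropped. -/
theorem mem_cotensSet_right (h₁ : DualPair A c₁ d₁) (h₂ : DualPair B c₂ d₂)
    (h₃ : DualPair C c₃ d₃) (φ : Fin (A ⊗ (B ⊗ C)).dim → ℂ) :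
    φ ∈ cotensSet A (B ⊗ C) c₁ (tensSet B C c₂ c₃) ↔ IsEff (A ⊗ (B ⊗ C)) φ ∧
      ∀ u ∈ c₁, ∀ v ∈ c₂, ∀ w ∈ c₃, φ ⬝ᵥ tens u (tens v w) = 1 := by
  refine and_congr_right fun hφ => ⟨fun h u hu v hv w hw =>
    h u hu _ (tens_mem_tensSet h₂ h₃ hv hw), fun h u hu t ht => ?_⟩
  rw [dot_tens']
  refine ht.2 _ ⟨isEff_margRight hφ (h₁.isPos hu), fun v hv w hw => ?_⟩
  rw [← dot_tens']
  exact h u hu v hv w hw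

theorem mem_cotensSet_left (h₁ : DualPair A c₁ d₁) (h₂ : DualPair B c₂ d₂)
    (h₃ : DualPair C c₃ d₃) (φ : Fin ((A ⊗ B) ⊗ C).dim → ℂ) :
    φ ∈ cotensSet (A ⊗ B) C (tensSet A B c₁ c₂) c₃ ↔ IsEff ((A ⊗ B) ⊗ C) φ ∧
      ∀ u ∈ c₁, ∀ v ∈ c₂, ∀ w ∈ c₃, φ ⬝ᵥ tens (tens u v) w = 1 := by
  refine and_congr_right fun hφ => ⟨fun h u hu v hv w hw =>
    h _ (tens_mem_tensSet h₁ h₂ hu hv) w hw, fun h t ht w hw => ?_⟩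
  rw [dot_tens]
  refine ht.2 _ ⟨isEff_margLeft hφ (h₃.isPos hw), fun u hu v hv => ?_⟩
  rw [← dot_tens]
  exact h u hu v hv w hw

/-- Both dual sets consist of the effects that are 1 on triple products, a condition indifferent to
bracketing. -/
theorem reassoc_mem_tensSet (h₁ : DualPair A c₁ d₁) (h₂ : DualPair B c₂ d₂)
    (h₃ : DualPair C c₃ d₃) (v : Fin (A ⊗ (B ⊗ C)).dim → ℂ) :
    v ∈ tensSet A (B ⊗ C) c₁ (tensSet B C c₂ c₃) ↔
      reassoc v ∈ tensSet (A ⊗ B) C (tensSet A B c₁ c₂) c₃ := by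
  have key : ∀ φ : Fin (A ⊗ (B ⊗ C)).dim → ℂ, φ ∈ cotensSet A (B ⊗ C) c₁ (tensSet B C c₂ c₃) ↔
      reassoc φ ∈ cotensSet (A ⊗ B) C (tensSet A B c₁ c₂) c₃ := fun φ => by
    rw [mem_cotensSet_right h₁ h₂ h₃, mem_cotensSet_left h₁ h₂ h₃, isEff_reassoc]
    simp only [← reassoc_tens, reassoc_dot]
  refine and_congr isPos_reassoc.symm ⟨fun h φ hφ => ?_, fun h φ hφ => ?_⟩
  · obtain ⟨φ, rfl⟩ := exists_reassoc φ
    rw [reassoc_dot]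
    exact h φ ((key φ).2 hφ)
  · rw [← reassoc_dot]
    exact h _ ((key φ).1 hφ)

theorem reassoc_mem_seqSet (h₂ : DualPair B c₂ d₂)
    (h₃ : DualPair C c₃ d₃) (v : Fin (A ⊗ (B ⊗ C)).dim → ℂ) :
    v ∈ seqSet A (B ⊗ C) c₁ (coseqSet B C d₂ c₃) ↔
      reassoc v ∈ seqSet (A ⊗ B) C (seqSet A B c₁ d₂) d₃ := by
  have hm : ∀ (π : Fin C.dim → ℂ) (i : Fin A.dim) (j : Fin B.dim),
      margLeft (reassoc v) π (pr i j) = margLeft (fun x => v (pr i x)) π j := fun π i j => by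
    simp only [margLeft, reassoc_pr]
  have hm' : ∀ (φ : Fin (B ⊗ C).dim → ℂ) (i : Fin A.dim),
      margLeft v φ i = φ ⬝ᵥ fun x => v (pr i x) := fun φ i => rfl
  constructor
  · rintro ⟨hv, m, hm₁, h⟩
    obtain ⟨r, hr, hu⟩ := h₃.unit_right
    have hv' := isPos_reassoc.2 hv
    -- The marginal on `A ⊗ B` is taken at the normalised counit of `C`; its independence of the
    -- chosen effect is shown last.
    refine ⟨hv', margLeft (reassoc v) ((r : ℂ) • star C.unit),
      ⟨isPos_margLeft hv' (h₃.isEff hu), m, hm₁, fun π hπ => ?_⟩, fun π hπ => ?_⟩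
    · rw [← h _ (tens_mem_coseqSet h₂ h₃ hπ hu)]
      ext i
      rw [hm', dotProduct_comm, dot_tens, dotProduct_comm]
      refine Finset.sum_congr rfl fun j _ => congrArg _ ?_
      exact hm _ i j
    · ext x
      obtain ⟨i, j, rfl⟩ := exists_pr x
      rw [hm, hm]
      -- For fixed `i`, the row of `v` is a functional constant on the effects dual to `B < C`, so
      -- it does not distinguish effects of `C`.
      have e := eq_of_const_on_seqSet h₂.symm h₃.symm (dotLeft fun x => v (pr i x)) (k := m i)
        (fun φ hφ => by
          refine Eq.trans ?_ (congrFun (h φ (mem_coseqSet_iff.2 hφ)) i)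
          exact dotProduct_comm (fun x => v (pr i x)) φ) (Pi.single j 1) hπ hu
      have e' : ∀ π : Fin C.dim → ℂ, dotLeft (fun x => v (pr i x))
          (tens (A := B) (B := C) (Pi.single j 1) π) = margLeft (fun x => v (pr i x)) π j := by
        intro π
        rw [dotLeft_apply, dot_tens, dotProduct_single_one]
      exact (e' π).symm.trans (e.trans (e' _))
  · rintro ⟨hv, k, ⟨hk, m, hm₁, hkm⟩, h⟩
    refine ⟨isPos_reassoc.1 hv, m, hm₁, fun φ hφ => funext fun i => ?_⟩
    obtain ⟨-, m', hm₂, hφ⟩ := hφ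
    obtain ⟨s, hs, hu⟩ := h₃.unit_left
    -- The row of `v` and the product of the row of `k` with the uniform state have the same
    -- marginals, so `φ` agrees on them.
    have h0 : φ ⬝ᵥ ((fun x => v (pr i x)) -
        tens (fun j => k (pr i j)) ((s : ℂ) • C.unit)) = 0 := by
      refine dot_eq_zero_of_marginals h₃ hφ fun π hπ => ?_
      rw [margLeft_sub, margLeft_tens, h₃.dot hu hπ, one_smul, ← h π hπ]
      ext j
      exact sub_eq_zero.2 (hm π i j).symm
    rw [dotProduct_sub, dot_tens, hφ _ hu] at h0
    rw [hm', sub_eq_zero.1 h0, ← hkm m' hm₂]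
    rfl

end Assoc

/-! ### The unit object -/

section Unit

instance : Unique (Fin one.dim) := inferInstanceAs (Unique (Fin 1))

theorem isPos_one : IsPos one 1 := by
  have h := isPos_vec (𝟙 one)
  refine Eq.mp (congrArg (IsPos one) (funext fun (x : Fin 1) => ?_)) h
  exact (Matrix.one_apply).trans (if_pos (Subsingleton.elim (α := Fin 1) _ _))

theorem isEff_one : IsEff one 1 :=
  (isPos_congr conj_one 1).2 isPos_one

theorem one_dot (v : Fin one.dim → ℂ) : (1 : Fin one.dim → ℂ) ⬝ᵥ v = v default :=
  (Fintype.sum_unique _).trans (one_mul _)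

theorem dualPair_one : DualPair one {1} {1} := by
  have h1 : ∀ v : Fin one.dim → ℂ, v = 1 ↔ (1 : Fin one.dim → ℂ) ⬝ᵥ v = 1 := fun v => by
    rw [one_dot]
    exact ⟨fun h => congrFun h _, fun h => funext fun x => by rwa [Unique.eq_default x]⟩
  refine ⟨fun v => ?_, fun v => ?_, ⟨1, one_pos, ?_⟩, 1, one_pos, ?_⟩
  · simp only [Set.mem_singleton_iff, forall_eq]
    exact ⟨fun h => ⟨h ▸ isPos_one, (h1 v).1 h⟩, fun h => (h1 v).2 h.2⟩
  · simp only [Set.mem_singleton_iff, forall_eq]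
    rw [dotProduct_comm]
    exact ⟨fun h => ⟨h ▸ isEff_one, (h1 v).1 h⟩, fun h => (h1 v).2 h.2⟩
  · rw [Complex.ofReal_one, one_smul]
    rfl
  · rw [Complex.ofReal_one, one_smul]
    exact funext fun _ => star_one _

variable {A : CPStar} {c d : Set (Fin A.dim → ℂ)}

/-- The cast is `v ↦ 1 ⊗ v`. Testing with the effects `1 ⊗ w` recovers all tests in `d`, so for
closed sets the two hypotheses on products suffice; this serves both tensor products. -/
theorem mem_iff_cast_left (hA : DualPair A c d) {S T : Set (Fin (one ⊗ A).dim → ℂ)}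
    (hS : DualPair (one ⊗ A) S T) (h₁ : ∀ v ∈ c, tens (A := one) 1 v ∈ S)
    (h₂ : ∀ w ∈ d, tens (A := one) 1 w ∈ T) (v : Fin A.dim → ℂ) :
    v ∈ c ↔ (fun i => v (Fin.cast (congrArg dim (one_tensor A)) i)) ∈ S := by
  have e : (fun i => v (Fin.cast (congrArg dim (one_tensor A)) i)) = tens (A := one) 1 v := by
    ext x
    obtain ⟨y, i, rfl⟩ := exists_pr x
    rw [tens_pr, Pi.one_apply, one_mul]
    exact congrArg v (cast_pair_one_left _ y i)
  refine ⟨fun hv => e ▸ h₁ v hv, fun hv => (hA.mem_left_iff v).2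
    ⟨(isPos_congr (one_tensor A) v).1 (hS.isPos hv), fun w hw => ?_⟩⟩
  have h := hS.dot hv (h₂ w hw)
  rw [e, tens_dot_tens, one_dot] at h
  exact (one_mul _).symm.trans h

theorem mem_iff_cast_right (hA : DualPair A c d) {S T : Set (Fin (A ⊗ one).dim → ℂ)}
    (hS : DualPair (A ⊗ one) S T) (h₁ : ∀ v ∈ c, tens (B := one) v 1 ∈ S)
    (h₂ : ∀ w ∈ d, tens (B := one) w 1 ∈ T) (v : Fin A.dim → ℂ) :
    v ∈ c ↔ (fun i => v (Fin.cast (congrArg dim (tensor_one A)) i)) ∈ S := by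
  have e : (fun i => v (Fin.cast (congrArg dim (tensor_one A)) i)) = tens (B := one) v 1 := by
    ext x
    obtain ⟨i, y, rfl⟩ := exists_pr x
    rw [tens_pr, Pi.one_apply, mul_one]
    exact congrArg v (cast_pair_one_right _ i y)
  refine ⟨fun hv => e ▸ h₁ v hv, fun hv => (hA.mem_left_iff v).2
    ⟨(isPos_congr (tensor_one A) v).1 (hS.isPos hv), fun w hw => ?_⟩⟩
  have h := hS.dot hv (h₂ w hw)
  rw [e, tens_dot_tens, one_dot] at h
  exact (mul_one _).symm.trans h

end Unit

/-- For fixed `i`, `j` the rows of `a` and `b` are constant on states, with values `a' i` and `b'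
j`. Hence their product sees the row of `h` only through `m (i, j)`, and the total is `(a' ⊗ b') ⬝ᵥ
m = 1`. -/
theorem tens_dot_interchange {A B E F : CPStar} {d₁ : Set (Fin A.dim → ℂ)}
    {d₂ : Set (Fin B.dim → ℂ)} {c₃ d₃ : Set (Fin E.dim → ℂ)} {c₄ d₄ : Set (Fin F.dim → ℂ)}
    (h₃ : DualPair E c₃ d₃) (h₄ : DualPair F c₄ d₄)
    {h : Fin ((A ⊗ B) ⊗ (E ⊗ F)).dim → ℂ} {h' : Fin ((A ⊗ E) ⊗ (B ⊗ F)).dim → ℂ}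
    (hh : ∀ i j k l, h' (pr (pr i k) (pr j l)) = h (pr (pr i j) (pr k l)))
    {m : Fin (A ⊗ B).dim → ℂ} (hm : ∀ π ∈ d₁, ∀ π' ∈ d₂, tens π π' ⬝ᵥ m = 1)
    (hhm : ∀ π ∈ d₃, ∀ π' ∈ d₄, margLeft h (tens π π') = m)
    {a : Fin (A ⊗ E).dim → ℂ} (ha : a ∈ coseqSet A E d₁ c₃)
    {b : Fin (B ⊗ F).dim → ℂ} (hb : b ∈ coseqSet B F d₂ c₄) : tens a b ⬝ᵥ h' = 1 := by
  obtain ⟨-, a', ha', ha⟩ := ha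
  obtain ⟨-, b', hb', hb⟩ := hb
  obtain ⟨r, -, hu⟩ := h₃.unit_left
  obtain ⟨s, -, hu'⟩ := h₄.unit_left
  have hsum : tens a b ⬝ᵥ h' = ∑ i, ∑ j, tens (fun k => a (pr i k)) (fun l => b (pr j l)) ⬝ᵥ
      fun x => h (pr (pr i j) x) := by
    unfold dotProduct
    simp only [sum_pr, tens_pr, hh]
    exact Finset.sum_congr rfl fun _ _ => Finset.sum_comm
  rw [hsum, ← hm a' ha' b' hb']
  unfold dotProduct
  rw [sum_pr]
  refine Finset.sum_congr rfl fun i _ => Finset.sum_congr rfl fun j _ => ?_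
  have hai : ∀ v ∈ c₃, (fun k => a (pr i k)) ⬝ᵥ v = a' i := fun v hv => by
    rw [dotProduct_comm]
    exact congrFun (ha v hv) i
  have hbj : ∀ v ∈ c₄, (fun l => b (pr j l)) ⬝ᵥ v = b' j := fun v hv => by
    rw [dotProduct_comm]
    exact congrFun (hb v hv) j
  -- The row of `h` is compared with the multiple of the uniform state on which product effects take
  -- the same value.
  have h0 : tens (fun k => a (pr i k)) (fun l => b (pr j l)) ⬝ᵥ ((fun x => h (pr (pr i j) x)) -
      m (pr i j) • tens ((r : ℂ) • E.unit) ((s : ℂ) • F.unit)) = 0 := by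
    refine tens_dot_eq_zero h₃ h₄ hai hbj fun π hπ π' hπ' => ?_
    rw [dotProduct_sub, dotProduct_smul, tens_dot_tens, h₃.dot hu hπ, h₄.dot hu' hπ', mul_one,
      smul_eq_mul, mul_one, sub_eq_zero]
    exact congrFun (hhm π hπ π' hπ') (pr i j)
  rw [dotProduct_sub, dotProduct_smul, tens_dot_tens, hai _ hu, hbj _ hu', smul_eq_mul,
    sub_eq_zero] at h0
  rw [tens_pr, mul_comm (a' i * b' j)]
  exact h0

end CPStar

/-! ## States and effects in coordinates -/

namespace PreCaus

open CPStar

/-- The coordinate vectors of the chosen states. -/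
def vecs (X : PreCaus) : Set (Fin X.carrier.dim → ℂ) := {v | ∃ ρ ∈ X.states, vec ρ = v}

/-- The coordinate vectors of the dual effects. -/
def covecs (X : PreCaus) : Set (Fin X.carrier.dim → ℂ) :=
  {w | ∃ π ∈ dualEffects X.states, covec π = w}

theorem vec_mem_vecs {X : PreCaus} {ρ : one ⟶ X.carrier} : vec ρ ∈ X.vecs ↔ ρ ∈ X.states :=
  ⟨fun ⟨_, hσ, h⟩ => vec_injective h ▸ hσ, fun h => ⟨ρ, h, rfl⟩⟩

theorem mem_dualEffects_iff {A : CPStar} {c : Set (one ⟶ A)} {π : A ⟶ one} :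
    π ∈ dualEffects c ↔ ∀ v ∈ vecs ⟨A, c⟩, covec π ⬝ᵥ v = 1 := by
  constructor
  · rintro h _ ⟨ρ, hρ, rfl⟩
    exact (comp_effect_eq ρ π).1 (h ρ hρ)
  · exact fun h ρ hρ => (comp_effect_eq ρ π).2 (h _ ⟨ρ, hρ, rfl⟩)

theorem mem_covecs_iff {X : PreCaus} {w : Fin X.carrier.dim → ℂ} :
    w ∈ X.covecs ↔ IsEff X.carrier w ∧ ∀ v ∈ X.vecs, w ⬝ᵥ v = 1 := by
  constructor
  · rintro ⟨π, hπ, rfl⟩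
    exact ⟨isEff_iff.2 ⟨π, rfl⟩, mem_dualEffects_iff.1 hπ⟩
  · rintro ⟨hw, h⟩
    obtain ⟨π, rfl⟩ := isEff_iff.1 hw
    exact ⟨π, mem_dualEffects_iff.2 h, rfl⟩

theorem mem_vecs_closure_iff {A : CPStar} {c : Set (one ⟶ A)} {v : Fin A.dim → ℂ} :
    v ∈ vecs ⟨A, closure c⟩ ↔ IsPos A v ∧ ∀ w ∈ covecs ⟨A, c⟩, w ⬝ᵥ v = 1 := by
  constructor
  · rintro ⟨ρ, hρ, rfl⟩
    refine ⟨isPos_vec ρ, ?_⟩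
    rintro _ ⟨π, hπ, rfl⟩
    exact (comp_effect_eq ρ π).1 (hρ π hπ)
  · rintro ⟨hv, h⟩
    exact ⟨toState v hv, fun π hπ => (comp_effect_eq _ π).2 (h _ ⟨π, hπ, rfl⟩), rfl⟩

theorem ext_vecs {X Y : PreCaus} (h : X.carrier = Y.carrier)
    (hv : ∀ v : Fin Y.carrier.dim → ℂ,
      v ∈ Y.vecs ↔ (fun i => v (Fin.cast (congrArg dim h) i)) ∈ X.vecs) : X = Y := by
  obtain ⟨A, c⟩ := X
  obtain ⟨B, c'⟩ := Y
  obtain rfl : A = B := h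
  congr
  ext ρ
  exact vec_mem_vecs.symm.trans ((hv (vec ρ)).symm.trans vec_mem_vecs)

theorem isClosed_and_isFlat_iff {X : PreCaus} :
    X.IsClosed ∧ X.IsFlat ↔ DualPair X.carrier X.vecs X.covecs := by
  constructor
  · rintro ⟨hc, ⟨r, hr, ρ, hρ, hρ'⟩, s, hs, π, hπ, hπ'⟩
    refine ⟨fun v => ?_, fun w => mem_covecs_iff, ⟨r, hr, ρ, hρ, funext hρ'⟩,
      s, hs, π, hπ, funext hπ'⟩
    rw [← mem_vecs_closure_iff]
    unfold IsClosed at hc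
    rw [hc]
  · intro h
    refine ⟨Set.ext fun ρ => ?_, ?_, ?_⟩
    · have h1 := (mem_vecs_closure_iff (c := X.states)).trans (h.mem_left_iff (vec ρ)).symm
      exact (vec_mem_vecs (X := ⟨X.carrier, closure X.states⟩)).symm.trans (h1.trans vec_mem_vecs)
    · obtain ⟨r, hr, ρ, hρ, e⟩ := h.unit_left
      exact ⟨r, hr, ρ, hρ, congrFun e⟩
    · obtain ⟨r, hr, π, hπ, e⟩ := h.unit_right
      exact ⟨r, hr, π, hπ, congrFun e⟩

/-- A dual pair determines its right member: exhibiting some `d` proves closedness and flatness and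
also computes the dual effects. -/
theorem covecs_eq {X : PreCaus} {d : Set (Fin X.carrier.dim → ℂ)}
    (h : DualPair X.carrier X.vecs d) : X.covecs = d :=
  Set.ext fun w => mem_covecs_iff.trans (h.mem_right_iff w).symm

theorem isClosed_and_isFlat_of_dualPair {X : PreCaus} {d : Set (Fin X.carrier.dim → ℂ)}
    (h : DualPair X.carrier X.vecs d) : X.IsClosed ∧ X.IsFlat :=
  isClosed_and_isFlat_iff.2 (by rwa [covecs_eq h])

theorem vecs_unit : unit.vecs = {1} := by
  have h : vec (𝟙 one) = 1 := funext fun (x : Fin 1) =>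
    (Matrix.one_apply).trans (if_pos (Subsingleton.elim (α := Fin 1) _ _))
  ext v
  constructor
  · rintro ⟨ρ, rfl, rfl⟩
    exact h
  · rintro rfl
    exact ⟨𝟙 one, rfl, h⟩

theorem vecs_dual (X : PreCaus) : X.dual.vecs = X.covecs := by
  ext w
  constructor
  · rintro ⟨σ, ⟨π, hπ, h⟩, rfl⟩
    exact ⟨π, hπ, (funext h).symm⟩
  · rintro ⟨π, hπ, rfl⟩
    have hp : IsEff X.carrier (covec π) := isEff_iff.2 ⟨π, rfl⟩
    exact ⟨toState (A := X.carrier.conj) (covec (A := X.carrier) π) hp, ⟨π, hπ, fun _ => rfl⟩, rfl⟩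

theorem vecs_tensor (X Y : PreCaus) :
    (X.tensor Y).vecs = tensSet X.carrier Y.carrier X.vecs Y.vecs := by
  ext v
  refine mem_vecs_closure_iff.trans (and_congr Iff.rfl (forall_congr' fun w =>
    imp_congr (mem_covecs_iff.trans (and_congr Iff.rfl ?_)) Iff.rfl))
  constructor
  · rintro h _ ⟨ρ, hρ, rfl⟩ _ ⟨σ, hσ, rfl⟩
    refine h _ ⟨toState _ ((isPos_vec ρ).tens (isPos_vec σ)), ⟨ρ, hρ, σ, hσ, fun i j => ?_⟩, rfl⟩
    exact tens_pr _ _ i j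
  · rintro h _ ⟨τ, ⟨ρ, hρ, σ, hσ, e⟩, rfl⟩
    refine Eq.trans (congrArg _ (funext fun x => ?_))
      (h _ ⟨ρ, hρ, rfl⟩ _ ⟨σ, hσ, rfl⟩)
    obtain ⟨i, j, rfl⟩ := exists_pr (A := X.carrier) (B := Y.carrier) x
    exact (e i j).trans (tens_pr _ _ i j).symm

theorem vecs_seq (X Y : PreCaus) :
    (X.seq Y).vecs = seqSet X.carrier Y.carrier X.vecs Y.covecs := by
  ext v
  constructor
  · rintro ⟨ρ, ⟨m, hm, h⟩, rfl⟩
    refine ⟨isPos_vec ρ, vec m, ⟨m, hm, rfl⟩, ?_⟩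
    rintro _ ⟨π, hπ, rfl⟩
    exact funext (h π hπ)
  · rintro ⟨hv, _, ⟨m, hm, rfl⟩, h⟩
    exact ⟨toState v hv, ⟨m, hm, fun π hπ => congrFun (h _ ⟨π, hπ, rfl⟩)⟩, rfl⟩

end PreCaus

/-! ### Transport along equalities of objects, and the interchange map -/

namespace CPStar

theorem comp_eqToHom_mat {A B C : CPStar} (f : A ⟶ B) (h : B = C) (o : Fin C.dim)
    (i : Fin A.dim) : (f ≫ eqToHom h).mat o i = f.mat (Fin.cast (congrArg dim h).symm o) i := by
  subst h
  rw [eqToHom_refl, Category.comp_id]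
  rfl

theorem eqToHom_comp_mat {A B C : CPStar} (h : A = B) (f : B ⟶ C) (o : Fin C.dim)
    (i : Fin A.dim) : (eqToHom h ≫ f).mat o i = f.mat o (Fin.cast (congrArg dim h) i) := by
  subst h
  rw [eqToHom_refl, Category.id_comp]
  rfl

theorem eqToHom_comp_comp_eqToHom_heq {A A' B B' : CPStar} (h : A = A') (h' : B' = B)
    (f : A' ⟶ B') : eqToHom h ≫ f ≫ eqToHom h' ≍ f := by
  subst h h'
  rw [eqToHom_refl, eqToHom_refl, Category.comp_id, Category.id_comp]

theorem eqToHom_heq_id {A B : CPStar} (h : A = B) : eqToHom h ≍ 𝟙 A := by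
  subst h
  rfl

theorem eqToHom_tensorHom_eqToHom {A A' B B' : CPStar} (h : A = A') (h' : B = B') :
    (eqToHom h ⊗ₘ eqToHom h') = eqToHom (congrArg₂ (· ⊗ ·) h h') := by
  subst h h'
  exact id_tensorHom_id _ _

theorem deMorgan_natural {A A' B B' : CPStar} (f : A ⟶ A') (g : B ⟶ B') :
    (StarAutonomous.dualMap f ⊗ₘ StarAutonomous.dualMap g) ≫ eqToHom (conj_tensor A B).symm =
      eqToHom (conj_tensor A' B').symm ≫ StarAutonomous.dualMap (f ⊗ₘ g) := by
  refine Hom.ext_mat (Matrix.ext fun o x => ?_)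
  rw [comp_eqToHom_mat]
  refine Eq.trans ?_ (eqToHom_comp_mat (conj_tensor A' B').symm
    (StarAutonomous.dualMap (f ⊗ₘ g)) o x).symm
  obtain ⟨i, j, rfl⟩ : ∃ (i : Fin A.dim) (j : Fin B.dim), o = pr (A := A) (B := B) i j :=
    exists_pr o
  obtain ⟨k, l, rfl⟩ : ∃ (k : Fin A'.dim) (l : Fin B'.dim),
      x = pr (A := A'.conj) (B := B'.conj) k l :=
    exists_pr x
  refine Eq.trans ?_ (dualMap_mat (f ⊗ₘ g) (pr i j) (pr k l)).symm
  refine (tensorHom_mat (StarAutonomous.dualMap f) (StarAutonomous.dualMap g) i j k l).trans ?_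
  rw [tensorHom_mat]
  exact congrArg₂ (· * ·) (dualMap_mat f i k) (dualMap_mat g j l)

theorem par_eq (A B : CPStar) : StarAutonomous.par A B = A ⊗ B := by
  change (A.conj ⊗ B.conj).conj = A ⊗ B
  rw [conj_tensor, conj_conj, conj_conj]

/-- Up to `eqToHom`, `⅋` is `⊗` in `CPStar`; naturality of the interchange thereby reduces to that
of `tensorμ`. -/
theorem parMap_eq {A A' B B' : CPStar} (f : A ⟶ A') (g : B ⟶ B') :
    StarAutonomous.parMap f g = eqToHom (par_eq A B) ≫ (f ⊗ₘ g) ≫ eqToHom (par_eq A' B').symm := by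
  refine Hom.ext_mat (Matrix.ext fun o x => ?_)
  rw [eqToHom_comp_mat, comp_eqToHom_mat]
  exact congrFun (congrFun (parMap_mat f g) o) x

/-- The interchange `(A ⅋ B) ⊗ (E ⅋ F) ⟶ (A ⊗ E) ⅋ (B ⊗ F)`. -/
def interchange (A B E F : CPStar) : StarAutonomous.par A B ⊗ StarAutonomous.par E F ⟶
    StarAutonomous.par (A ⊗ E) (B ⊗ F) :=
  eqToHom (congrArg₂ (· ⊗ ·) (par_eq A B) (par_eq E F)) ≫ tensorμ A B E F ≫
    eqToHom (par_eq (A ⊗ E) (B ⊗ F)).symm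

theorem interchange_natural {A A' B B' E E' F F' : CPStar} (a : A ⟶ A') (b : B ⟶ B') (e : E ⟶ E')
    (f : F ⟶ F') :
    (StarAutonomous.parMap a b ⊗ₘ StarAutonomous.parMap e f) ≫ interchange A' B' E' F' =
      interchange A B E F ≫ StarAutonomous.parMap (a ⊗ₘ e) (b ⊗ₘ f) := by
  simp only [parMap_eq, interchange, ← tensorHom_comp_tensorHom, eqToHom_tensorHom_eqToHom,
    Category.assoc, eqToHom_trans_assoc, eqToHom_refl, Category.id_comp, tensorμ_natural_assoc]

theorem comp_tensorμ_mat {A B E F X : CPStar} (g : X ⟶ (A ⊗ B) ⊗ (E ⊗ F)) (i : Fin A.dim)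
    (j : Fin B.dim) (k : Fin E.dim) (l : Fin F.dim) (x : Fin X.dim) :
    (g ≫ tensorμ A B E F).mat (pr (pr i k) (pr j l)) x = g.mat (pr (pr i j) (pr k l)) x := by
  rw [comp_mat_apply]
  simp only [sum_pr, maps_tensorμ A B E F _ _ _ _ _, pr_inj, ite_and, ite_mul, one_mul, zero_mul]
  simp

theorem comp_tensorHom_mat {A A' B B' X : CPStar} (ρ : X ⟶ A ⊗ B) (f : A ⟶ A') (g : B ⟶ B')
    (i : Fin A'.dim) (j : Fin B'.dim) (x : Fin X.dim) :
    (ρ ≫ (f ⊗ₘ g)).mat (pr i j) x =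
      ∑ k, f.mat i k * ∑ l, g.mat j l * ρ.mat (pr k l) x := by
  rw [comp_mat_apply, sum_pr]
  simp only [tensorHom_mat, Finset.mul_sum, mul_assoc]

end CPStar

/-! ## The structure of `Caus[CP*[FHilb_sk]]` -/

namespace PreCaus

open CPStar

/-- An element of a closure passes every test passed by the generators, so it suffices to pull a
test effect back along `f ⊗ g` and evaluate it on product states. -/
theorem comp_tensorMap_mem_tensor {X X' Y Y' : PreCaus} (f : X.carrier ⟶ X'.carrier)
    (hf : ∀ ρ ∈ X.states, ρ ≫ f ∈ X'.states) (g : Y.carrier ⟶ Y'.carrier)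
    (hg : ∀ ρ ∈ Y.states, ρ ≫ g ∈ Y'.states) :
    ∀ ρ ∈ (X.tensor Y).states, ρ ≫ tensorMap f g ∈ (X'.tensor Y').states := by
  intro ρ hρ π hπ
  refine (Category.assoc ρ _ π).trans ?_
  refine hρ _ fun τ hτ => ?_
  obtain ⟨ρ', hρ', σ, hσ, e⟩ := hτ
  refine (Category.assoc τ _ π).symm.trans ?_
  refine hπ _ ⟨_, hf _ hρ', _, hg _ hσ, fun i j => ?_⟩
  refine (comp_tensorHom_mat τ f g i j (0 : Fin 1)).trans ?_
  refine Eq.trans ?_ (Finset.sum_mul_sum _ _ _ _).symm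
  refine Finset.sum_congr rfl fun k _ => ?_
  rw [Finset.mul_sum]
  refine Finset.sum_congr rfl fun l _ => ?_
  have h : τ.mat (pr k l) (0 : Fin 1) = vec ρ' k * vec σ l := e k l
  rw [h]
  change _ = f.mat i k * vec ρ' k * (g.mat j l * vec σ l)
  ring

theorem comp_tensorMap_mem_seq {X X' Y Y' : PreCaus} (f : X.carrier ⟶ X'.carrier)
    (hf : ∀ ρ ∈ X.states, ρ ≫ f ∈ X'.states) (g : Y.carrier ⟶ Y'.carrier)
    (hg : ∀ ρ ∈ Y.states, ρ ≫ g ∈ Y'.states) :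
    ∀ ρ ∈ (X.seq Y).states, ρ ≫ tensorMap f g ∈ (X'.seq Y').states := by
  rintro ρ ⟨m, hm, h⟩
  refine ⟨m ≫ f, hf m hm, fun π hπ i => ?_⟩
  -- Effects in the dual set pull back along `g`, so the old marginal condition applies and the new
  -- marginal is `m ≫ f`.
  have hπ' : g ≫ π ∈ dualEffects Y.states := fun σ hσ => by
    rw [← Category.assoc]
    exact hπ _ (hg σ hσ)
  have e : ∀ j, vec (ρ ≫ tensorMap f g) (finProdFinEquiv (i, j)) =
      ∑ k, f.mat i k * ∑ l, g.mat j l * vec ρ (pr k l) := fun j =>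
    comp_tensorHom_mat ρ f g i j (0 : Fin 1)
  have e' : vec (m ≫ f) i = ∑ k, f.mat i k * vec m k := rfl
  have e'' : ∀ l, covec (g ≫ π) l = ∑ j, covec π j * g.mat j l := fun l => rfl
  rw [e']
  simp only [e, ← h _ hπ', e'', Finset.mul_sum, Finset.sum_mul]
  rw [Finset.sum_comm]
  refine Finset.sum_congr rfl fun k _ => ?_
  rw [Finset.sum_comm]
  refine Finset.sum_congr rfl fun l _ => Finset.sum_congr rfl fun j _ => ?_
  change _ = f.mat i k * (covec π j * g.mat j l * vec ρ (pr k l))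
  ring

theorem comp_swapMap_mem_tensor (X Y : PreCaus) :
    ∀ ρ ∈ (X.tensor Y).states, ρ ≫ swapMap X.carrier Y.carrier ∈ (Y.tensor X).states := by
  intro ρ hρ π hπ
  refine (Category.assoc ρ _ π).trans ?_
  refine hρ _ fun τ hτ => ?_
  obtain ⟨ρ', hρ', σ, hσ, e⟩ := hτ
  refine (Category.assoc τ _ π).symm.trans ?_
  refine hπ _ ⟨_, hσ, _, hρ', fun j i => ?_⟩
  exact (comp_swapMap_mat τ i j (0 : Fin 1)).trans ((e i j).trans (mul_comm _ _))

theorem comp_eqToHom_mem {X Y : PreCaus} (h : X = Y) :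
    ∀ ρ ∈ X.states, ρ ≫ eqToHom (congrArg carrier h) ∈ Y.states := by
  subst h
  intro ρ hρ
  rwa [eqToHom_refl, Category.comp_id]

end PreCaus

namespace Caus

open CPStar PreCaus

theorem dualPair (X : Caus) : DualPair X.1.carrier X.1.vecs X.1.covecs :=
  isClosed_and_isFlat_iff.1 X.2

theorem dualPair_tensor (X Y : Caus) : DualPair (X.1.carrier ⊗ Y.1.carrier) (X.1.tensor Y.1).vecs
    (cotensSet X.1.carrier Y.1.carrier X.1.vecs Y.1.vecs) :=
  Eq.mpr (congrArg (fun s => DualPair (X.1.carrier ⊗ Y.1.carrier) s _) (vecs_tensor X.1 Y.1))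
    (dualPair_tensSet X.dualPair Y.dualPair)

theorem dualPair_seq (X Y : Caus) : DualPair (X.1.carrier ⊗ Y.1.carrier) (X.1.seq Y.1).vecs
    (coseqSet X.1.carrier Y.1.carrier X.1.covecs Y.1.vecs) :=
  Eq.mpr (congrArg (fun s => DualPair (X.1.carrier ⊗ Y.1.carrier) s _) (vecs_seq X.1 Y.1))
    (dualPair_seqSet X.dualPair Y.dualPair)

theorem dualPair_dual (X : Caus) : DualPair X.1.carrier.conj X.1.dual.vecs X.1.vecs :=
  Eq.mpr (congrArg (fun s => DualPair X.1.carrier.conj s _) (vecs_dual X.1)) X.dualPair.symm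

theorem covecs_tensor (X Y : Caus) : (X.1.tensor Y.1).covecs =
    cotensSet X.1.carrier Y.1.carrier X.1.vecs Y.1.vecs := covecs_eq (dualPair_tensor X Y)

theorem covecs_seq (X Y : Caus) : (X.1.seq Y.1).covecs =
    coseqSet X.1.carrier Y.1.carrier X.1.covecs Y.1.vecs := covecs_eq (dualPair_seq X Y)

theorem covecs_dual (X : Caus) : X.1.dual.covecs = X.1.vecs := covecs_eq (dualPair_dual X)

theorem dualPair_unit : DualPair one PreCaus.unit.vecs {1} :=
  Eq.mpr (congrArg (fun s => DualPair one s _) vecs_unit) dualPair_one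

theorem covecs_unit : PreCaus.unit.covecs = {1} := covecs_eq dualPair_unit

/-- The object `I`. -/
def unit : Caus := ⟨PreCaus.unit, isClosed_and_isFlat_of_dualPair dualPair_unit⟩

/-- The dual object. -/
def dual (X : Caus) : Caus := ⟨X.1.dual, isClosed_and_isFlat_of_dualPair (dualPair_dual X)⟩

theorem hom_ext {X Y : Caus} {f g : X ⟶ Y} (h : f.map = g.map) : f = g := Hom.ext h

/-- The isomorphism given by an equality of objects. -/
def isoOfEq {X Y : Caus} (h : X.1 = Y.1) : X ≅ Y where
  hom := ⟨eqToHom (congrArg carrier h), comp_eqToHom_mem h⟩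
  inv := ⟨eqToHom (congrArg carrier h.symm), comp_eqToHom_mem h.symm⟩
  hom_inv_id := hom_ext (eqToHom_trans (congrArg carrier h) (congrArg carrier h.symm))
  inv_hom_id := hom_ext (eqToHom_trans (congrArg carrier h.symm) (congrArg carrier h))

/-- A choice of states on tensor products that is a monoidal structure lying strictly over the one
of `CP*[FHilb_sk]`. -/
structure TensorStates where
  states : ∀ X Y : Caus, Set (one ⟶ X.1.carrier.tensor Y.1.carrier)
  isClosed_and_isFlat : ∀ X Y, (⟨_, states X Y⟩ : PreCaus).IsClosed ∧
    (⟨_, states X Y⟩ : PreCaus).IsFlat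
  comp_tensorMap_mem : ∀ {X X' Y Y' : Caus} (f : X ⟶ X') (g : Y ⟶ Y'), ∀ ρ ∈ states X Y,
    ρ ≫ tensorMap f.map g.map ∈ states X' Y'
  assoc : ∀ X Y Z : Caus,
    (⟨_, states ⟨⟨_, states X Y⟩, isClosed_and_isFlat X Y⟩ Z⟩ : PreCaus) =
      ⟨_, states X ⟨⟨_, states Y Z⟩, isClosed_and_isFlat Y Z⟩⟩
  unit_left : ∀ X : Caus, (⟨_, states unit X⟩ : PreCaus) = X.1
  unit_right : ∀ X : Caus, (⟨_, states X unit⟩ : PreCaus) = X.1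

namespace TensorStates

variable (T : TensorStates)

/-- The tensor product of objects. -/
def obj (X Y : Caus) : Caus := ⟨⟨_, T.states X Y⟩, T.isClosed_and_isFlat X Y⟩

/-- The tensor product of morphisms. -/
def hom {X X' Y Y' : Caus} (f : X ⟶ X') (g : Y ⟶ Y') : T.obj X Y ⟶ T.obj X' Y' :=
  ⟨tensorMap f.map g.map, T.comp_tensorMap_mem f g⟩

/-- The monoidal structure with the given states on tensor products. -/
@[reducible]
def monoidalCategory : MonoidalCategory Caus where
  tensorObj := T.obj
  tensorUnit := unit
  tensorHom := T.hom
  whiskerLeft X _ _ f := T.hom (𝟙 X) f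
  whiskerRight f Y := T.hom f (𝟙 Y)
  associator X Y Z := isoOfEq (T.assoc X Y Z)
  leftUnitor X := isoOfEq (T.unit_left X)
  rightUnitor X := isoOfEq (T.unit_right X)
  -- Each structural map lies over the corresponding one of `CPStar`, so every axiom is the one
  -- downstairs, independently of the chosen states.
  tensorHom_def f g := hom_ext (MonoidalCategory.tensorHom_def f.map g.map)
  id_tensorHom_id X Y := hom_ext (id_tensorHom_id X.1.carrier Y.1.carrier)
  tensorHom_comp_tensorHom f g f' g' :=
    hom_ext (tensorHom_comp_tensorHom f.map g.map f'.map g'.map)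
  whiskerLeft_id X Y := hom_ext (MonoidalCategory.whiskerLeft_id X.1.carrier Y.1.carrier)
  id_whiskerRight X Y := hom_ext (id_whiskerRight X.1.carrier Y.1.carrier)
  associator_naturality f g h := hom_ext (associator_naturality f.map g.map h.map)
  leftUnitor_naturality f := hom_ext (leftUnitor_naturality f.map)
  rightUnitor_naturality f := hom_ext (rightUnitor_naturality f.map)
  pentagon X Y Z W := hom_ext (pentagon X.1.carrier Y.1.carrier Z.1.carrier W.1.carrier)
  triangle X Y := hom_ext (triangle X.1.carrier Y.1.carrier)

theorem isStrictMonoidal_forget : IsStrictMonoidal T.monoidalCategory inferInstance forget where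
  obj_unit := rfl
  obj_tensor _ _ := rfl
  map_tensor _ _ := HEq.rfl
  map_associator _ _ _ := HEq.rfl
  map_leftUnitor _ := HEq.rfl
  map_rightUnitor _ := HEq.rfl

end TensorStates

/-- The tensor product of `Caus[CP*[FHilb_sk]]`. -/
def tensorStates : TensorStates where
  states X Y := (X.1.tensor Y.1).states
  isClosed_and_isFlat X Y := isClosed_and_isFlat_of_dualPair (dualPair_tensor X Y)
  comp_tensorMap_mem f g := comp_tensorMap_mem_tensor f.map f.preserves g.map g.preserves
  assoc X Y Z := by
    refine ext_vecs (tensor_assoc X.1.carrier Y.1.carrier Z.1.carrier) fun v => ?_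
    have h := reassoc_mem_tensSet X.dualPair Y.dualPair Z.dualPair v
    rw [← vecs_tensor, ← vecs_tensor] at h
    refine Iff.trans (Eq.to_iff (congrArg (v ∈ ·) (vecs_tensor X.1 (Y.1.tensor Z.1))))
      (h.trans (Eq.to_iff (congrArg (reassoc v ∈ ·) (vecs_tensor (X.1.tensor Y.1) Z.1))).symm)
  unit_left X := by
    refine ext_vecs (one_tensor X.1.carrier) fun v => ?_
    refine mem_iff_cast_left X.dualPair (dualPair_tensor unit X) (fun w hw => ?_)
      (fun w hw => ?_) v
    · exact Eq.mpr (congrArg (tens (A := one) 1 w ∈ ·) (vecs_tensor PreCaus.unit X.1))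
        (tens_mem_tensSet unit.dualPair X.dualPair (vecs_unit ▸ rfl) hw)
    · exact tens_mem_cotensSet unit.dualPair X.dualPair (covecs_unit ▸ rfl) hw
  unit_right X := by
    refine ext_vecs (tensor_one X.1.carrier) fun v => ?_
    refine mem_iff_cast_right X.dualPair (dualPair_tensor X unit) (fun w hw => ?_)
      (fun w hw => ?_) v
    · exact Eq.mpr (congrArg (tens (B := one) w 1 ∈ ·) (vecs_tensor X.1 PreCaus.unit))
        (tens_mem_tensSet X.dualPair unit.dualPair hw (vecs_unit ▸ rfl))
    · exact tens_mem_cotensSet X.dualPair unit.dualPair hw (covecs_unit ▸ rfl)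

/-- The one-way signalling product of `Caus[CP*[FHilb_sk]]`. -/
def seqStates : TensorStates where
  states X Y := (X.1.seq Y.1).states
  isClosed_and_isFlat X Y := isClosed_and_isFlat_of_dualPair (dualPair_seq X Y)
  comp_tensorMap_mem f g := comp_tensorMap_mem_seq f.map f.preserves g.map g.preserves
  assoc X Y Z := by
    refine ext_vecs (tensor_assoc X.1.carrier Y.1.carrier Z.1.carrier) fun v => ?_
    have h := reassoc_mem_seqSet (c₁ := X.1.vecs) Y.dualPair Z.dualPair v
    rw [← vecs_seq, ← covecs_seq] at h
    refine Iff.trans (Eq.to_iff (congrArg (v ∈ ·) (vecs_seq X.1 (Y.1.seq Z.1))))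
      (h.trans (Eq.to_iff (congrArg (reassoc v ∈ ·) (vecs_seq (X.1.seq Y.1) Z.1))).symm)
  unit_left X := by
    refine ext_vecs (one_tensor X.1.carrier) fun v => ?_
    refine mem_iff_cast_left X.dualPair (dualPair_seq unit X) (fun w hw => ?_)
      (fun w hw => ?_) v
    · exact Eq.mpr (congrArg (tens (A := one) 1 w ∈ ·) (vecs_seq PreCaus.unit X.1))
        (tens_mem_seqSet unit.dualPair X.dualPair (vecs_unit ▸ rfl) hw)
    · exact tens_mem_coseqSet unit.dualPair X.dualPair (covecs_unit ▸ rfl) hw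
  unit_right X := by
    refine ext_vecs (tensor_one X.1.carrier) fun v => ?_
    refine mem_iff_cast_right X.dualPair (dualPair_seq X unit) (fun w hw => ?_)
      (fun w hw => ?_) v
    · exact Eq.mpr (congrArg (tens (B := one) w 1 ∈ ·) (vecs_seq X.1 PreCaus.unit))
        (tens_mem_seqSet X.dualPair unit.dualPair hw (vecs_unit ▸ rfl))
    · exact tens_mem_coseqSet X.dualPair unit.dualPair hw (covecs_unit ▸ rfl)

instance : MonoidalCategory Caus := tensorStates.monoidalCategory

end Caus

/-! ### Symmetry, duality and interchange of `Caus` -/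

namespace Caus

open CPStar PreCaus

instance : SymmetricCategory Caus where
  braiding X Y :=
    { hom := ⟨swapMap X.1.carrier Y.1.carrier, comp_swapMap_mem_tensor X.1 Y.1⟩
      inv := ⟨swapMap Y.1.carrier X.1.carrier, comp_swapMap_mem_tensor Y.1 X.1⟩
      hom_inv_id := hom_ext (swapMap_swapMap X.1.carrier Y.1.carrier)
      inv_hom_id := hom_ext (swapMap_swapMap Y.1.carrier X.1.carrier) }
  braiding_naturality_right X _ _ f :=
    hom_ext (BraidedCategory.braiding_naturality_right X.1.carrier f.map)
  braiding_naturality_left f Z :=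
    hom_ext (BraidedCategory.braiding_naturality_left f.map Z.1.carrier)
  hexagon_forward X Y Z :=
    hom_ext (BraidedCategory.hexagon_forward X.1.carrier Y.1.carrier Z.1.carrier)
  hexagon_reverse X Y Z :=
    hom_ext (BraidedCategory.hexagon_reverse X.1.carrier Y.1.carrier Z.1.carrier)
  symmetry X Y := hom_ext (swapMap_swapMap X.1.carrier Y.1.carrier)

/-- By closure only products of a state `σ` with a transposed effect `π` are tested; on these the
counit evaluates to `π σ = 1`. -/
theorem comp_ev_mem (X : Caus) :
    ∀ ρ ∈ (X.1.tensor X.1.dual).states, ρ ≫ ev X.1.carrier ∈ PreCaus.unit.states := by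
  intro ρ hρ
  refine hρ (ev X.1.carrier) ?_
  rintro τ ⟨σ, hσ, σ', ⟨π, hπ, e'⟩, e⟩
  refine (comp_effect_eq τ (ev X.1.carrier)).2 ?_
  refine Eq.trans ?_ ((comp_effect_eq σ π).1 (hπ σ hσ))
  refine (sum_pr_conj_right (A := X.1.carrier) (B := X.1.carrier) _).trans ?_
  refine Finset.sum_congr rfl fun i _ => ?_
  rw [Finset.sum_eq_single i]
  · have h1 : covec (ev X.1.carrier) (pr (B := X.1.carrier.conj) i i) = 1 :=
      (ev_mat X.1.carrier (0 : Fin 1) i i).trans (if_pos rfl)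
    have h2 : vec τ (pr (B := X.1.carrier.conj) i i) = vec σ i * covec π i :=
      (e i i).trans (congrArg (vec σ i * ·) (e' i))
    rw [h2]
    refine (congrArg (· * _) h1).trans ?_
    rw [one_mul, mul_comm]
  · intro j _ hj
    have h1 : covec (ev X.1.carrier) (pr (B := X.1.carrier.conj) i j) = 0 :=
      (ev_mat X.1.carrier (0 : Fin 1) i j).trans (if_neg hj.symm)
    exact (congrArg (· * _) h1).trans (zero_mul _)
  · exact fun h => absurd (Finset.mem_univ _) h

/-- Pairing the bent morphism at `σ` with a state `ρ` gives `p (ρ ⊗ σ)`, which is 1 by hypothesis.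
-/
theorem comp_bend_mem {X Y : Caus} (p : X.1.carrier ⊗ Y.1.carrier ⟶ 𝟙_ CPStar)
    (hp : ∀ ρ ∈ (X.1.tensor Y.1).states, ρ ≫ p ∈ PreCaus.unit.states) :
    ∀ σ ∈ Y.1.states, σ ≫ CompactClosed.bend p ∈ X.1.dual.states := by
  intro σ hσ
  refine vec_mem_vecs.1 ?_
  rw [vecs_dual]
  refine mem_covecs_iff.2 ⟨isPos_vec (A := X.1.carrier.conj) (σ ≫ CompactClosed.bend p), ?_⟩
  rintro _ ⟨ρ, hρ, rfl⟩
  let τ : one ⟶ X.1.carrier ⊗ Y.1.carrier := toState _ ((isPos_vec ρ).tens (isPos_vec σ))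
  have hτ : τ ∈ (X.1.tensor Y.1).states := fun π hπ =>
    hπ _ ⟨ρ, hρ, σ, hσ, fun i j => tens_pr (vec ρ) (vec σ) i j⟩
  have h := (comp_effect_eq τ p).1 (hp τ hτ)
  refine Eq.trans ?_ h
  refine Eq.trans ?_ (dot_tens (covec p) (vec ρ) (vec σ)).symm
  refine Finset.sum_congr rfl fun i _ => congrArg (· * _) ?_
  refine (comp_mat_apply σ (CompactClosed.bend p) i (0 : Fin 1)).trans ?_
  refine Finset.sum_congr rfl fun j _ => ?_
  refine (congrArg (· * _) (bend_mat p (0 : Fin 1) i j)).trans (mul_comm _ _)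

/-- This is closedness, `c = c**`, together with the strict double conjugation of carriers. -/
theorem dual_dual (X : Caus) : X.1 = X.1.dual.dual := by
  refine ext_vecs (conj_conj X.1.carrier).symm fun v => ?_
  refine Eq.to_iff (congrArg (v ∈ ·) ?_)
  exact (vecs_dual X.1.dual).trans (covecs_dual X)

/-- Transposition of a morphism into the dualizing object. -/
def lift {X Y : Caus} (p : X ⊗ Y ⟶ unit) : Y ⟶ dual X :=
  ⟨CompactClosed.bend p.map, comp_bend_mem p.map p.preserves⟩

instance : StarAutonomous Caus where
  bot := unit
  dual := dual
  ev X := ⟨ev X.1.carrier, comp_ev_mem X⟩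
  lift := lift
  lift_ev p := hom_ext (CompactClosed.bendAlong_ev (CompactClosed.dual _) _ p.map)
  lift_unique f := hom_ext (CompactClosed.bendAlong_unique (CompactClosed.dual _) _ f.map)
  reflexive X := by
    have h : lift (X := dual X) ((β_ (dual X) X).hom ≫ ⟨ev X.1.carrier, comp_ev_mem X⟩) =
        (isoOfEq (X := X) (Y := dual (dual X)) (dual_dual X)).hom :=
      hom_ext (doubleDual_eq X.1.carrier)
    rw [h]
    infer_instance

theorem dual_unit : PreCaus.unit.dual = PreCaus.unit := by
  refine ext_vecs conj_one fun v => Eq.to_iff (congrArg (v ∈ ·) ?_)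
  exact vecs_unit.trans (((vecs_dual PreCaus.unit).trans covecs_unit).symm)

/-- Self-duality of one-way signalling (`dualPair_seqSet`, through `covecs_seq`) makes the two
objects equal, so `κ` can be taken over an `eqToHom`. -/
theorem seq_dual (X Y : Caus) : X.1.dual.seq Y.1.dual = (X.1.seq Y.1).dual := by
  refine ext_vecs (conj_tensor X.1.carrier Y.1.carrier).symm fun v => ?_
  refine (Eq.to_iff (congrArg (v ∈ ·) ((vecs_dual _).trans (covecs_seq X Y)))).trans
    (mem_coseqSet_iff.trans ?_)
  refine Eq.to_iff (congrArg (v ∈ ·) ((vecs_seq X.1.dual Y.1.dual).trans ?_).symm)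
  exact congrArg₂ (seqSet X.1.carrier.conj Y.1.carrier.conj) (vecs_dual X.1) (covecs_dual Y)

theorem vecs_par (X Y : Caus) : (StarAutonomous.par X Y).1.vecs =
    cotensSet X.1.carrier.conj Y.1.carrier.conj X.1.covecs Y.1.covecs :=
  ((vecs_dual _).trans (covecs_tensor (dual X) (dual Y))).trans
    (congrArg₂ (cotensSet X.1.carrier.conj Y.1.carrier.conj) (vecs_dual X.1) (vecs_dual Y.1))

theorem covecs_par (X Y : Caus) : (StarAutonomous.par X Y).1.covecs =
    tensSet X.1.carrier.conj Y.1.carrier.conj X.1.covecs Y.1.covecs :=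
  ((covecs_dual (tensorStates.obj (dual X) (dual Y))).trans (vecs_tensor _ _)).trans
    (congrArg₂ (tensSet X.1.carrier.conj Y.1.carrier.conj) (vecs_dual X.1) (vecs_dual Y.1))

theorem interchange_pr {A B E F : CPStar}
    (ρ : one ⟶ StarAutonomous.par A B ⊗ StarAutonomous.par E F)
    (i : Fin A.dim) (j : Fin B.dim) (k : Fin E.dim) (l : Fin F.dim) :
    vec (ρ ≫ interchange A B E F)
      (pr (A := A ⊗ E) (B := B ⊗ F) (pr i k) (pr j l)) =
    vec ρ (pr (A := A ⊗ B) (B := E ⊗ F) (pr i j) (pr k l)) := by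
  have e : ρ ≫ interchange A B E F = ((ρ ≫ eqToHom (congrArg₂ (· ⊗ ·) (par_eq A B) (par_eq E F))) ≫
      tensorμ A B E F) ≫ eqToHom (par_eq (A ⊗ E) (B ⊗ F)).symm := by
    simp only [interchange, Category.assoc]
  rw [e]
  refine (comp_eqToHom_mat (A := one) _ (par_eq (A ⊗ E) (B ⊗ F)).symm _ (0 : Fin 1)).trans ?_
  refine (comp_tensorμ_mat (ρ ≫ eqToHom _) i j k l (0 : Fin 1)).trans ?_
  exact comp_eqToHom_mat ρ _ _ (0 : Fin 1)

/-- States of a par are those normalised on products of dual effects. For the two `<`-objects these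
effects are in `coseqSet`, so the claim becomes `tens_dot_interchange`. -/
theorem comp_interchange_mem (X Y Z W : Caus) :
    ∀ ρ ∈ ((StarAutonomous.par X Y).1.seq (StarAutonomous.par Z W).1).states,
      ρ ≫ interchange X.1.carrier Y.1.carrier Z.1.carrier W.1.carrier ∈
        (StarAutonomous.par (seqStates.obj X Z) (seqStates.obj Y W)).1.states := by
  intro ρ hρ
  have h := vec_mem_vecs.2 hρ
  rw [vecs_seq] at h
  obtain ⟨-, m, hm, h⟩ := h
  rw [vecs_par] at hm
  rw [covecs_par] at h
  refine vec_mem_vecs.1 ?_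
  rw [vecs_par]
  refine ⟨isPos_vec (ρ ≫ interchange X.1.carrier Y.1.carrier Z.1.carrier W.1.carrier),
    fun a ha b hb => ?_⟩
  refine (dotProduct_comm _ _).trans ?_
  refine tens_dot_interchange (d₁ := X.1.covecs) (d₂ := Y.1.covecs) Z.dualPair W.dualPair
    (interchange_pr (A := X.1.carrier) (B := Y.1.carrier) (E := Z.1.carrier) (F := W.1.carrier) ρ)
    (m := m) (fun π hπ π' hπ' => ?_) (fun π hπ π' hπ' => ?_)
    (covecs_seq X Z ▸ ha) (covecs_seq Y W ▸ hb)
  · exact (dotProduct_comm _ _).trans (hm.2 π hπ π' hπ')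
  -- Of all effects dual to the second par, only product effects are needed.
  · exact h _ (tens_mem_tensSet Z.dualPair.symm W.dualPair.symm hπ hπ')

theorem faithful_forget : forget.Faithful where
  map_injective h := hom_ext h

theorem isStrictStarAutonomous_forget : IsStrictStarAutonomous forget where
  toIsStrictMonoidal := tensorStates.isStrictMonoidal_forget
  map_braiding _ _ := HEq.rfl
  obj_bot := rfl
  obj_dual _ := rfl
  map_ev _ := HEq.rfl
  map_dual _ := HEq.rfl

/-- `Caus[CP*[FHilb_sk]]` is a strong BV-category. -/
def strongBVCategory : StrongBVCategory Caus CPStar forget where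
  isomix := isoOfEq dual_unit
  seq := ⟨seqStates.monoidalCategory⟩
  seq_unit := rfl
  κ X Y := isoOfEq (seq_dual X Y)
  κ_natural f g := hom_ext (deMorgan_natural f.map g.map)
  q X Y Z W := ⟨interchange X.1.carrier Y.1.carrier Z.1.carrier W.1.carrier,
    comp_interchange_mem X Y Z W⟩
  q_natural a b e f := hom_ext (interchange_natural a.map b.map e.map f.map)
  strictD := isStrictCompactClosed
  faithful := faithful_forget
  strict_star := isStrictStarAutonomous_forget
  strict_seq := seqStates.isStrictMonoidal_forget
  map_κ X Y := eqToHom_heq_id (conj_tensor X.1.carrier Y.1.carrier).symm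
  map_q _ _ _ _ := eqToHom_comp_comp_eqToHom_heq _ _ _

end Caus

theorem mainTheorem9 :
    ∃ S : StrongBVCategory Caus CPStar Caus.forget,
      -- the compact closed structure of `CP*[FHilb_sk]` is the standard one
      S.tensD.tensorUnit = CPStar.one ∧
      (∀ A B : CPStar, S.tensD.tensorObj A B = A.tensor B) ∧
      (∀ (A A' B B' : CPStar) (f : A ⟶ A') (g : B ⟶ B'),
        (S.tensD.tensorHom f g).mat ≍ CPStar.kron f.mat g.mat) ∧
      (∀ A B : CPStar, (S.symmD.braiding A B).hom.mat ≍ CPStar.swap A.dim B.dim) ∧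
      (∀ A : CPStar, S.compactD.dual A = A.conj) ∧
      (∀ A : CPStar, (@CompactClosed.counit CPStar _ S.tensD S.symmD S.compactD A).mat ≍
        CPStar.cap A.dim) ∧
      -- the objects of `Caus[CP*[FHilb_sk]]` are combined as prescribed
      S.tens.tensorUnit.1 = PreCaus.unit ∧
      S.star.bot.1 = PreCaus.unit ∧
      (∀ X Y : Caus, (S.tens.tensorObj X Y).1 = X.1.tensor Y.1) ∧
      (∀ X Y : Caus, (S.seq.obj X Y).1 = X.1.seq Y.1) ∧
      (∀ X : Caus, (S.star.dual X).1 = X.1.dual) := by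
  exact ⟨Caus.strongBVCategory, rfl, fun _ _ => rfl, fun _ _ _ _ _ _ => HEq.rfl,
    fun _ _ => HEq.rfl, fun _ => rfl, fun _ => HEq.rfl, rfl, rfl, fun _ _ => rfl, fun _ _ => rfl,
    fun _ => rfl⟩
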